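/- Let $R\ge 1$ and let $b_1,\dots,b_R$ be nonzero complex numbers; put $a_r=1/b_r^2$. For a finite family $(e_r)$ of complex end-points (repetitions allowed) and times $0<\tau_k,\tau_\ell<1$, the extended kernel of the (possibly fictitious) model of nonintersecting Brownian paths starting at $0$ at time $0$ and ending at the $e_r$ at time $1$ is $K_{k\ell}=H_{k\ell}-E_{k\ell}$. Here $E_{k\ell}(x,y)=P(x,y,\tau_\ell-\tau_k)$ for $\tau_k<\tau_\ell$ and $k<\ell$, with $P(x,y,\sigma)=(\pi\sigma)^{-1/2}e^{-(x-y)^2/\sigma}$, and $E_{k\ell}=0$ for $k\ge\ell$; and $$H_{k\ell}(x,y)=-\frac{1}{2\pi^2}\frac{e^{\frac{y^2}{1-\tau_\ell}-\frac{x^2}{1-\tau_k}}}{\sqrt{(1-\tau_k)(1-\tau_\ell)}}\int_{C_0}\int_{L} e^{-\frac{\tau_k}{1-\tau_k}t^2+\frac{2xt}{1-\tau_k}+\frac{\tau_\ell}{1-\tau_\ell}s^2-\frac{2sy}{1-\tau_\ell}}\prod_r\frac{s-e_r}{t-e_r}\,\frac{ds\,dt}{s-t},$$ where $C_0$ is a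 counterclockwise circle $|t|=\rho$ surrounding all $e_r$ and $L$ is an upward vertical line $\mathrm{Re}\,s=c$ with $|c|>\rho$ (so that $C_0$ lies to one side of $L$). (1) The $a_r$ are the roots, with multiplicity, of $$a^R-a^{R-1}+\tfrac1{2!}a^{R-2}-\cdots+\tfrac{(-1)^R}{R!}=0$$ if and only if $\sum_r a_r=1$ and $\sum_r a_r^k=0$ for $2\le k\le R$. (2) Assume this is the case. Then $\sum_r a_r^{R+1}=(-1)^{R+1}/R!$. Take the $2Rn$ end-points that consist of $n$ copies of each of $\pm n^{1/2}b_r$ $(r=1,\dots,R)$, put $\delta=R/(R+1)$, let $\tau_i,\tau_j$ be real, and let $$H_{n,ij}(x,y)=n^{-\delta/2}\,H_{ij}(n^{-\delta/2}x,\;n^{-\delta/2}y)$$ with the times $\tfrac12+n^{-\delta}\tau_i$, $\tfrac12+n^{-\delta}\tau_j$ in place of $\tau_i,\tau_j$; let $E_{n,ij}$ be obtained from $E_{ij}$ in the same way. Then $$\lim_{n\to\infty}H_{n,ij}(x,y)=H^{\lim}_{ij}(x,y):=-\frac1{\pi^2}\int_C\int_{-i\infty}^{i\infty} e^{\frac{(-1)^Rs^{2R+2}}{(R+1)!}+4\tau_js^2-4ys+\frac{(-1)^{R+1}t^{2R+2}}{(R+1)!}-4\tau_it^2+4xt}\,\frac{ds\,dt}{s-t}$$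 uniformly for real $x,y$ in any bounded set, and likewise for all partial derivatives in $x$ and $y$, for any choice of the admissible circles and lines for each $n$. Here $C$ consists of the rays from $\pm\infty e^{\frac{R}{2R+2}\pi i}$ to $0$ and the rays from $0$ to $\pm\infty e^{-\frac{R}{2R+2}\pi i}$. The double integral for $H^{\lim}_{ij}$ converges absolutely, $H^{\lim}_{ij}$ is $C^\infty$ in $(x,y)$, and so is $H_{n,ij}$ for all large $n$. Moreover $E_{n,ij}=E_{ij}$ for all $n\ge1$ when $\tau_i<\tau_j$, i.e. $E_{n,ij}(x,y)=P(x,y,\tau_j-\tau_i)$. -/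

import Mathlib

open Filter Topology Set
open scoped ContDiff

noncomputable section

namespace HigherPearcey

/-- The Brownian transition density `P(x, y, σ) = (πσ)^{-1/2} e^{-(x-y)²/σ}`. -/
def transitionDensity (x y σ : ℝ) : ℝ :=
  (Real.pi * σ) ^ (-(1 / 2) : ℝ) * Real.exp (-(x - y) ^ 2 / σ)

/-- The integrand of the extended kernel of nonintersecting Brownian paths that start at `0` at
time `0` and end at the (possibly complex, possibly repeated) points `e r` at time `1`; `τ` is the
time that goes with `x`, and `τ'` the time that goes with `y`. -/
def pathIntegrand {ι : Type} [Fintype ι] (e : ι → ℂ) (τ τ' x y : ℝ) (s t : ℂ) : ℂ :=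
  Complex.exp (-((τ / (1 - τ) : ℝ) : ℂ) * t ^ 2 + 2 * x * t / (1 - τ)
      + ((τ' / (1 - τ') : ℝ) : ℂ) * s ^ 2 - 2 * s * y / (1 - τ'))
    * (∏ r, (s - e r) / (t - e r)) / (s - t)

/-- The main part `H` of the extended kernel. The `t`-contour is the circle `|t| = ρ`, described
counterclockwise, and the `s`-contour is the upward vertical line `Re s = c`. It is used with
`|e r| < ρ < |c|` for all `r`: the `t`-contour surrounds all end-points and lies to one side of the
`s`-contour. -/
def pathKernel {ι : Type} [Fintype ι] (e : ι → ℂ) (ρ c : ℝ) (τ τ' x y : ℝ) : ℂ :=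
  -(1 / (2 * (Real.pi : ℂ) ^ 2)) * ((1 / Real.sqrt ((1 - τ) * (1 - τ')) : ℝ) : ℂ)
    * ((Real.exp (y ^ 2 / (1 - τ') - x ^ 2 / (1 - τ)) : ℝ) : ℂ)
    * ∮ t in C(0, ρ), ∫ v : ℝ,
        pathIntegrand e τ τ' x y ((c : ℂ) + (v : ℂ) * Complex.I) t * Complex.I

/-- The `2Rn` end-points: each of `n^{1/2} b_r` and `-n^{1/2} b_r` is repeated `n` times. -/
def endPoints {R : ℕ} (b : Fin R → ℂ) (n : ℕ) : Fin R × Bool × Fin n → ℂ :=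
  fun p => (if p.2.1 then 1 else -1) * ((Real.sqrt n : ℝ) : ℂ) * b p.1

/-- The scaling exponent `δ = R / (R + 1)`. -/
def scalingExponent (R : ℕ) : ℝ := (R : ℝ) / ((R : ℝ) + 1)

/-- The time `1/2 + n^{-δ} τ`. -/
def scaledTime (R n : ℕ) (τ : ℝ) : ℝ := 1 / 2 + (n : ℝ) ^ (-scalingExponent R) * τ

/-- The position `n^{-δ/2} x`. -/
def scaledPos (R n : ℕ) (x : ℝ) : ℝ := (n : ℝ) ^ (-(scalingExponent R / 2)) * x

/-- The rescaled kernel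
`H_{n,ij}(x, y) = n^{-δ/2} H_{ij}(n^{-δ/2} x, n^{-δ/2} y)` at the times `1/2 + n^{-δ} τ_i` and
`1/2 + n^{-δ} τ_j`, for the `2Rn` end-points `± n^{1/2} b_r`. -/
def rescaledKernel {R : ℕ} (b : Fin R → ℂ) (n : ℕ) (ρ c : ℝ) (τi τj x y : ℝ) : ℂ :=
  (((n : ℝ) ^ (-(scalingExponent R / 2)) : ℝ) : ℂ)
    * pathKernel (endPoints b n) ρ c (scaledTime R n τi) (scaledTime R n τj)
        (scaledPos R n x) (scaledPos R n y)

/-- The rescaled Gaussian part `E_{n,ij}(x, y)` of the extended kernel `K = H - E` (for `i < j`). -/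
def rescaledGaussian (R n : ℕ) (τi τj x y : ℝ) : ℝ :=
  (n : ℝ) ^ (-(scalingExponent R / 2))
    * transitionDensity (scaledPos R n x) (scaledPos R n y)
        (scaledTime R n τj - scaledTime R n τi)

/-- The integrand of the limiting kernel. -/
def limitIntegrand (R : ℕ) (τi τj x y : ℝ) (s t : ℂ) : ℂ :=
  Complex.exp ((-1) ^ R * s ^ (2 * R + 2) / ((R + 1).factorial : ℂ) + 4 * τj * s ^ 2 - 4 * y * s
      + (-1) ^ (R + 1) * t ^ (2 * R + 2) / ((R + 1).factorial : ℂ) - 4 * τi * t ^ 2 + 4 * x * t)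
    / (s - t)

/-- The direction `e^{Rπi/(2R+2)}`. -/
def rayDir (R : ℕ) : ℂ :=
  Complex.exp (((R : ℂ) * Real.pi / (2 * R + 2)) * Complex.I)

/-- The integral of `f` over the ray from `0` to `∞ · w`. -/
def rayIntegral (w : ℂ) (f : ℂ → ℂ) : ℂ := ∫ r in Ioi (0 : ℝ), f ((r : ℂ) * w) * w

/-- The integral of `f` over the contour `C`: the rays from `± ∞ e^{Rπi/(2R+2)}` to `0` and the
rays from `0` to `± ∞ e^{-Rπi/(2R+2)}`. -/
def contourIntegral (R : ℕ) (f : ℂ → ℂ) : ℂ :=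
  -rayIntegral (rayDir R) f - rayIntegral (-rayDir R) f
    + rayIntegral (rayDir R)⁻¹ f + rayIntegral (-(rayDir R)⁻¹) f

/-- The limiting kernel; `s` runs up the imaginary axis and `t` over `C`. -/
def limitKernel (R : ℕ) (τi τj x y : ℝ) : ℂ :=
  -(1 / (Real.pi : ℂ) ^ 2)
    * contourIntegral R fun t =>
        ∫ v : ℝ, limitIntegrand R τi τj x y ((v : ℂ) * Complex.I) t * Complex.I

/-- The partial derivative `∂_x^p ∂_y^q F`. -/
def partialDeriv (p q : ℕ) (F : ℝ → ℝ → ℂ) (z : ℝ × ℝ) : ℂ :=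
  iteratedDeriv p (fun x => iteratedDeriv q (fun y => F x y) z.2) z.1

end HigherPearcey

end

noncomputable section

namespace HigherPearcey

/-! ### Newton's identities and the end-points -/

/-! The polynomial condition says that `∏ (1 - a_r u)` is the Taylor polynomial `T(-u)` of degree
`R` of `exp (-u)`. Newton's identities translate this into power sums, and the vanishing of the
elementary symmetric function of degree `R + 1` in `R` variables gives the next power sum.

For the limit, put `s = n^{1/2} σ` and `t = n^{1/2} κ`. The end-points `± n^{1/2} b_r` contribute
`T(-σ²)^n / T(-κ²)^n`, and at times near `1/2` the Gaussian exponents are `n σ² - n κ²` to leading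
order. Together they form `Q(-σ²)^n / Q(-κ²)^n` with `Q(w) = T(w) exp(-w)` (`expQuot`). Since `Q' =
-w^R exp(-w) / R!`, `Q(w) = 1 - w^{R+1}/(R+1)! + …` near `0`. With `σ = h s`, `h = n^{-1/(2R+2)}`
(`fineScale`), one has `n h^{2R+2} = 1`, so `Q(-σ²)^n` tends to `exp((-1)^R s^{2R+2}/(R+1)!)`, and
the deviations of the times from `1/2` leave the quadratic and linear exponents (`pathIntegrand_eq`,
`tendsto_weight`).

The contours must keep `|Q|` small for `s` and large for `t`. On the imaginary axis `w = -σ²` is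
nonnegative and `Q` decreases from `1` (`norm_expQuot_ofReal_le`). For `t`, `w` follows the ray of
angle `π/(R+1)` up to modulus `1` (`expQuot_ray_lower`), then the curve on which the phase `(R+1)θ -
r sin θ` of the logarithmic derivative direction `w Q'(w)` is constant up to sign, so that `Re Q`
keeps growing (`one_add_gapConst_le_curve`), and finally a distant arc (`exists_closing_arc`). No
zero of `Q` lies between the imaginary axis and this contour (`expQuot_cexp_ne_zero`), so a large
circle can be deformed into it.

The pole at `s = t` is kept out of the way by replacing `N(s) D(t)/(s - t)` with `D(t)` times the
difference quotient of `N`. This changes nothing while `s` is outside the circle, and makes the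
inner integral entire in `s`. The line can then be moved to the imaginary axis, and the added term
vanishes there again because the new contour does not wind around imaginary points
(`circle_line_eq_deformed`).

The kernel is now a finite sum of two-variable Laplace integrals. The ray parts converge by
domination, the singularity of `1/(s - t)` being of order `(|s||t|)^{-1/2}` at worst; the other
parts are killed by a factor `(1 + g)^{-n}`. Everything is entire in complex `(x, y)` and converges
locally uniformly, so Cauchy's estimates carry the convergence to all partial derivatives. -/

/-- Newton's identities for a finite family of complex numbers. -/
theorem newton_identity {R : ℕ} (a : Fin R → ℂ) (k : ℕ) :
    (k : ℂ) * MvPolynomial.aeval a (MvPolynomial.esymm (Fin R) ℂ k) =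
      (-1) ^ (k + 1) * ∑ i ∈ Finset.range k,
        (-1) ^ i * MvPolynomial.aeval a (MvPolynomial.esymm (Fin R) ℂ i) *
          ∑ r, a r ^ (k - i) := by
  have h := congrArg (MvPolynomial.aeval a) (MvPolynomial.mul_esymm_eq_sum (Fin R) ℂ k)
  simp only [map_mul, map_natCast, map_pow, map_neg, map_one, map_sum] at h
  rw [h]
  congr 1
  rw [Finset.sum_filter, Finset.Nat.sum_antidiagonal_eq_sum_range_succ_mk,
    Finset.sum_range_succ, if_neg (lt_irrefl k), add_zero]
  refine Finset.sum_congr rfl fun i hi => ?_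
  rw [if_pos (Finset.mem_range.1 hi)]
  simp [MvPolynomial.psum]

theorem prod_X_sub_C_eq {R : ℕ} (a : Fin R → ℂ) :
    ∏ r, (Polynomial.X - Polynomial.C (a r)) =
      ∑ k ∈ Finset.range (R + 1), Polynomial.C ((-1 : ℂ) ^ k *
        MvPolynomial.aeval a (MvPolynomial.esymm (Fin R) ℂ k)) * Polynomial.X ^ (R - k) := by
  have h := Multiset.prod_X_sub_X_eq_sum_esymm (Finset.univ.val.map a)
  rw [Multiset.map_map] at h
  simp only [Multiset.card_map, Finset.card_val, Finset.card_univ, Fintype.card_fin] at h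
  have h2 : (Multiset.map ((fun t => Polynomial.X - Polynomial.C t) ∘ a) Finset.univ.val).prod
      = ∏ r, (Polynomial.X - Polynomial.C (a r)) := rfl
  rw [← h2, h]
  refine Finset.sum_congr rfl fun k _ => ?_
  rw [MvPolynomial.aeval_esymm_eq_multiset_esymm]
  simp [mul_assoc]

/-- The coefficients determine the polynomial written in descending powers. -/
theorem sum_C_mul_X_pow_sub_inj {R : ℕ} (u v : ℕ → ℂ) :
    (∑ k ∈ Finset.range (R + 1), Polynomial.C (u k) * Polynomial.X ^ (R - k) =
      ∑ k ∈ Finset.range (R + 1), Polynomial.C (v k) * Polynomial.X ^ (R - k)) ↔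
    ∀ k ≤ R, u k = v k := by
  constructor
  · intro h k hk
    have h1 := congrArg (fun p => Polynomial.coeff p (R - k)) h
    simp only [Polynomial.finsetSum_coeff, Polynomial.coeff_C_mul_X_pow] at h1
    rw [Finset.sum_eq_single_of_mem k (by simp; omega),
      Finset.sum_eq_single_of_mem k (by simp; omega)] at h1
    · simpa using h1
    · intro b hb hbk
      rw [if_neg]
      simp at hb; omega
    · intro b hb hbk
      rw [if_neg]
      simp at hb; omega
  · intro h
    refine Finset.sum_congr rfl fun k hk => ?_
    rw [h k (by simp at hk; omega)]

theorem prod_eq_iff_esymm {R : ℕ} (a : Fin R → ℂ) :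
    (∏ r, (Polynomial.X - Polynomial.C (a r)) =
      ∑ k ∈ Finset.range (R + 1),
        Polynomial.C ((-1 : ℂ) ^ k / (k.factorial : ℂ)) * Polynomial.X ^ (R - k)) ↔
      ∀ k ≤ R, MvPolynomial.aeval a (MvPolynomial.esymm (Fin R) ℂ k) = 1 / (k.factorial : ℂ) := by
  rw [prod_X_sub_C_eq, sum_C_mul_X_pow_sub_inj (fun k => (-1 : ℂ) ^ k *
    MvPolynomial.aeval a (MvPolynomial.esymm (Fin R) ℂ k))
    (fun k => (-1 : ℂ) ^ k / (k.factorial : ℂ))]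
  refine forall₂_congr fun k _ => ?_
  rw [div_eq_mul_one_div, mul_right_inj' (pow_ne_zero _ (by norm_num))]

theorem aeval_esymm_zero {R : ℕ} (a : Fin R → ℂ) :
    MvPolynomial.aeval a (MvPolynomial.esymm (Fin R) ℂ 0) = 1 := by
  simp

/-- Inductively, all middle terms of Newton's identity for `k` vanish. What remains is `k e_k`
against `e_{k-1} p_1` and `p_k`; since `k / k! = 1 / (k-1)!`, the first two balance and `p_k = 0`.
-/
theorem powerSums_of_esymm {R : ℕ} (a : Fin R → ℂ)
    (h : ∀ k ≤ R, MvPolynomial.aeval a (MvPolynomial.esymm (Fin R) ℂ k) =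
      1 / (k.factorial : ℂ)) :
    (1 ≤ R → ∑ r, a r = 1) ∧ ∀ k, 2 ≤ k → k ≤ R → ∑ r, a r ^ k = 0 := by
  have h1 : 1 ≤ R → ∑ r, a r = 1 := by
    intro hR
    have := newton_identity a 1
    rw [h 1 hR] at this
    simpa using this.symm
  refine ⟨h1, ?_⟩
  intro k
  induction k using Nat.strong_induction_on with
  | _ k ih =>
    intro hk2 hkR
    obtain ⟨m, rfl⟩ : ∃ m, k = m + 2 := ⟨k - 2, by omega⟩
    have hN := newton_identity a (m + 2)
    rw [Finset.sum_range_succ, Finset.sum_range_succ', Finset.sum_eq_zero] at hN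
    · rw [h _ hkR, h (m + 1) (by omega), h 0 (by omega)] at hN
      simp only [Nat.sub_zero, show m + 2 - (m + 1) = 1 by omega, pow_one, h1 (by omega)] at hN
      have hf : (((m + 2).factorial : ℕ) : ℂ) = (m + 2) * ((m + 1).factorial : ℂ) := by
        rw [Nat.factorial_succ (m + 1)]; push_cast; ring
      rw [hf] at hN
      have hm : ((m : ℂ) + 2) ≠ 0 := by exact_mod_cast (by omega : m + 2 ≠ 0)
      have hfac : ((m + 1).factorial : ℂ) ≠ 0 := by exact_mod_cast (m + 1).factorial_ne_zero
      have hs : ((-1 : ℂ) ^ (m + 1)) * (-1) ^ (m + 1) = 1 := by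
        rw [← mul_pow]; simp
      have e1 : (((m + 2 : ℕ)) : ℂ) * (1 / ((m + 2) * ((m + 1).factorial : ℂ))) =
          1 / ((m + 1).factorial : ℂ) := by
        push_cast; field_simp
      rw [e1] at hN
      have e2 : ((-1 : ℂ) ^ (m + 2 + 1)) = (-1) ^ (m + 1) := by ring
      rw [e2] at hN
      have e3 : (-1 : ℂ) ^ (m + 1) * ∑ r, a r ^ (m + 2) = 0 := by
        simp only [Nat.factorial_zero, Nat.cast_one, div_one, pow_zero, one_mul, mul_one, zero_add]
          at hN
        linear_combination (-1) * hN - (1 / ((m + 1).factorial : ℂ)) * hs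
      exact (mul_eq_zero.1 e3).resolve_left (pow_ne_zero _ (by norm_num))
    · intro i hi
      have hi' := Finset.mem_range.1 hi
      rw [ih (m + 2 - (i + 1)) (by omega) (by omega) (by omega), mul_zero]

/-- Only `p_1 = 1` survives in Newton's identity, which becomes the recursion `k e_k = e_{k-1}` of
the inverse factorials. -/
theorem esymm_of_powerSums {R : ℕ} (a : Fin R → ℂ)
    (h1 : ∑ r, a r = 1) (h2 : ∀ k, 2 ≤ k → k ≤ R → ∑ r, a r ^ k = 0) :
    ∀ k ≤ R, MvPolynomial.aeval a (MvPolynomial.esymm (Fin R) ℂ k) =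
      1 / (k.factorial : ℂ) := by
  intro k
  induction k with
  | zero => intro _; rw [aeval_esymm_zero]; simp
  | succ m ih =>
    intro hm
    have hN := newton_identity a (m + 1)
    rw [Finset.sum_range_succ, Finset.sum_eq_zero, zero_add, ih (by omega)] at hN
    · have hm0 : ((m : ℂ) + 1) ≠ 0 := by exact_mod_cast (by omega : m + 1 ≠ 0)
      have hfac : (m.factorial : ℂ) ≠ 0 := by exact_mod_cast m.factorial_ne_zero
      have hs : ((-1 : ℂ) ^ m) * (-1) ^ m = 1 := by
        rw [← mul_pow]; simp
      simp only [show m + 1 - m = 1 by omega, pow_one, h1, mul_one] at hN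
      rw [Nat.factorial_succ, eq_div_iff (by exact_mod_cast (Nat.factorial_pos (m+1)).ne')]
      have e2 : ((-1 : ℂ) ^ (m + 1 + 1)) = (-1) ^ m := by ring
      rw [e2, ← mul_assoc, hs, one_mul, eq_div_iff hfac] at hN
      push_cast at hN ⊢
      linear_combination hN
    · intro i hi
      have hi' := Finset.mem_range.1 hi
      rw [h2 _ (by omega) (by omega), mul_zero]

/-- With only `R` variables `e_{R+1} = 0`, so Newton's identity at `R + 1` balances the unknown
power sum against `e_R p_1 = 1 / R!`. -/
theorem powerSum_succ_of_esymm {R : ℕ} (hR : 1 ≤ R) (a : Fin R → ℂ)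
    (h : ∀ k ≤ R, MvPolynomial.aeval a (MvPolynomial.esymm (Fin R) ℂ k) =
      1 / (k.factorial : ℂ)) :
    ∑ r, a r ^ (R + 1) = (-1 : ℂ) ^ (R + 1) / (R.factorial : ℂ) := by
  obtain ⟨h1, h2⟩ := powerSums_of_esymm a h
  have hN := newton_identity a (R + 1)
  have h0 : MvPolynomial.esymm (Fin R) ℂ (R + 1) = 0 := by
    rw [MvPolynomial.esymm, Finset.powersetCard_eq_empty.2 (by simp), Finset.sum_empty]
  obtain ⟨m, rfl⟩ : ∃ m, R = m + 1 := ⟨R - 1, by omega⟩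
  rw [h0, map_zero, mul_zero, Finset.sum_range_succ, Finset.sum_range_succ',
    Finset.sum_eq_zero] at hN
  · rw [h (m + 1) le_rfl, h 0 (by omega)] at hN
    have hN' := (mul_eq_zero.1 hN.symm).resolve_left (pow_ne_zero _ (by norm_num))
    simp only [Nat.sub_zero, show m + 1 + 1 - (m + 1) = 1 by omega, pow_one, h1 (by omega)] at hN'
    simp only [Nat.factorial_zero, Nat.cast_one, div_one, pow_zero, one_mul, mul_one, zero_add]
      at hN'
    rw [pow_succ (-1 : ℂ) (m + 1)]
    linear_combination hN'
  · intro i hi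
    have hi' := Finset.mem_range.1 hi
    rw [h2 _ (by omega) (by omega), mul_zero]

/-! ### The end-point products in terms of the truncated exponential -/

/-- The Taylor polynomial of degree `R` of the exponential function. -/
def expTrunc (R : ℕ) (w : ℂ) : ℂ := ∑ k ∈ Finset.range (R + 1), w ^ k / (k.factorial : ℂ)

/-- This is the reversed polynomial: evaluate at `u⁻¹` and multiply by `u ^ R`. The point `u = 0` is
treated separately. -/
theorem prod_one_sub_mul {R : ℕ} (a : Fin R → ℂ)
    (h : ∏ r, (Polynomial.X - Polynomial.C (a r)) =
      ∑ k ∈ Finset.range (R + 1),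
        Polynomial.C ((-1 : ℂ) ^ k / (k.factorial : ℂ)) * Polynomial.X ^ (R - k)) (u : ℂ) :
    ∏ r, (1 - a r * u) = expTrunc R (-u) := by
  rcases eq_or_ne u 0 with rfl | hu
  · simp [expTrunc, Finset.sum_range_succ']
  · have h1 := congrArg (Polynomial.eval u⁻¹) h
    simp only [Polynomial.eval_prod, Polynomial.eval_sub, Polynomial.eval_X, Polynomial.eval_C,
      Polynomial.eval_finsetSum, Polynomial.eval_mul, Polynomial.eval_pow] at h1
    have h2 : ∏ r, (1 - a r * u) = u ^ R * ∏ r, (u⁻¹ - a r) := by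
      rw [show u ^ R = ∏ _r : Fin R, u by simp, ← Finset.prod_mul_distrib]
      refine Finset.prod_congr rfl fun r _ => ?_
      field_simp
    rw [h2, h1, Finset.mul_sum, expTrunc]
    refine Finset.sum_congr rfl fun k hk => ?_
    have hk' : k ≤ R := by simp at hk; omega
    have : u ^ R = u ^ k * u ^ (R - k) := by rw [← pow_add]; congr 1; omega
    rw [this, neg_pow u k, inv_pow]
    field_simp

/-- The quotient of node polynomials for the end-points `± n^{1/2} b_r`. -/
theorem prod_endPoints {R : ℕ} (b : Fin R → ℂ) (hb : ∀ r, b r ≠ 0)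
    (h : ∏ r, (Polynomial.X - Polynomial.C (1 / b r ^ 2)) =
      ∑ k ∈ Finset.range (R + 1),
        Polynomial.C ((-1 : ℂ) ^ k / (k.factorial : ℂ)) * Polynomial.X ^ (R - k))
    {n : ℕ} (hn : n ≠ 0) (s t : ℂ) :
    ∏ p, (s - endPoints b n p) / (t - endPoints b n p) =
      expTrunc R (-(s ^ 2 / n)) ^ n / expTrunc R (-(t ^ 2 / n)) ^ n := by
  have hn' : (n : ℂ) ≠ 0 := by exact_mod_cast hn
  have hsq : (((Real.sqrt n : ℝ) : ℂ)) ^ 2 = n := by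
    rw [← Complex.ofReal_pow, Real.sq_sqrt (Nat.cast_nonneg n)]; simp
  -- The two signs pair up to `s² - n b_r²`, which is `-n b_r²` times `1 - a_r s² / n`; the
  -- constants cancel in the quotient.
  have key : ∀ s : ℂ, ∏ p, (s - endPoints b n p) =
      (∏ r, (-(n * b r ^ 2))) ^ n * expTrunc R (-(s ^ 2 / n)) ^ n := by
    intro s
    rw [← prod_one_sub_mul _ h, ← mul_pow, ← Finset.prod_mul_distrib, ← Finset.prod_pow,
      Fintype.prod_prod_type]
    refine Finset.prod_congr rfl fun r _ => ?_
    rw [Fintype.prod_prod_type]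
    simp only [endPoints, Fintype.prod_bool, if_true, Bool.false_eq_true, if_false,
      Finset.prod_const, Finset.card_univ, Fintype.card_fin]
    rw [← mul_pow]
    congr 1
    have hbr := hb r
    field_simp
    linear_combination (-b r ^ 2) * hsq
  rw [Finset.prod_div_distrib, key, key, mul_div_mul_left]
  refine pow_ne_zero _ (Finset.prod_ne_zero_iff.2 fun r _ => neg_ne_zero.2 ?_)
  exact mul_ne_zero hn' (pow_ne_zero _ (hb r))

/-- This will show that every circle around the end-points also surrounds the singularities in the
rescaled variable. -/
theorem expTrunc_endPoints_eq_zero {R : ℕ} (b : Fin R → ℂ) (hb : ∀ r, b r ≠ 0)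
    (h : ∏ r, (Polynomial.X - Polynomial.C (1 / b r ^ 2)) =
      ∑ k ∈ Finset.range (R + 1),
        Polynomial.C ((-1 : ℂ) ^ k / (k.factorial : ℂ)) * Polynomial.X ^ (R - k))
    {n : ℕ} (hn : n ≠ 0) {t : ℂ} (ht : expTrunc R (-(t ^ 2 / n)) = 0) :
    ∃ r, ‖t‖ = Real.sqrt n * ‖b r‖ := by
  have hn' : (n : ℂ) ≠ 0 := by exact_mod_cast hn
  rw [← prod_one_sub_mul _ h, Finset.prod_eq_zero_iff] at ht
  obtain ⟨r, -, hr⟩ := ht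
  refine ⟨r, ?_⟩
  have hbr := hb r
  have h1 : t ^ 2 = n * b r ^ 2 := by
    field_simp at hr
    linear_combination -hr
  have h2 : ‖t‖ ^ 2 = (Real.sqrt n * ‖b r‖) ^ 2 := by
    rw [← norm_pow, h1, mul_pow, Real.sq_sqrt (Nat.cast_nonneg n)]; simp
  exact (sq_eq_sq₀ (norm_nonneg _) (by positivity)).1 h2

/-- Brownian scaling: positions shrink by the square root of the factor by which times shrink, and
the spatial factor restores the density. -/
theorem rescaledGaussian_eq (R : ℕ) {τi τj : ℝ} (h : τi < τj) {n : ℕ} (hn : 1 ≤ n) (x y : ℝ) :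
    rescaledGaussian R n τi τj x y = transitionDensity x y (τj - τi) := by
  have hn0 : (0 : ℝ) < n := by exact_mod_cast hn
  set δ := scalingExponent R with hδ
  have hd : 0 < τj - τi := sub_pos.2 h
  have ht : scaledTime R n τj - scaledTime R n τi = (n : ℝ) ^ (-δ) * (τj - τi) := by
    simp only [scaledTime, ← hδ]; ring
  have hp : (0 : ℝ) < (n : ℝ) ^ (-δ) := Real.rpow_pos_of_pos hn0 _
  have hsq : (n : ℝ) ^ (-δ) = ((n : ℝ) ^ (-(δ / 2))) ^ 2 := by
    rw [← Real.rpow_natCast, ← Real.rpow_mul hn0.le]; congr 1; push_cast; ring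
  have hq : (0 : ℝ) < (n : ℝ) ^ (-(δ / 2)) := Real.rpow_pos_of_pos hn0 _
  simp only [rescaledGaussian, transitionDensity, ht, scaledPos, ← hδ]
  rw [show Real.pi * ((n : ℝ) ^ (-δ) * (τj - τi)) = (n : ℝ) ^ (-δ) * (Real.pi * (τj - τi)) by ring,
    Real.mul_rpow hp.le (by positivity), ← mul_assoc, ← mul_assoc]
  congr 1
  · rw [hsq, ← Real.rpow_natCast, ← Real.rpow_mul hq.le]
    norm_num
    rw [Real.rpow_neg_one, mul_inv_cancel₀ hq.ne', one_mul]
  · congr 1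
    rw [hsq]
    field_simp

/-! ### The truncated exponential -/

/-- The quotient of the truncated exponential by the exponential. -/
def expQuot (R : ℕ) (w : ℂ) : ℂ := expTrunc R w * Complex.exp (-w)

theorem expTrunc_succ (R : ℕ) (w : ℂ) :
    expTrunc (R + 1) w = expTrunc R w + w ^ (R + 1) / ((R + 1).factorial : ℂ) := by
  rw [expTrunc, Finset.sum_range_succ, expTrunc]

theorem expTrunc_zero_right (R : ℕ) : expTrunc R 0 = 1 := by
  simp [expTrunc, Finset.sum_range_succ']

theorem expQuot_zero_right (R : ℕ) : expQuot R 0 = 1 := by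
  simp [expQuot, expTrunc_zero_right]

theorem hasDerivAt_expTrunc (R : ℕ) (w : ℂ) :
    HasDerivAt (expTrunc R) (expTrunc R w - w ^ R / (R.factorial : ℂ)) w := by
  induction R with
  | zero =>
    have : expTrunc 0 = fun _ => (1 : ℂ) := by funext z; simp [expTrunc]
    rw [this]
    simpa using hasDerivAt_const w (1 : ℂ)
  | succ R ih =>
    have h := ih.add ((hasDerivAt_pow (R + 1) w).div_const ((R + 1).factorial : ℂ))
    have h2 : expTrunc (R + 1) = fun z => expTrunc R z + z ^ (R + 1) / ((R + 1).factorial : ℂ) :=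
      funext fun z => expTrunc_succ R z
    rw [h2]
    refine h.congr_deriv ?_
    have hf : ((R + 1).factorial : ℂ) = (R + 1) * (R.factorial : ℂ) := by
      rw [Nat.factorial_succ]; push_cast; ring
    have h0 : (R.factorial : ℂ) ≠ 0 := by exact_mod_cast R.factorial_ne_zero
    have h1 : ((R : ℂ) + 1) ≠ 0 := by exact_mod_cast R.succ_ne_zero
    rw [hf]
    push_cast
    field_simp
    simp
    ring

/-- The Taylor sum telescopes, leaving one monomial times an exponential. All monotonicity arguments
below rest on this explicit phase and size. -/
theorem hasDerivAt_expQuot (R : ℕ) (w : ℂ) :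
    HasDerivAt (expQuot R) (-(w ^ R / (R.factorial : ℂ) * Complex.exp (-w))) w := by
  have h := (hasDerivAt_expTrunc R w).mul ((Complex.hasDerivAt_exp (-w)).comp w (hasDerivAt_neg w))
  refine h.congr_deriv ?_
  simp only [Function.comp]
  ring

theorem differentiable_expQuot (R : ℕ) : Differentiable ℂ (expQuot R) :=
  fun w => (hasDerivAt_expQuot R w).differentiableAt

theorem expQuot_conj (R : ℕ) (w : ℂ) :
    expQuot R ((starRingEnd ℂ) w) = (starRingEnd ℂ) (expQuot R w) := by
  simp only [expQuot, expTrunc, map_mul, map_sum, map_div₀, map_pow, map_natCast]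
  rw [← Complex.exp_conj, map_neg]

theorem expQuot_eq_zero_iff (R : ℕ) (w : ℂ) : expQuot R w = 0 ↔ expTrunc R w = 0 := by
  simp [expQuot, Complex.exp_ne_zero]

/-- `n (expQuot R w_n - 1)` converges if `w_n → 0` and `n w_n ^ (R + 1)` converges. -/
theorem tendsto_mul_expQuot_sub_one (R : ℕ) {w : ℕ → ℂ} {l : ℂ} (hw : Tendsto w atTop (𝓝 0))
    (hl : Tendsto (fun n : ℕ => (n : ℂ) * w n ^ (R + 1)) atTop (𝓝 l)) :
    Tendsto (fun n : ℕ => (n : ℂ) * (expQuot R (w n) - 1)) atTop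
      (𝓝 (-(l / ((R + 1).factorial : ℂ)))) := by
  -- The remainder contributes `n w^{R+2} = (n w^{R+1}) w → 0`, so only the term of degree `R + 1`
  -- is felt in the limit.
  have hO : (fun z : ℂ => Complex.exp z - expTrunc (R + 1) z) =O[𝓝 0] fun z => z ^ (R + 2) := by
    exact Complex.exp_sub_sum_range_isBigO_pow (R + 2)
  have h1 : (fun n : ℕ => (n : ℂ) * (Complex.exp (w n) - expTrunc (R + 1) (w n))) =O[atTop]
      fun n : ℕ => (n : ℂ) * w n ^ (R + 2) :=
    (Asymptotics.isBigO_refl _ _).mul (hO.comp_tendsto hw)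
  have h2 : Tendsto (fun n : ℕ => (n : ℂ) * w n ^ (R + 2)) atTop (𝓝 0) := by
    have := hl.mul hw
    rw [mul_zero] at this
    refine this.congr fun n => ?_
    ring
  have h3 := h1.trans_tendsto h2
  have h4 : Tendsto (fun n => Complex.exp (-(w n))) atTop (𝓝 1) := by
    have := (Complex.continuous_exp.tendsto 0).comp (hw.neg.trans (by rw [neg_zero]))
    simpa [Function.comp_def] using this
  have h5 := (((hl.div_const ((R + 1).factorial : ℂ)).add h3).mul h4).neg
  rw [add_zero, mul_one] at h5
  refine h5.congr fun n => ?_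
  have h6 : Complex.exp (w n) * Complex.exp (-(w n)) = 1 := by rw [← Complex.exp_add]; simp
  rw [expQuot, expTrunc_succ]
  linear_combination (-(n : ℂ)) * h6

/-! ### Decay of the quotient along the positive real axis -/

/-- A lower bound for the rates below. -/
def gapConst (R : ℕ) : ℝ := Real.exp (-1) / (2 * ((R + 1).factorial : ℝ))

theorem gapConst_pos (R : ℕ) : 0 < gapConst R := by
  have : (0 : ℝ) < ((R + 1).factorial : ℝ) := by exact_mod_cast Nat.factorial_pos _
  rw [gapConst]; positivity

theorem gapConst_le_one (R : ℕ) : gapConst R ≤ 1 := by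
  have : (1 : ℝ) ≤ ((R + 1).factorial : ℝ) := by exact_mod_cast Nat.factorial_pos _
  rw [gapConst, div_le_one (by positivity)]
  have : Real.exp (-1) ≤ 1 := Real.exp_le_one_iff.2 (by norm_num)
  linarith

/-- The real version of `expQuot`. -/
theorem expQuot_ofReal (R : ℕ) (x : ℝ) :
    expQuot R x = ((∑ k ∈ Finset.range (R + 1), x ^ k / (k.factorial : ℝ)) * Real.exp (-x) : ℝ) := by
  simp [expQuot, expTrunc]

theorem expQuot_ofReal_re_pos (R : ℕ) {x : ℝ} (hx : 0 ≤ x) : 0 < (expQuot R x).re := by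
  rw [expQuot_ofReal, Complex.ofReal_re]
  refine mul_pos ?_ (Real.exp_pos _)
  rw [Finset.sum_range_succ']
  have : 0 ≤ ∑ k ∈ Finset.range R, x ^ (k + 1) / ((k + 1).factorial : ℝ) :=
    Finset.sum_nonneg fun k _ => by positivity
  simp only [pow_zero, Nat.factorial_zero, Nat.cast_one, div_one]
  linarith

theorem norm_expQuot_ofReal (R : ℕ) {x : ℝ} (hx : 0 ≤ x) :
    ‖expQuot R x‖ = (expQuot R x).re := by
  have h := expQuot_ofReal_re_pos R hx
  rw [expQuot_ofReal, Complex.ofReal_re] at *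
  rw [Complex.norm_real, Real.norm_of_nonneg h.le]

theorem hasDerivAt_expQuot_ofReal_re (R : ℕ) (x : ℝ) :
    HasDerivAt (fun x : ℝ => (expQuot R x).re)
      (-(x ^ R / (R.factorial : ℝ) * Real.exp (-x))) x := by
  have h := (hasDerivAt_expQuot R x).real_of_complex
  refine h.congr_deriv ?_
  have : (-((x : ℂ) ^ R / (R.factorial : ℂ) * Complex.exp (-(x : ℂ)))) =
      ((-(x ^ R / (R.factorial : ℝ) * Real.exp (-x)) : ℝ) : ℂ) := by push_cast; ring
  rw [this, Complex.ofReal_re]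

theorem gapConst_mul_succ (R : ℕ) :
    gapConst R * ((R : ℝ) + 1) = Real.exp (-1) / (2 * (R.factorial : ℝ)) := by
  have : (R.factorial : ℝ) ≠ 0 := by exact_mod_cast R.factorial_ne_zero
  rw [gapConst, Nat.factorial_succ]
  push_cast
  field_simp

/-- On `[0, 1]` the factor `exp(-x)` is at least `exp(-1)`, so the derivative of `expQuot` is at
most `-exp(-1) x^R / R!`. This is twice what `gapConst` requires. -/
theorem expQuot_ofReal_re_le_of_le_one (R : ℕ) {x : ℝ} (hx : 0 ≤ x) (hx1 : x ≤ 1) :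
    (expQuot R x).re ≤ 1 - gapConst R * x ^ (R + 1) := by
  have hd : ∀ x : ℝ, HasDerivAt (fun x : ℝ => (expQuot R x).re + gapConst R * x ^ (R + 1))
      (-(x ^ R / (R.factorial : ℝ) * Real.exp (-x)) + gapConst R * (((R + 1 : ℕ) : ℝ) * x ^ R)) x := by
    intro x
    have := (hasDerivAt_expQuot_ofReal_re R x).fun_add ((hasDerivAt_pow (R + 1) x).const_mul (gapConst R))
    simpa using this
  have hanti : AntitoneOn (fun x : ℝ => (expQuot R x).re + gapConst R * x ^ (R + 1)) (Icc 0 1) := by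
    refine antitoneOn_of_deriv_nonpos (convex_Icc 0 1)
      (fun x _ => (hd x).continuousAt.continuousWithinAt)
      (fun x _ => (hd x).differentiableAt.differentiableWithinAt) ?_
    intro x hx
    rw [interior_Icc] at hx
    rw [(hd x).deriv]
    push_cast
    rw [← mul_assoc, gapConst_mul_succ]
    have h1 : Real.exp (-1) ≤ Real.exp (-x) := Real.exp_le_exp.2 (by linarith [hx.2])
    have h2 : 0 ≤ x ^ R / (R.factorial : ℝ) := by have := hx.1; positivity
    have h3 : Real.exp (-1) / (2 * (R.factorial : ℝ)) * x ^ R =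
      x ^ R / (R.factorial : ℝ) * (Real.exp (-1) / 2) := by ring
    rw [h3]
    have h4 := Real.exp_pos (-1)
    nlinarith [mul_le_mul_of_nonneg_left h1 h2, mul_nonneg h2 h4.le]
  have h := hanti (left_mem_Icc.2 zero_le_one) ⟨hx, hx1⟩ hx
  simp only [Complex.ofReal_zero, expQuot_zero_right, Complex.one_re] at h
  simp at h
  linarith

/-- The decay has order `x^{R+1}` near `0`, as in the limit, but is only exponential for large `x`;
the minimum records both regimes. -/
theorem norm_expQuot_ofReal_le (R : ℕ) {x : ℝ} (hx : 0 ≤ x) :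
    ‖expQuot R x‖ ≤ Real.exp (-(gapConst R * min (x ^ (R + 1)) x)) := by
  rw [norm_expQuot_ofReal R hx]
  have hc := gapConst_pos R
  rcases le_total x 1 with h1 | h1
  · have h2 : x ^ (R + 1) ≤ x := pow_le_of_le_one hx h1 (by omega)
    rw [min_eq_left h2]
    have := Real.add_one_le_exp (-(gapConst R * x ^ (R + 1)))
    linarith [expQuot_ofReal_re_le_of_le_one R hx h1]
  · have h2 : x ≤ x ^ (R + 1) := le_self_pow₀ h1 (by omega)
    rw [min_eq_right h2]
    have hd : ∀ x : ℝ, HasDerivAt (fun x : ℝ => Real.exp (gapConst R * x) * (expQuot R x).re)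
        (Real.exp (gapConst R * x) * (gapConst R) * (expQuot R x).re +
          Real.exp (gapConst R * x) * (-(x ^ R / (R.factorial : ℝ) * Real.exp (-x)))) x := by
      intro x
      have h0 : HasDerivAt (fun x : ℝ => gapConst R * x) (gapConst R) x := by
        simpa using (hasDerivAt_id x).const_mul (gapConst R)
      exact h0.exp.mul (hasDerivAt_expQuot_ofReal_re R x)
    have hanti : AntitoneOn (fun x : ℝ => Real.exp (gapConst R * x) * (expQuot R x).re)
        (Ici 1) := by
      refine antitoneOn_of_deriv_nonpos (convex_Ici 1)
        (fun x _ => (hd x).continuousAt.continuousWithinAt)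
        (fun x _ => (hd x).differentiableAt.differentiableWithinAt) ?_
      intro x hx
      rw [interior_Ici] at hx
      have hx1 : (1 : ℝ) < x := hx
      rw [(hd x).deriv, expQuot_ofReal, Complex.ofReal_re]
      -- For `x ≥ 1` every power in the Taylor sum is at most `x^R`, so the sum is at most `e x^R`.
      -- Since `gapConst R * e ≤ 1 / R!`, multiplication by `exp(gapConst R * x)` does not spoil the
      -- decrease.
      have hT : ∑ k ∈ Finset.range (R + 1), x ^ k / (k.factorial : ℝ) ≤ Real.exp 1 * x ^ R := by
        calc ∑ k ∈ Finset.range (R + 1), x ^ k / (k.factorial : ℝ)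
            ≤ ∑ k ∈ Finset.range (R + 1), ((1 : ℝ) ^ k / (k.factorial : ℝ)) * x ^ R := by
              refine Finset.sum_le_sum fun k hk => ?_
              rw [one_pow, div_mul_eq_mul_div, one_mul]
              have hk' : k ≤ R := by simp at hk; omega
              gcongr
              exact hx1.le
          _ = (∑ k ∈ Finset.range (R + 1), ((1 : ℝ) ^ k / (k.factorial : ℝ))) * x ^ R := by
              rw [Finset.sum_mul]
          _ ≤ Real.exp 1 * x ^ R := by
              gcongr
              exact Real.sum_le_exp_of_nonneg zero_le_one _
      have hf : (1 : ℝ) ≤ (R : ℝ) + 1 := by linarith [Nat.cast_nonneg (α := ℝ) R]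
      have hfac : (0 : ℝ) < (R.factorial : ℝ) := by exact_mod_cast R.factorial_pos
      have hg : gapConst R * Real.exp 1 ≤ 1 / (R.factorial : ℝ) := by
        have h3 : gapConst R ≤ gapConst R * ((R : ℝ) + 1) := le_mul_of_one_le_right hc.le hf
        rw [gapConst_mul_succ] at h3
        have h4 : Real.exp (-1) * Real.exp 1 = 1 := by rw [← Real.exp_add]; simp
        have h5 := mul_le_mul_of_nonneg_right h3 (Real.exp_pos 1).le
        refine h5.trans ?_
        rw [div_mul_eq_mul_div, h4]
        exact one_div_le_one_div_of_le hfac (by linarith)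
      have hxR : (0 : ℝ) < x ^ R := by positivity
      have h6 : gapConst R * ∑ k ∈ Finset.range (R + 1), x ^ k / (k.factorial : ℝ) ≤
          x ^ R / (R.factorial : ℝ) := by
        calc _ ≤ gapConst R * (Real.exp 1 * x ^ R) := by gcongr
          _ = (gapConst R * Real.exp 1) * x ^ R := by ring
          _ ≤ 1 / (R.factorial : ℝ) * x ^ R := by gcongr
          _ = _ := by ring
      have h7 : 0 < Real.exp (gapConst R * x) * Real.exp (-x) := by positivity
      have h8 := mul_le_mul_of_nonneg_left h6 h7.le
      linarith
    have h := hanti self_mem_Ici h1 h1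
    have h9 := expQuot_ofReal_re_le_of_le_one R zero_le_one le_rfl
    have h10 := Real.add_one_le_exp (-(gapConst R))
    simp only [one_pow, mul_one] at h h9
    have h11 : Real.exp (gapConst R) * (expQuot R ((1 : ℝ) : ℂ)).re ≤ 1 := by
      calc _ ≤ Real.exp (gapConst R) * Real.exp (-gapConst R) := by gcongr; linarith
        _ = 1 := by rw [← Real.exp_add]; simp
    have h12 : Real.exp (gapConst R * x) * (expQuot R x).re ≤ 1 := h.trans h11
    rw [Real.exp_neg, ← one_div, le_div_iff₀ (Real.exp_pos _)]
    linarith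

/-! ### Growth of the real part along the ray of angle `π / (R + 1)` -/

/-- The angle `π / (R + 1)`. -/
def rayAngle (R : ℕ) : ℝ := Real.pi / ((R : ℝ) + 1)

theorem rayAngle_pos (R : ℕ) : 0 < rayAngle R := by
  have := Real.pi_pos
  rw [rayAngle]; positivity

theorem rayAngle_le {R : ℕ} (hR : 1 ≤ R) : rayAngle R ≤ Real.pi / 2 := by
  have h1 : (1 : ℝ) ≤ R := by exact_mod_cast hR
  rw [rayAngle]
  exact div_le_div_of_nonneg_left Real.pi_pos.le (by norm_num) (by linarith)

theorem succ_mul_rayAngle (R : ℕ) : ((R : ℝ) + 1) * rayAngle R = Real.pi := by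
  rw [rayAngle]; field_simp

/-- In the coordinate `ζ = X + iθ` the derivative is minus an exponential, whose phase is `(R + 1) θ
- exp(X) sin θ`. This phase decides how `Re Q` varies along circles and along the curve below. -/
theorem hasDerivAt_expQuot_cexp (R : ℕ) (ζ : ℂ) :
    HasDerivAt (fun ζ => expQuot R (Complex.exp ζ))
      (-(1 / (R.factorial : ℂ) * Complex.exp ((R + 1) * ζ - Complex.exp ζ))) ζ := by
  have h := (hasDerivAt_expQuot R (Complex.exp ζ)).comp ζ (Complex.hasDerivAt_exp ζ)
  refine h.congr_deriv ?_
  rw [sub_eq_add_neg, Complex.exp_add, add_mul, one_mul, Complex.exp_add, Complex.exp_nat_mul]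
  ring

/-- On this ray `w^R dw = -r^R dr`, so `Re Q` grows at the rate `r^R / R!` times `Re exp(-w)`. As
`|w| ≤ 1 < π/3`, the latter is at least `exp(-1) / 2`; this explains the `2` in `gapConst`. -/
theorem expQuot_ray_lower (R : ℕ) {r : ℝ} (hr : 0 ≤ r) (hr1 : r ≤ 1) :
    1 + gapConst R * r ^ (R + 1) ≤ (expQuot R (r * Complex.exp (rayAngle R * Complex.I))).re := by
  set u : ℂ := Complex.exp (rayAngle R * Complex.I) with hu
  have hu1 : u ^ (R + 1) = -1 := by
    rw [hu, ← Complex.exp_nat_mul]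
    have : ((R + 1 : ℕ) : ℂ) * (rayAngle R * Complex.I) = Real.pi * Complex.I := by
      rw [← mul_assoc]
      congr 1
      exact_mod_cast succ_mul_rayAngle R
    rw [this, Complex.exp_pi_mul_I]
  have hn : ‖u‖ = 1 := Complex.norm_exp_ofReal_mul_I _
  have hd : ∀ x : ℝ, HasDerivAt
      (fun x : ℝ => (expQuot R (x * u)).re - gapConst R * x ^ (R + 1))
      (x ^ R / (R.factorial : ℝ) * (Complex.exp (-(x * u))).re -
        gapConst R * (((R + 1 : ℕ) : ℝ) * x ^ R)) x := by
    intro x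
    have h1 : HasDerivAt (fun z : ℂ => expQuot R (z * u))
        (-((x * u) ^ R / (R.factorial : ℂ) * Complex.exp (-(x * u))) * u) (x : ℂ) := by
      have := (hasDerivAt_expQuot R (x * u)).comp (x : ℂ) ((hasDerivAt_id (x : ℂ)).mul_const u)
      simpa [Function.comp_def] using this
    have h2 := h1.real_of_complex.sub ((hasDerivAt_pow (R + 1) x).const_mul (gapConst R))
    refine h2.congr_deriv ?_
    have h3 : -((x * u) ^ R / (R.factorial : ℂ) * Complex.exp (-(x * u))) * u =
        ((x ^ R / (R.factorial : ℝ) : ℝ) : ℂ) * Complex.exp (-(x * u)) := by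
      rw [mul_pow]
      push_cast
      have : u ^ R * u = -1 := by rw [← pow_succ, hu1]
      linear_combination (-(x : ℂ) ^ R / (R.factorial : ℂ) * Complex.exp (-(x * u))) * this
    rw [h3, Complex.re_ofReal_mul]
    simp
  have hmono : MonotoneOn (fun x : ℝ => (expQuot R (x * u)).re - gapConst R * x ^ (R + 1))
      (Icc 0 1) := by
    refine monotoneOn_of_deriv_nonneg (convex_Icc 0 1)
      (fun x _ => (hd x).continuousAt.continuousWithinAt)
      (fun x _ => (hd x).differentiableAt.differentiableWithinAt) ?_
    intro x hx
    rw [interior_Icc] at hx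
    rw [(hd x).deriv]
    push_cast
    rw [← mul_assoc, gapConst_mul_succ]
    have hnorm : ‖(x : ℂ) * u‖ ≤ 1 := by
      rw [norm_mul, hn, mul_one, Complex.norm_real, Real.norm_of_nonneg hx.1.le]; exact hx.2.le
    have hre : ((x : ℂ) * u).re ≤ 1 := (Complex.re_le_norm _).trans hnorm
    have him : |((x : ℂ) * u).im| ≤ 1 := (Complex.abs_im_le_norm _).trans hnorm
    have hcos : 1 / 2 ≤ Real.cos ((x : ℂ) * u).im := by
      rw [← Real.cos_abs, ← Real.cos_pi_div_three]
      refine Real.cos_le_cos_of_nonneg_of_le_pi (abs_nonneg _) (by linarith [Real.pi_pos]) ?_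
      linarith [Real.pi_gt_three]
    have hexp : Real.exp (-1) * (1 / 2) ≤ (Complex.exp (-(x * u))).re := by
      rw [Complex.exp_re, Complex.neg_re, Complex.neg_im, Real.cos_neg]
      exact mul_le_mul (Real.exp_le_exp.2 (by linarith)) hcos (by norm_num) (Real.exp_pos _).le
    have h2 : 0 ≤ x ^ R / (R.factorial : ℝ) := by have := hx.1; positivity
    have h3 : Real.exp (-1) / (2 * (R.factorial : ℝ)) * x ^ R =
      x ^ R / (R.factorial : ℝ) * (Real.exp (-1) * (1 / 2)) := by ring
    rw [h3, ← mul_sub]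
    exact mul_nonneg h2 (by linarith)
  have h := hmono (left_mem_Icc.2 zero_le_one) ⟨hr, hr1⟩ hr
  simp only [Complex.ofReal_zero, zero_mul, expQuot_zero_right, Complex.one_re] at h
  simp at h
  linarith

/-! ### Zero-free regions of the truncated exponential -/

theorem sum_mul_pow_div_factorial (R : ℕ) (w : ℂ) :
    ∑ k ∈ Finset.range (R + 1), (k : ℂ) * (w ^ k / (k.factorial : ℂ)) =
      w * expTrunc R w - w ^ (R + 1) / (R.factorial : ℂ) := by
  induction R with
  | zero => simp [expTrunc]
  | succ R ih =>
    rw [Finset.sum_range_succ, ih, expTrunc_succ]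
    have h0 : (R.factorial : ℂ) ≠ 0 := by exact_mod_cast R.factorial_ne_zero
    have h1 : ((R : ℂ) + 1) ≠ 0 := by exact_mod_cast R.succ_ne_zero
    have hf : ((R + 1).factorial : ℂ) = (R + 1) * (R.factorial : ℂ) := by
      rw [Nat.factorial_succ]; push_cast; ring
    rw [hf]
    push_cast
    field_simp
    ring

/-- The zeros of the truncated exponential lie in the closed disc of radius `R`. -/
theorem expTrunc_ne_zero_of_lt_norm (R : ℕ) {w : ℂ} (hw : (R : ℝ) < ‖w‖) : expTrunc R w ≠ 0 := by
  intro h0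
  -- An argument of Eneström–Kakeya type: at a zero the identity reduces to `w^{R+1} / R!` being a
  -- sum with coefficients `R - k ≥ 0`. The triangle inequality, compared with the same identity at
  -- `‖w‖`, then contradicts `R < ‖w‖`.
  have key : ∀ w : ℂ, ∑ k ∈ Finset.range (R + 1), ((R : ℂ) - k) * (w ^ k / (k.factorial : ℂ)) =
      (R - w) * expTrunc R w + w ^ (R + 1) / (R.factorial : ℂ) := by
    intro w
    have := sum_mul_pow_div_factorial R w
    simp only [sub_mul, Finset.sum_sub_distrib, this, ← Finset.mul_sum]
    rw [expTrunc]; ring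
  have h1 := key w
  rw [h0, mul_zero, zero_add] at h1
  have h2 := key ((‖w‖ : ℝ) : ℂ)
  have h3 : ‖w‖ ^ (R + 1) / (R.factorial : ℝ) ≤
      ∑ k ∈ Finset.range (R + 1), ((R : ℝ) - k) * (‖w‖ ^ k / (k.factorial : ℝ)) := by
    have : ‖w‖ ^ (R + 1) / (R.factorial : ℝ) = ‖w ^ (R + 1) / (R.factorial : ℂ)‖ := by simp
    rw [this, ← h1]
    refine (norm_sum_le _ _).trans (Finset.sum_le_sum fun k hk => ?_)
    have hk' : (k : ℝ) ≤ R := by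
      have : k ≤ R := by simp at hk; omega
      exact_mod_cast this
    have h5 : ((R : ℂ) - k) = (((R : ℝ) - k : ℝ) : ℂ) := by push_cast; ring
    rw [norm_mul, h5, Complex.norm_real, Real.norm_of_nonneg (by linarith)]
    simp
  have h4 : ∑ k ∈ Finset.range (R + 1), ((R : ℝ) - k) * (‖w‖ ^ k / (k.factorial : ℝ)) =
      (R - ‖w‖) * ∑ k ∈ Finset.range (R + 1), ‖w‖ ^ k / (k.factorial : ℝ) +
        ‖w‖ ^ (R + 1) / (R.factorial : ℝ) := by
    rw [expTrunc] at h2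
    exact_mod_cast h2
  have h5 : 0 < ∑ k ∈ Finset.range (R + 1), ‖w‖ ^ k / (k.factorial : ℝ) := by
    rw [Finset.sum_range_succ']
    have : 0 ≤ ∑ k ∈ Finset.range R, ‖w‖ ^ (k + 1) / ((k + 1).factorial : ℝ) :=
      Finset.sum_nonneg fun k _ => by positivity
    simp only [pow_zero, Nat.factorial_zero, Nat.cast_one, div_one]
    linarith
  nlinarith

theorem exists_two_le_norm_expTrunc {R : ℕ} (hR : 1 ≤ R) :
    ∃ r₀ : ℝ, 0 < r₀ ∧ ∀ w : ℂ, r₀ ≤ ‖w‖ → 2 ≤ ‖expTrunc R w‖ := by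
  set p : Polynomial ℂ := ∑ k ∈ Finset.range (R + 1),
    Polynomial.C (1 / (k.factorial : ℂ)) * Polynomial.X ^ k with hp
  have hev : ∀ w, p.eval w = expTrunc R w := by
    intro w
    simp only [hp, Polynomial.eval_finsetSum, Polynomial.eval_mul, Polynomial.eval_C,
      Polynomial.eval_pow, Polynomial.eval_X, expTrunc]
    exact Finset.sum_congr rfl fun k _ => by ring
  have hcoeff : p.coeff R ≠ 0 := by
    simp only [hp, Polynomial.finsetSum_coeff, Polynomial.coeff_C_mul_X_pow]
    rw [Finset.sum_eq_single_of_mem R (by simp)]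
    · simp [R.factorial_ne_zero]
    · intro b _ hb
      rw [if_neg (Ne.symm hb)]
  have hdeg : 0 < p.degree := by
    refine lt_of_lt_of_le ?_ (Polynomial.le_degree_of_ne_zero hcoeff)
    exact_mod_cast hR
  have ht := Polynomial.tendsto_norm_atTop p hdeg
    (l := comap (fun w : ℂ => ‖w‖) atTop) (z := id) tendsto_comap
  have h2 := ht.eventually_ge_atTop 2
  rw [eventually_comap] at h2
  obtain ⟨r₀, hr₀⟩ := eventually_atTop.1 h2
  refine ⟨max r₀ 1, by positivity, fun w hw => ?_⟩
  have := hr₀ ‖w‖ ((le_max_left _ _).trans hw) w rfl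
  rw [← hev]
  exact this

/-- `expQuot R` has no zeros in the curved sector next to the positive real axis. -/
theorem expQuot_cexp_ne_zero {R : ℕ} {X θ : ℝ} (h0 : 0 ≤ θ)
    (h : ((R : ℝ) + 1) * θ - Real.exp X * Real.sin θ ≤ Real.pi) :
    expQuot R (Complex.exp (X + θ * Complex.I)) ≠ 0 := by
  -- Large moduli are excluded by the bound on the zeros. If `exp X ≤ R`, the phase increases with
  -- the angle and stays in `[0, π]`, so `Re Q` does not decrease along the circular arc from its
  -- positive value on the real axis.
  rcases lt_or_ge (R : ℝ) (Real.exp X) with hX | hX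
  · rw [Ne, expQuot_eq_zero_iff]
    refine expTrunc_ne_zero_of_lt_norm R ?_
    rw [Complex.norm_exp]
    simpa using hX
  · intro hz
    have hd : ∀ α : ℝ, HasDerivAt (fun α : ℝ => (expQuot R (Complex.exp (X + α * Complex.I))).re)
        (1 / (R.factorial : ℝ) * (Real.exp ((R + 1) * X - Real.exp X * Real.cos α) *
          Real.sin ((R + 1) * α - Real.exp X * Real.sin α))) α := by
      intro α
      have h1 : HasDerivAt (fun z : ℂ => (X : ℂ) + z * Complex.I) Complex.I (α : ℂ) := by
        simpa using ((hasDerivAt_id (α : ℂ)).mul_const Complex.I).const_add (X : ℂ)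
      have h2 := ((hasDerivAt_expQuot_cexp R (X + α * Complex.I)).comp (α : ℂ) h1).real_of_complex
      refine h2.congr_deriv ?_
      have e1 : Complex.exp (X + α * Complex.I) =
          ((Real.exp X * Real.cos α : ℝ) : ℂ) + ((Real.exp X * Real.sin α : ℝ) : ℂ) * Complex.I := by
        rw [Complex.exp_add, Complex.exp_mul_I]; push_cast; ring
      have e2 : ((R : ℂ) + 1) * (X + α * Complex.I) - Complex.exp (X + α * Complex.I) =
          (((R + 1) * X - Real.exp X * Real.cos α : ℝ) : ℂ) +
          (((R + 1) * α - Real.exp X * Real.sin α : ℝ) : ℂ) * Complex.I := by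
        rw [e1]; push_cast; ring
      rw [e2, Complex.exp_add, Complex.exp_mul_I, ← Complex.ofReal_exp, ← Complex.ofReal_cos,
        ← Complex.ofReal_sin]
      set A := Real.exp ((R + 1) * X - Real.exp X * Real.cos α)
      set S := Real.sin ((R + 1) * α - Real.exp X * Real.sin α)
      set K := Real.cos ((R + 1) * α - Real.exp X * Real.sin α)
      have e3 : -(1 / (R.factorial : ℂ) * ((A : ℂ) * ((K : ℂ) + (S : ℂ) * Complex.I))) * Complex.I =
          ((1 / (R.factorial : ℝ) * (A * S) : ℝ) : ℂ) +
            ((-(1 / (R.factorial : ℝ) * (A * K)) : ℝ) : ℂ) * Complex.I := by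
        push_cast
        linear_combination (-(1 / (R.factorial : ℂ) * A * S)) * Complex.I_sq
      rw [e3]
      simp
    have hf : MonotoneOn (fun α : ℝ => ((R : ℝ) + 1) * α - Real.exp X * Real.sin α) univ := by
      have hfd : ∀ α : ℝ, HasDerivAt (fun α : ℝ => ((R : ℝ) + 1) * α - Real.exp X * Real.sin α)
          (((R : ℝ) + 1) - Real.exp X * Real.cos α) α := by
        intro α
        have := ((hasDerivAt_id α).const_mul ((R : ℝ) + 1)).fun_sub
          ((Real.hasDerivAt_sin α).const_mul (Real.exp X))
        simpa using this
      refine monotoneOn_of_deriv_nonneg convex_univ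
        (fun x _ => (hfd x).continuousAt.continuousWithinAt)
        (fun x _ => (hfd x).differentiableAt.differentiableWithinAt) ?_
      intro α _
      rw [(hfd α).deriv]
      have := Real.cos_le_one α
      nlinarith [Real.exp_pos X]
    have hmono : MonotoneOn (fun α : ℝ => (expQuot R (Complex.exp (X + α * Complex.I))).re)
        (Icc 0 θ) := by
      refine monotoneOn_of_deriv_nonneg (convex_Icc 0 θ)
        (fun x _ => (hd x).continuousAt.continuousWithinAt)
        (fun x _ => (hd x).differentiableAt.differentiableWithinAt) ?_
      intro α hα
      rw [interior_Icc] at hα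
      rw [(hd α).deriv]
      have l1 := hf (mem_univ 0) (mem_univ α) hα.1.le
      have l2 := hf (mem_univ α) (mem_univ θ) hα.2.le
      simp only [mul_zero, Real.sin_zero, sub_zero] at l1 l2
      have := Real.sin_nonneg_of_nonneg_of_le_pi l1 (l2.trans h)
      positivity
    have hm := hmono (left_mem_Icc.2 h0) (right_mem_Icc.2 h0) h0
    have hp := expQuot_ofReal_re_pos R (Real.exp_pos X).le
    rw [Complex.ofReal_exp] at hp
    simp only [Complex.ofReal_zero, zero_mul, add_zero, hz, Complex.zero_re] at hm
    linarith

/-! ### A curve on which the truncated exponential dominates the exponential -/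

/-- The constant value of `(R + 1) θ - r sin θ` on the curve. -/
def curvePhase (R : ℕ) : ℝ := Real.pi - Real.sin (rayAngle R)

/-- The logarithm of the modulus of the point of the curve with argument `θ`. -/
def curveLog (R : ℕ) (θ : ℝ) : ℝ :=
  Real.log (((R : ℝ) + 1) * θ - curvePhase R) - Real.log (Real.sin θ)

/-- The derivative of `curveLog`. -/
def curveLogDeriv (R : ℕ) (θ : ℝ) : ℝ :=
  ((R : ℝ) + 1) / (((R : ℝ) + 1) * θ - curvePhase R) - Real.cos θ / Real.sin θ

section Curve

variable {R : ℕ} {θ : ℝ}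

theorem sin_rayAngle_pos (hR : 1 ≤ R) : 0 < Real.sin (rayAngle R) :=
  Real.sin_pos_of_pos_of_lt_pi (rayAngle_pos R)
    (by linarith [rayAngle_le hR, Real.pi_pos])

theorem curve_sin_pos (h0 : rayAngle R ≤ θ) (h1 : θ < Real.pi) : 0 < Real.sin θ :=
  Real.sin_pos_of_pos_of_lt_pi ((rayAngle_pos R).trans_le h0) h1

theorem curve_num_pos (hR : 1 ≤ R) (h0 : rayAngle R ≤ θ) :
    0 < ((R : ℝ) + 1) * θ - curvePhase R := by
  have h1 := sin_rayAngle_pos hR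
  have h2 : ((R : ℝ) + 1) * rayAngle R ≤ ((R : ℝ) + 1) * θ := by gcongr
  rw [succ_mul_rayAngle] at h2
  rw [curvePhase]; linarith

theorem curvePhase_mem (hR : 1 ≤ R) :
    Real.pi / 2 ≤ curvePhase R ∧ curvePhase R ≤ Real.pi := by
  have h1 := sin_rayAngle_pos hR
  have h2 := Real.sin_le_one (rayAngle R)
  have h3 := Real.pi_gt_three
  constructor <;> rw [curvePhase] <;> linarith

theorem curveLog_rayAngle : curveLog R (rayAngle R) = 0 := by
  rw [curveLog, succ_mul_rayAngle, curvePhase]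
  simp

/-- The implicit equation of the curve: the phase in the derivative of `expQuot` stays equal to
`curvePhase R`. -/
theorem exp_curveLog_mul_sin (hR : 1 ≤ R) (h0 : rayAngle R ≤ θ) (h1 : θ < Real.pi) :
    Real.exp (curveLog R θ) * Real.sin θ = ((R : ℝ) + 1) * θ - curvePhase R := by
  have hs := curve_sin_pos h0 h1
  rw [curveLog, Real.exp_sub, Real.exp_log (curve_num_pos hR h0), Real.exp_log hs]
  field_simp

theorem hasDerivAt_curve_num : HasDerivAt (fun θ : ℝ => ((R : ℝ) + 1) * θ - curvePhase R)
    ((R : ℝ) + 1) θ := by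
  simpa using ((hasDerivAt_id θ).const_mul ((R : ℝ) + 1)).sub_const (curvePhase R)

theorem hasDerivAt_curveLog (hR : 1 ≤ R) (h0 : rayAngle R ≤ θ) (h1 : θ < Real.pi) :
    HasDerivAt (curveLog R) (curveLogDeriv R θ) θ :=
  (hasDerivAt_curve_num.log (curve_num_pos hR h0).ne').sub
    ((Real.hasDerivAt_sin θ).log (curve_sin_pos h0 h1).ne')

theorem differentiableAt_curveLogDeriv (hR : 1 ≤ R) (h0 : rayAngle R ≤ θ) (h1 : θ < Real.pi) :
    DifferentiableAt ℝ (curveLogDeriv R) θ :=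
  ((differentiableAt_const _).div hasDerivAt_curve_num.differentiableAt
    (curve_num_pos hR h0).ne').sub
    (Real.differentiableAt_cos.div Real.differentiableAt_sin (curve_sin_pos h0 h1).ne')

/-- Up to `π/2` this follows from `θ cos θ ≤ sin θ`; beyond `π/2` the cotangent is not positive. -/
theorem curveLogDeriv_nonneg (hR : 1 ≤ R) (h0 : rayAngle R ≤ θ) (h1 : θ < Real.pi) :
    0 ≤ curveLogDeriv R θ := by
  have hs := curve_sin_pos h0 h1
  have hn := curve_num_pos hR h0
  have hk := (curvePhase_mem hR).1
  have hpi := Real.pi_pos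
  have hθ := (rayAngle_pos R).trans_le h0
  rw [curveLogDeriv, sub_nonneg, div_le_div_iff₀ hs hn]
  rcases lt_or_ge θ (Real.pi / 2) with h | h
  · have hc : 0 < Real.cos θ := Real.cos_pos_of_mem_Ioo ⟨by linarith, h⟩
    have ht := Real.lt_tan hθ h
    rw [Real.tan_eq_sin_div_cos, lt_div_iff₀ hc] at ht
    have hR0 : (0 : ℝ) ≤ R := Nat.cast_nonneg R
    have : ((R : ℝ) + 1) * (θ * Real.cos θ) ≤ ((R : ℝ) + 1) * Real.sin θ := by gcongr
    nlinarith [mul_nonneg hc.le (hpi.le)]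
  · have hc : Real.cos θ ≤ 0 := Real.cos_nonpos_of_pi_div_two_le_of_le h (by linarith)
    have hR0 : (0 : ℝ) ≤ R := Nat.cast_nonneg R
    have e1 : 0 ≤ ((R : ℝ) + 1) * Real.sin θ := by positivity
    have e2 := mul_nonpos_of_nonpos_of_nonneg hc hn.le
    linarith

/-- With constant phase `k`, the derivative of `Re Q` in the angle has the sign of `sin k - cos k ·
X'`, where `X` is the logarithm of the modulus. Since `k` lies in `[π/2, π]` and `X` increases, this
is nonnegative. The initial value comes from the ray at modulus `1`. -/
theorem one_add_gapConst_le_curve (hR : 1 ≤ R) (h0 : rayAngle R ≤ θ) (h1 : θ < Real.pi) :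
    1 + gapConst R ≤ ‖expQuot R (Complex.exp (curveLog R θ + θ * Complex.I))‖ := by
  have hd : ∀ α : ℝ, rayAngle R ≤ α → α < Real.pi →
      HasDerivAt (fun α : ℝ => (expQuot R (Complex.exp (curveLog R α + α * Complex.I))).re)
      (1 / (R.factorial : ℝ) * (Real.exp ((R + 1) * curveLog R α -
        Real.exp (curveLog R α) * Real.cos α) *
        (Real.sin (curvePhase R) - Real.cos (curvePhase R) * curveLogDeriv R α))) α := by
    intro α ha0 ha1
    have h1 : HasDerivAt (fun t : ℝ => (curveLog R t : ℂ) + (t : ℂ) * Complex.I)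
        ((curveLogDeriv R α : ℂ) + Complex.I) α := by
      have h1 := (hasDerivAt_curveLog hR ha0 ha1).ofReal_comp
      have h2 := ((hasDerivAt_id α).ofReal_comp).mul_const Complex.I
      simpa using h1.fun_add h2
    have h2 := (hasDerivAt_expQuot_cexp R (curveLog R α + α * Complex.I)).comp α h1
    have h3 := Complex.reCLM.hasFDerivAt.comp_hasDerivAt α h2
    refine h3.congr_deriv ?_
    have e1 : Complex.exp (curveLog R α + α * Complex.I) =
        ((Real.exp (curveLog R α) * Real.cos α : ℝ) : ℂ) +
          ((Real.exp (curveLog R α) * Real.sin α : ℝ) : ℂ) * Complex.I := by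
      rw [Complex.exp_add, Complex.exp_mul_I]; push_cast; ring
    have e0 := exp_curveLog_mul_sin hR ha0 ha1
    have e2 : ((R : ℂ) + 1) * (curveLog R α + α * Complex.I) -
        Complex.exp (curveLog R α + α * Complex.I) =
        (((R + 1) * curveLog R α - Real.exp (curveLog R α) * Real.cos α : ℝ) : ℂ) +
        ((curvePhase R : ℝ) : ℂ) * Complex.I := by
      rw [e1, e0]; push_cast; ring
    rw [e2, Complex.exp_add, Complex.exp_mul_I, ← Complex.ofReal_exp, ← Complex.ofReal_cos,
      ← Complex.ofReal_sin]
    set A := Real.exp ((R + 1) * curveLog R α - Real.exp (curveLog R α) * Real.cos α)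
    set S := Real.sin (curvePhase R)
    set K := Real.cos (curvePhase R)
    set X := curveLogDeriv R α
    have e3 : -(1 / (R.factorial : ℂ) * ((A : ℂ) * ((K : ℂ) + (S : ℂ) * Complex.I))) *
        (X + Complex.I) = ((1 / (R.factorial : ℝ) * (A * (S - K * X)) : ℝ) : ℂ) +
          ((-(1 / (R.factorial : ℝ) * (A * (K + S * X))) : ℝ) : ℂ) * Complex.I := by
      push_cast
      linear_combination (-(1 / (R.factorial : ℂ) * A * S)) * Complex.I_sq
    rw [e3]
    simp
  have hk := curvePhase_mem hR
  have hmono : MonotoneOn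
      (fun α : ℝ => (expQuot R (Complex.exp (curveLog R α + α * Complex.I))).re)
      (Icc (rayAngle R) θ) := by
    refine monotoneOn_of_deriv_nonneg (convex_Icc _ _)
      (fun x hx => (hd x hx.1 (hx.2.trans_lt h1)).continuousAt.continuousWithinAt)
      (fun x hx => ?_) ?_
    · rw [interior_Icc] at hx
      exact (hd x hx.1.le (hx.2.trans h1)).differentiableAt.differentiableWithinAt
    · intro x hx
      rw [interior_Icc] at hx
      rw [(hd x hx.1.le (hx.2.trans h1)).deriv]
      have hX := curveLogDeriv_nonneg hR hx.1.le (hx.2.trans h1)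
      have hS : 0 ≤ Real.sin (curvePhase R) :=
        Real.sin_nonneg_of_nonneg_of_le_pi (by linarith [Real.pi_pos]) hk.2
      have hK : Real.cos (curvePhase R) ≤ 0 :=
        Real.cos_nonpos_of_pi_div_two_le_of_le hk.1 (by linarith [Real.pi_pos])
      have : 0 ≤ Real.sin (curvePhase R) - Real.cos (curvePhase R) * curveLogDeriv R x := by
        nlinarith
      positivity
  have h := hmono (left_mem_Icc.2 h0) (right_mem_Icc.2 h0) h0
  have h2 := expQuot_ray_lower R zero_le_one le_rfl
  simp only [curveLog_rayAngle, Complex.ofReal_zero, zero_add] at h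
  simp only [Complex.ofReal_one, one_mul, one_pow, mul_one] at h2
  exact (h2.trans h).trans (Complex.re_le_norm _)

/-- The curve can be closed up far away by an arc on which `expQuot` is large. -/
theorem exists_closing_arc (hR : 1 ≤ R) :
    ∃ θ₁ : ℝ, rayAngle R < θ₁ ∧ θ₁ < Real.pi ∧
      (∀ w : ℂ, Real.exp (curveLog R θ₁) ≤ ‖w‖ → expTrunc R w ≠ 0) ∧
      ∀ θ : ℝ, θ₁ ≤ θ → θ ≤ Real.pi →
        1 + gapConst R ≤ ‖expQuot R (Complex.exp (curveLog R θ₁ + θ * Complex.I))‖ := by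
  obtain ⟨r₀, hr₀, hT⟩ := exists_two_le_norm_expTrunc hR
  have hpi := Real.pi_pos
  -- On the curve at `π - η` the product of modulus and sine is at least `π/2`, while the sine is at
  -- most `η ≤ π / (2 r₀)`; hence the modulus is at least `r₀`. The bound `π/4` gives that `π/2`,
  -- keeps the angle beyond `rayAngle R` and makes the cosine negative on the arc.
  set η : ℝ := min (Real.pi / 4) (Real.pi / (2 * r₀)) with hη
  have hη0 : 0 < η := by positivity
  have hη1 : η ≤ Real.pi / 4 := min_le_left _ _
  have hη2 : η ≤ Real.pi / (2 * r₀) := min_le_right _ _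
  have hφ := rayAngle_le hR
  have hθφ : rayAngle R < Real.pi - η := by linarith
  have hθpi : Real.pi - η < Real.pi := by linarith
  have hr : r₀ ≤ Real.exp (curveLog R (Real.pi - η)) := by
    have e := exp_curveLog_mul_sin hR hθφ.le hθpi
    have hs := curve_sin_pos hθφ.le hθpi
    have hs2 : Real.sin (Real.pi - η) ≤ η := by
      rw [Real.sin_pi_sub]; exact Real.sin_le hη0.le
    have hR1 : (1 : ℝ) ≤ R := by exact_mod_cast hR
    have hk := (curvePhase_mem hR).2
    have h3 : Real.pi / 2 ≤ ((R : ℝ) + 1) * (Real.pi - η) - curvePhase R := by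
      nlinarith
    rw [← e] at h3
    have h4 : r₀ * η ≤ Real.pi / 2 := by
      rw [le_div_iff₀ (by positivity)] at hη2
      linarith
    have h5 := Real.exp_pos (curveLog R (Real.pi - η))
    have h6 : r₀ * η ≤ Real.exp (curveLog R (Real.pi - η)) * η := by nlinarith
    exact le_of_mul_le_mul_right h6 hη0
  refine ⟨Real.pi - η, hθφ, hθpi, fun w hw h0 => ?_, fun θ h1 h2 => ?_⟩
  · have := hT w (hr.trans hw)
    rw [h0, norm_zero] at this
    linarith
  set z := Complex.exp (curveLog R (Real.pi - η) + θ * Complex.I) with hz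
  have hzn : ‖z‖ = Real.exp (curveLog R (Real.pi - η)) := by
    rw [hz, Complex.norm_exp]; simp
  have hzre : z.re ≤ 0 := by
    rw [hz, Complex.exp_re]
    have : Real.cos θ ≤ 0 := Real.cos_nonpos_of_pi_div_two_le_of_le (by linarith) (by linarith)
    simp only [Complex.add_re, Complex.ofReal_re, Complex.mul_re, Complex.I_re, mul_zero,
      Complex.ofReal_im, Complex.I_im, mul_one, sub_self, add_zero, Complex.add_im,
      Complex.mul_im, zero_add]
    exact mul_nonpos_of_nonneg_of_nonpos (Real.exp_pos _).le this
  have h2 := hT z (by rw [hzn]; exact hr)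
  rw [expQuot, norm_mul, Complex.norm_exp, Complex.neg_re]
  -- On the arc `Re z ≤ 0`, so `exp(-z)` does not reduce `|T(z)| ≥ 2`, and `gapConst R ≤ 1`.
  have h3 : 1 ≤ Real.exp (-z.re) := Real.one_le_exp (by linarith)
  have := gapConst_le_one R
  nlinarith

/-- Concavity of the sine gives `sin(lθ) ≥ l sin θ`, so at angle `lθ` and the modulus of the curve
at `θ` the phase is at most `l` times its value on the curve, hence at most `π`. -/
theorem expQuot_polar_ne_zero (hR : 1 ≤ R) (h0 : rayAngle R ≤ θ) (h1 : θ < Real.pi) {l : ℝ}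
    (hl0 : 0 ≤ l) (hl1 : l ≤ 1) :
    expQuot R (Complex.exp (curveLog R θ + (l * θ : ℝ) * Complex.I)) ≠ 0 := by
  have hθ := (rayAngle_pos R).trans_le h0
  refine expQuot_cexp_ne_zero (by positivity) ?_
  have hc := strictConcaveOn_sin_Icc.concaveOn.2 (left_mem_Icc.2 Real.pi_pos.le)
    (⟨hθ.le, h1.le⟩ : θ ∈ Icc 0 Real.pi) (sub_nonneg.2 hl1) hl0 (by ring)
  simp only [smul_eq_mul, mul_zero, Real.sin_zero, zero_add] at hc
  have he := exp_curveLog_mul_sin hR h0 h1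
  have hk := (curvePhase_mem hR)
  have h3 := mul_le_mul_of_nonneg_left hc (Real.exp_pos (curveLog R θ)).le
  have h4 : Real.exp (curveLog R θ) * (l * Real.sin θ) =
    l * (((R : ℝ) + 1) * θ - curvePhase R) := by rw [← he]; ring
  rw [h4] at h3
  have h5 : l * curvePhase R ≤ 1 * curvePhase R := by
    have := Real.pi_pos
    exact mul_le_mul_of_nonneg_right hl1 (by linarith [hk.1])
  linarith [hk.2]

theorem expQuot_sector_ne_zero {r : ℝ} (hr0 : 0 ≤ r) (h0 : 0 ≤ θ)
    (h1 : θ ≤ rayAngle R) (hR : 1 ≤ R) : expQuot R (r * Complex.exp (θ * Complex.I)) ≠ 0 := by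
  rcases hr0.eq_or_lt with rfl | hr
  · simp [expQuot_zero_right]
  · have : (r : ℂ) * Complex.exp (θ * Complex.I) =
        Complex.exp ((Real.log r : ℝ) + θ * Complex.I) := by
      rw [Complex.exp_add, ← Complex.ofReal_exp, Real.exp_log hr]
    rw [this]
    refine expQuot_cexp_ne_zero h0 ?_
    have h2 : ((R : ℝ) + 1) * θ ≤ ((R : ℝ) + 1) * rayAngle R := by gcongr
    rw [succ_mul_rayAngle] at h2
    have h3 : 0 ≤ Real.sin θ := Real.sin_nonneg_of_nonneg_of_le_pi h0
      (by linarith [rayAngle_le hR, Real.pi_pos])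
    have := Real.exp_pos (Real.log r)
    nlinarith

end Curve

/-! ### Cauchy's theorem in polar coordinates -/

/-- Two `C¹` families `P`, `Q` with `∂Q/∂x = ∂P/∂y` have zero circulation around a rectangle. -/
theorem circulation_eq_zero {P Q : ℝ × ℝ → ℂ} {W : ℝ × ℝ → ℂ} {a b c d : ℝ} (hab : a ≤ b)
    (hcd : c ≤ d)
    (hP : ∀ x ∈ Icc a b, ∀ y ∈ Icc c d, DifferentiableAt ℝ P (x, y))
    (hQ : ∀ x ∈ Icc a b, ∀ y ∈ Icc c d, DifferentiableAt ℝ Q (x, y))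
    (hP' : ∀ x ∈ Icc a b, ∀ y ∈ Icc c d, HasDerivAt (fun y => P (x, y)) (W (x, y)) y)
    (hQ' : ∀ x ∈ Icc a b, ∀ y ∈ Icc c d, HasDerivAt (fun x => Q (x, y)) (W (x, y)) x) :
    (∫ x in a..b, P (x, d)) - ∫ x in a..b, P (x, c) =
      (∫ y in c..d, Q (b, y)) - ∫ y in c..d, Q (a, y) := by
  have hz : ∀ x ∈ Icc a b, ∀ y ∈ Icc c d,
      fderiv ℝ Q (x, y) (1, 0) + (-fderiv ℝ P (x, y)) (0, 1) = 0 := by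
    intro x hx y hy
    have h1 : HasDerivAt (fun x => Q (x, y)) (fderiv ℝ Q (x, y) (1, 0)) x :=
      (hQ x hx y hy).hasFDerivAt.comp_hasDerivAt x ((hasDerivAt_id x).prodMk (hasDerivAt_const x y))
    have h2 : HasDerivAt (fun y => P (x, y)) (fderiv ℝ P (x, y) (0, 1)) y :=
      (hP x hx y hy).hasFDerivAt.comp_hasDerivAt y ((hasDerivAt_const y x).prodMk (hasDerivAt_id y))
    rw [h1.unique (hQ' x hx y hy)]
    simp only [neg_apply]
    rw [h2.unique (hP' x hx y hy)]
    ring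
  -- Green's formula for the field `(Q, -P)`. Its divergence vanishes on the rectangle, so
  -- integrability needs no continuity of the derivatives.
  have h := MeasureTheory.integral2_divergence_prod_of_hasFDerivAt Q (fun p => -P p)
    (fun p => fderiv ℝ Q p) (fun p => -fderiv ℝ P p) a c b d
    (fun p hp => by
      rw [uIcc_of_le hab, uIcc_of_le hcd] at hp
      exact (hQ p.1 hp.1 p.2 hp.2).continuousAt.continuousWithinAt)
    (fun p hp => by
      rw [uIcc_of_le hab, uIcc_of_le hcd] at hp
      exact (hP p.1 hp.1 p.2 hp.2).neg.continuousAt.continuousWithinAt)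
    (fun p hp => by
      rw [min_eq_left hab, max_eq_right hab, min_eq_left hcd, max_eq_right hcd] at hp
      exact (hQ p.1 (Ioo_subset_Icc_self hp.1) p.2 (Ioo_subset_Icc_self hp.2)).hasFDerivAt)
    (fun p hp => by
      rw [min_eq_left hab, max_eq_right hab, min_eq_left hcd, max_eq_right hcd] at hp
      exact (hP p.1 (Ioo_subset_Icc_self hp.1) p.2 (Ioo_subset_Icc_self hp.2)).hasFDerivAt.neg)
    (by
      rw [uIcc_of_le hab, uIcc_of_le hcd]
      refine (MeasureTheory.integrableOn_zero).congr_fun (fun p hp => ?_)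
        (measurableSet_Icc.prod measurableSet_Icc)
      exact (hz p.1 hp.1 p.2 hp.2).symm)
  have h0 : (∫ x in a..b, ∫ y in c..d,
      fderiv ℝ Q (x, y) (1, 0) + (-fderiv ℝ P (x, y)) (0, 1)) = 0 := by
    rw [intervalIntegral.integral_congr (g := fun _ => (0 : ℂ))]
    · simp
    · intro x hx
      rw [uIcc_of_le hab] at hx
      change (∫ y in c..d, fderiv ℝ Q (x, y) (1, 0) + (-fderiv ℝ P (x, y)) (0, 1)) = 0
      rw [intervalIntegral.integral_congr (g := fun _ => (0 : ℂ))]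
      · simp
      · intro y hy
        rw [uIcc_of_le hcd] at hy
        exact hz x hx y hy
  rw [h0] at h
  simp only [intervalIntegral.integral_neg] at h
  linear_combination h

/-- Cauchy's theorem for the polar rectangle `{d ρ(x) e^{i μ y θ(x)}}`. -/
theorem polar_cauchy {F : ℂ → ℂ} (d : ℂ) (μ : ℝ) {ρ ρ' θ θ' : ℝ → ℝ} {a b : ℝ} (hab : a ≤ b)
    (hρ : ∀ x ∈ Icc a b, HasDerivAt ρ (ρ' x) x) (hρ' : ∀ x ∈ Icc a b, DifferentiableAt ℝ ρ' x)
    (hθ : ∀ x ∈ Icc a b, HasDerivAt θ (θ' x) x) (hθ' : ∀ x ∈ Icc a b, DifferentiableAt ℝ θ' x)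
    (hF : ∀ x ∈ Icc a b, ∀ y ∈ Icc (0 : ℝ) 1,
      DifferentiableAt ℂ F (d * ρ x * Complex.exp (Complex.I * μ * y * θ x))) :
    (∫ x in a..b, F (d * ρ x * Complex.exp (Complex.I * μ * θ x)) *
        (d * (ρ' x + Complex.I * μ * ρ x * θ' x) * Complex.exp (Complex.I * μ * θ x))) -
      ∫ x in a..b, F (d * ρ x) * (d * ρ' x) =
    (∫ y in (0 : ℝ)..1, F (d * ρ b * Complex.exp (Complex.I * μ * y * θ b)) *
        (d * ρ b * Complex.exp (Complex.I * μ * y * θ b) * (Complex.I * μ * θ b))) -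
      ∫ y in (0 : ℝ)..1, F (d * ρ a * Complex.exp (Complex.I * μ * y * θ a)) *
        (d * ρ a * Complex.exp (Complex.I * μ * y * θ a) * (Complex.I * μ * θ a)) := by
  -- `γ` is the parametrization and `u`, `v` are its partial derivatives in `x` and `y`. The form
  -- `F(γ) dγ` is closed because the mixed derivatives `∂u/∂y` and `∂v/∂x` agree.
  set c : ℂ := Complex.I * μ with hc
  set E : ℝ × ℝ → ℂ := fun p => Complex.exp (c * p.2 * θ p.1) with hE
  set γ : ℝ × ℝ → ℂ := fun p => d * ρ p.1 * E p with hγ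
  set u : ℝ × ℝ → ℂ := fun p => d * (ρ' p.1 + c * p.2 * ρ p.1 * θ' p.1) * E p with hu
  set v : ℝ × ℝ → ℂ := fun p => γ p * (c * θ p.1) with hv
  -- partial derivatives
  have hEx : ∀ x ∈ Icc a b, ∀ y : ℝ, HasDerivAt (fun x => E (x, y)) (E (x, y) * (c * y * θ' x)) x := by
    intro x hx y
    exact ((hθ x hx).ofReal_comp.const_mul (c * y)).cexp
  have hEy : ∀ x y : ℝ, HasDerivAt (fun y => E (x, y)) (E (x, y) * (c * θ x)) y := by
    intro x y
    have := (((hasDerivAt_id y).ofReal_comp.const_mul c).mul_const (θ x : ℂ)).cexp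
    simpa using this
  have hγx : ∀ x ∈ Icc a b, ∀ y : ℝ, HasDerivAt (fun x => γ (x, y)) (u (x, y)) x := by
    intro x hx y
    have := ((hρ x hx).ofReal_comp.const_mul d).mul (hEx x hx y)
    refine this.congr_deriv ?_
    simp only [hu]
    ring
  have hγy : ∀ x y : ℝ, HasDerivAt (fun y => γ (x, y)) (v (x, y)) y := by
    intro x y
    refine ((hEy x y).const_mul (d * (ρ x : ℂ))).congr_deriv ?_
    simp only [hv, hγ]
    ring
  have hvx : ∀ x ∈ Icc a b, ∀ y : ℝ, HasDerivAt (fun x => v (x, y))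
      (c * (u (x, y) * θ x + γ (x, y) * θ' x)) x := by
    intro x hx y
    have := (hγx x hx y).mul ((hθ x hx).ofReal_comp.const_mul c)
    refine this.congr_deriv ?_
    ring
  have huy : ∀ x y : ℝ, HasDerivAt (fun y => u (x, y))
      (c * (u (x, y) * θ x + γ (x, y) * θ' x)) y := by
    intro x y
    have h1 : HasDerivAt (fun y : ℝ => d * ((ρ' x : ℂ) + c * y * ρ x * θ' x))
        (d * (c * ρ x * θ' x)) y := by
      have := (((((hasDerivAt_id y).ofReal_comp.const_mul c).mul_const (ρ x : ℂ)).mul_const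
        (θ' x : ℂ)).const_add (ρ' x : ℂ)).const_mul d
      simpa using this
    refine (h1.mul (hEy x y)).congr_deriv ?_
    simp only [hu, hγ]
    ring
  -- joint differentiability
  have hdE : ∀ x ∈ Icc a b, ∀ y : ℝ, DifferentiableAt ℝ E (x, y) := by
    intro x hx y
    have h1 : DifferentiableAt ℝ (fun p : ℝ × ℝ => θ p.1) (x, y) :=
      (hθ x hx).differentiableAt.comp (x, y) differentiableAt_fst
    have h2 : DifferentiableAt ℝ (fun p : ℝ × ℝ => ((θ p.1 : ℝ) : ℂ)) (x, y) :=
      Complex.ofRealCLM.differentiableAt.comp (x, y) h1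
    have h3 : DifferentiableAt ℝ (fun p : ℝ × ℝ => ((p.2 : ℝ) : ℂ)) (x, y) :=
      Complex.ofRealCLM.differentiableAt.comp (x, y) differentiableAt_snd
    exact ((h3.const_mul c).mul h2).cexp
  have hfst : ∀ {f : ℝ → ℝ} {x : ℝ} (y : ℝ), DifferentiableAt ℝ f x →
      DifferentiableAt ℝ (fun p : ℝ × ℝ => ((f p.1 : ℝ) : ℂ)) (x, y) := fun {f} {x} y hf =>
    Complex.ofRealCLM.differentiableAt.comp (x, y)
      (DifferentiableAt.comp (g := f) (x, y) hf differentiableAt_fst)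
  have hsnd : ∀ x y : ℝ, DifferentiableAt ℝ (fun p : ℝ × ℝ => ((p.2 : ℝ) : ℂ)) (x, y) :=
    fun x y => Complex.ofRealCLM.differentiableAt.comp (x, y) differentiableAt_snd
  have hdγ : ∀ x ∈ Icc a b, ∀ y : ℝ, DifferentiableAt ℝ γ (x, y) := fun x hx y =>
    ((hfst y (hρ x hx).differentiableAt).const_mul d).mul (hdE x hx y)
  have hdu : ∀ x ∈ Icc a b, ∀ y : ℝ, DifferentiableAt ℝ u (x, y) := fun x hx y =>
    (((hfst y (hρ' x hx)).add ((((hsnd x y).const_mul c).mul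
      (hfst y (hρ x hx).differentiableAt)).mul (hfst y (hθ' x hx)))).const_mul d).mul (hdE x hx y)
  have hdv : ∀ x ∈ Icc a b, ∀ y : ℝ, DifferentiableAt ℝ v (x, y) := fun x hx y =>
    (hdγ x hx y).mul ((hfst y (hθ x hx).differentiableAt).const_mul c)
  have hFγ : ∀ x ∈ Icc a b, ∀ y ∈ Icc (0 : ℝ) 1, DifferentiableAt ℂ F (γ (x, y)) := hF
  have hdF : ∀ x ∈ Icc a b, ∀ y ∈ Icc (0 : ℝ) 1, DifferentiableAt ℝ (fun p => F (γ p)) (x, y) :=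
    fun x hx y hy => ((hFγ x hx y hy).restrictScalars ℝ).comp (x, y) (hdγ x hx y)
  have h := circulation_eq_zero (P := fun p => F (γ p) * u p) (Q := fun p => F (γ p) * v p)
    (W := fun p => deriv F (γ p) * u p * v p +
      F (γ p) * (c * (u p * θ p.1 + γ p * θ' p.1))) hab zero_le_one
    (fun x hx y hy => (hdF x hx y hy).mul (hdu x hx y))
    (fun x hx y hy => (hdF x hx y hy).mul (hdv x hx y))
    (fun x hx y hy => by
      have h1 := ((hFγ x hx y hy).hasDerivAt.comp_of_eq y (hγy x y) rfl).mul (huy x y)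
      refine h1.congr_deriv ?_
      simp only [Function.comp]
      ring)
    (fun x hx y hy => by
      have h1 := ((hFγ x hx y hy).hasDerivAt.comp_of_eq x (hγx x hx y) rfl).mul (hvx x hx y)
      refine h1.congr_deriv ?_
      simp only [Function.comp])
  simpa [hu, hv, hγ, hE] using h

/-! ### The deformed contour -/

/-- The imaginary half-axis next to a quadrant. -/
def axisDir (q : Bool × Bool) : ℂ := if q.1 then Complex.I else -Complex.I

/-- The sense of rotation from the imaginary half-axis into the quadrant. -/
def turn (q : Bool × Bool) : ℝ := if q.2 then 1 else -1

/-- The rotation by the angle `α` from the imaginary half-axis into the quadrant. -/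
def turnExp (q : Bool × Bool) (α : ℝ) : ℂ := Complex.exp (Complex.I * turn q * α)

/-- The direction of the ray of the contour in a quadrant. -/
def nearDir (R : ℕ) (q : Bool × Bool) : ℂ := axisDir q * turnExp q (rayAngle R / 2)

/-- The modulus along the curved part of the contour. -/
def curveRadius (R : ℕ) (θ : ℝ) : ℝ := Real.exp (curveLog R θ / 2)

/-- The curved part of the contour in a quadrant. -/
def curvePath (R : ℕ) (q : Bool × Bool) (θ : ℝ) : ℂ :=
  axisDir q * curveRadius R θ * turnExp q (θ / 2)

/-- The velocity of `curvePath`. -/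
def curveVel (R : ℕ) (q : Bool × Bool) (θ : ℝ) : ℂ :=
  curvePath R q θ * (((curveLogDeriv R θ : ℝ) + Complex.I * turn q) / 2)

/-- The closing arc of the contour in a quadrant. -/
def arcPath (R : ℕ) (θ₁ : ℝ) (q : Bool × Bool) (θ : ℝ) : ℂ :=
  axisDir q * curveRadius R θ₁ * turnExp q (θ / 2)

/-- The velocity of `arcPath`. -/
def arcVel (R : ℕ) (θ₁ : ℝ) (q : Bool × Bool) (θ : ℝ) : ℂ :=
  arcPath R θ₁ q θ * (Complex.I * turn q / 2)

/-- The integral along the part of the contour in a quadrant. -/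
def quadrantInt (R : ℕ) (θ₁ : ℝ) (q : Bool × Bool) (F : ℂ → ℂ) : ℂ :=
  (∫ p in (0 : ℝ)..1, F (p * nearDir R q) * nearDir R q) +
    (∫ θ in (rayAngle R)..θ₁, F (curvePath R q θ) * curveVel R q θ) +
    ∫ θ in θ₁..Real.pi, F (arcPath R θ₁ q θ) * arcVel R θ₁ q θ

/-- The integral along the deformed contour. -/
def deformedInt (R : ℕ) (θ₁ : ℝ) (F : ℂ → ℂ) : ℂ :=
  ∑ q : Bool × Bool, (turn q : ℂ) * quadrantInt R θ₁ q F

theorem axisDir_sq (q : Bool × Bool) : axisDir q ^ 2 = -1 := by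
  rcases q with ⟨_ | _, _⟩ <;> simp [axisDir]

theorem norm_axisDir (q : Bool × Bool) : ‖axisDir q‖ = 1 := by
  rcases q with ⟨_ | _, _⟩ <;> simp [axisDir]

theorem norm_turnExp (q : Bool × Bool) (α : ℝ) : ‖turnExp q α‖ = 1 := by
  rw [turnExp, Complex.norm_exp]; simp

theorem norm_nearDir (R : ℕ) (q : Bool × Bool) : ‖nearDir R q‖ = 1 := by
  rw [nearDir, norm_mul, norm_axisDir, norm_turnExp, one_mul]

theorem abs_re_axis_turn (q : Bool × Bool) (r α : ℝ) :
    |(axisDir q * r * turnExp q α).re| = |r| * |Real.sin α| := by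
  rw [← abs_mul]
  have h : turnExp q α = (Real.cos α : ℂ) + (turn q * Real.sin α : ℝ) * Complex.I := by
    rcases q with ⟨_, _ | _⟩
    · simp only [turnExp, turn, Bool.false_eq_true, if_false]
      rw [show Complex.I * ((-1 : ℝ) : ℂ) * α = ((-α : ℝ) : ℂ) * Complex.I by push_cast; ring,
        Complex.exp_mul_I, ← Complex.ofReal_cos, ← Complex.ofReal_sin, Real.cos_neg, Real.sin_neg]
      push_cast; ring
    · simp only [turnExp, turn, if_true]
      rw [show Complex.I * ((1 : ℝ) : ℂ) * α = (α : ℂ) * Complex.I by push_cast; ring,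
        Complex.exp_mul_I]
      push_cast; ring
  rw [h]
  rcases q with ⟨_ | _, _ | _⟩ <;>
    simp [axisDir, turn, abs_mul, -Complex.ofReal_sin, -Complex.ofReal_cos]

/-- The map `κ ↦ -κ²` sends the imaginary half-axis to the positive reals and doubles angles, so
each quadrant opens onto the upper or the lower half-plane. Estimates for `w` at angle `θ` thus
serve `κ` at angle `θ / 2`. -/
theorem neg_sq_axis_turn (q : Bool × Bool) (r α : ℝ) :
    -(axisDir q * r * turnExp q α) ^ 2 =
      (r ^ 2 : ℝ) * Complex.exp ((turn q * (2 * α) : ℝ) * Complex.I) := by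
  rw [mul_pow, mul_pow, axisDir_sq, turnExp, ← Complex.exp_nat_mul]
  push_cast
  rw [show 2 * (Complex.I * turn q * α) = turn q * (2 * α) * Complex.I by ring]
  ring

/-- The norm of `expQuot` does not depend on the quadrant. -/
theorem norm_expQuot_turn (R : ℕ) (q : Bool × Bool) (r α : ℝ) :
    ‖expQuot R (-(axisDir q * r * turnExp q α) ^ 2)‖ =
      ‖expQuot R ((r ^ 2 : ℝ) * Complex.exp ((2 * α : ℝ) * Complex.I))‖ := by
  rw [neg_sq_axis_turn]
  rcases q with ⟨s, _ | _⟩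
  · have : ((r ^ 2 : ℝ) : ℂ) * Complex.exp ((turn (s, false) * (2 * α) : ℝ) * Complex.I) =
        (starRingEnd ℂ) ((r ^ 2 : ℝ) * Complex.exp ((2 * α : ℝ) * Complex.I)) := by
      rw [map_mul, Complex.conj_ofReal, ← Complex.exp_conj, map_mul, Complex.conj_ofReal,
        Complex.conj_I]
      simp [turn]
    rw [this, expQuot_conj, Complex.norm_conj]
  · simp [turn]

theorem norm_expQuot_turn_exp (R : ℕ) (q : Bool × Bool) (X α : ℝ) :
    ‖expQuot R (-(axisDir q * (Real.exp (X / 2) : ℝ) * turnExp q α) ^ 2)‖ =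
      ‖expQuot R (Complex.exp (X + (2 * α : ℝ) * Complex.I))‖ := by
  rw [norm_expQuot_turn, Complex.exp_add (X : ℂ), ← Complex.ofReal_exp, ← Real.exp_nat_mul]
  congr 5
  push_cast; ring

section Contour

variable {R : ℕ} {θ₁ : ℝ}

theorem curveRadius_pos (R : ℕ) (θ : ℝ) : 0 < curveRadius R θ := Real.exp_pos _

theorem curveRadius_rayAngle (R : ℕ) : curveRadius R (rayAngle R) = 1 := by
  rw [curveRadius, curveLog_rayAngle]; simp

theorem hasDerivAt_curveRadius (hR : 1 ≤ R) {θ : ℝ} (h0 : rayAngle R ≤ θ) (h1 : θ < Real.pi) :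
    HasDerivAt (curveRadius R) (curveRadius R θ * (curveLogDeriv R θ / 2)) θ :=
  ((hasDerivAt_curveLog hR h0 h1).div_const 2).exp

/-- The deformed contour lies in this set. -/
def contourSet (R : ℕ) : Set ℂ :=
  {κ | expQuot R (-κ ^ 2) ≠ 0 ∧ (κ ≠ 0 → κ.re ≠ 0)}

theorem near_mem (hR : 1 ≤ R) (q : Bool × Bool) (p : ℝ) :
    (p : ℂ) * nearDir R q ∈ contourSet R := by
  have e : (p : ℂ) * nearDir R q = axisDir q * p * turnExp q (rayAngle R / 2) := by
    rw [nearDir]; ring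
  have hs : 0 < Real.sin (rayAngle R / 2) :=
    Real.sin_pos_of_pos_of_lt_pi (by linarith [rayAngle_pos R])
      (by linarith [rayAngle_le hR, Real.pi_pos])
  refine ⟨?_, ?_⟩
  · rw [e, ← norm_ne_zero_iff, norm_expQuot_turn, norm_ne_zero_iff,
      show 2 * (rayAngle R / 2) = rayAngle R by ring]
    exact expQuot_sector_ne_zero (by positivity) (rayAngle_pos R).le le_rfl hR
  · intro h0 hre
    rw [← abs_eq_zero, e, abs_re_axis_turn, abs_of_pos hs] at hre
    rcases mul_eq_zero.1 hre with h | h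
    · rw [abs_eq_zero] at h
      exact h0 (by rw [h]; simp)
    · exact hs.ne' h

theorem curve_mem (hR : 1 ≤ R) (h1 : θ₁ < Real.pi) (q : Bool × Bool) {θ : ℝ}
    (hθ : θ ∈ Icc (rayAngle R) θ₁) : curvePath R q θ ∈ contourSet R := by
  have hθpi : θ < Real.pi := hθ.2.trans_lt h1
  have hs : 0 < Real.sin (θ / 2) :=
    Real.sin_pos_of_pos_of_lt_pi (by linarith [rayAngle_pos R, hθ.1]) (by linarith [Real.pi_pos])
  refine ⟨?_, fun _ => ?_⟩
  · rw [curvePath, curveRadius, ← norm_ne_zero_iff, norm_expQuot_turn_exp,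
      show 2 * (θ / 2) = θ by ring]
    have := one_add_gapConst_le_curve hR hθ.1 hθpi
    linarith [gapConst_pos R]
  · rw [curvePath, ← abs_ne_zero, abs_re_axis_turn]
    exact (mul_pos (abs_pos.2 (curveRadius_pos R θ).ne') (abs_pos.2 hs.ne')).ne'

theorem arc_mem (h0 : rayAngle R < θ₁)
    (hbig : ∀ w : ℂ, Real.exp (curveLog R θ₁) ≤ ‖w‖ → expTrunc R w ≠ 0) (q : Bool × Bool) {θ : ℝ}
    (hθ : θ ∈ Icc θ₁ Real.pi) : arcPath R θ₁ q θ ∈ contourSet R := by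
  have hs : 0 < Real.sin (θ / 2) :=
    Real.sin_pos_of_pos_of_lt_pi (by linarith [rayAngle_pos R, hθ.1])
      (by linarith [Real.pi_pos, hθ.2])
  refine ⟨?_, fun _ => ?_⟩
  · rw [arcPath, curveRadius, ← norm_ne_zero_iff, norm_expQuot_turn_exp,
      show 2 * (θ / 2) = θ by ring, norm_ne_zero_iff, Ne, expQuot_eq_zero_iff]
    refine hbig _ ?_
    rw [Complex.norm_exp]
    simp
  · rw [arcPath, ← abs_ne_zero, abs_re_axis_turn]
    exact (mul_pos (abs_pos.2 (curveRadius_pos R θ₁).ne') (abs_pos.2 hs.ne')).ne'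

theorem continuous_turnExp (q : Bool × Bool) : Continuous (turnExp q) := by
  unfold turnExp; fun_prop

theorem continuousOn_curvePath (hR : 1 ≤ R) (h1 : θ₁ < Real.pi) (q : Bool × Bool) :
    ContinuousOn (curvePath R q) (Icc (rayAngle R) θ₁) := by
  have h : ContinuousOn (curveRadius R) (Icc (rayAngle R) θ₁) := fun θ hθ =>
    (hasDerivAt_curveRadius hR hθ.1 (hθ.2.trans_lt h1)).continuousAt.continuousWithinAt
  have h2 : ContinuousOn (fun θ => ((curveRadius R θ : ℝ) : ℂ)) (Icc (rayAngle R) θ₁) :=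
    Complex.continuous_ofReal.comp_continuousOn h
  exact (continuousOn_const.mul h2).mul
    ((continuous_turnExp q).comp (continuous_id.div_const 2)).continuousOn

theorem continuousOn_curveVel (hR : 1 ≤ R) (h1 : θ₁ < Real.pi) (q : Bool × Bool) :
    ContinuousOn (curveVel R q) (Icc (rayAngle R) θ₁) := by
  have h : ContinuousOn (curveLogDeriv R) (Icc (rayAngle R) θ₁) := fun θ hθ =>
    (differentiableAt_curveLogDeriv hR hθ.1 (hθ.2.trans_lt h1)).continuousAt.continuousWithinAt
  have h2 : ContinuousOn (fun θ => ((curveLogDeriv R θ : ℝ) : ℂ)) (Icc (rayAngle R) θ₁) :=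
    Complex.continuous_ofReal.comp_continuousOn h
  exact (continuousOn_curvePath hR h1 q).mul ((h2.add continuousOn_const).div_const 2)

theorem continuous_arcPath (q : Bool × Bool) : Continuous (arcPath R θ₁ q) := by
  unfold arcPath turnExp; fun_prop

theorem continuous_arcVel (q : Bool × Bool) : Continuous (arcVel R θ₁ q) :=
  (continuous_arcPath q).mul continuous_const

/-! ### From a circle to the deformed contour -/

/-- The arc of a circle in a quadrant. -/
def quadrantArc (q : Bool × Bool) (ρ : ℝ) (F : ℂ → ℂ) (a b : ℝ) : ℂ :=
  ∫ α in a..b, F (axisDir q * ρ * turnExp q α) *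
    (axisDir q * ρ * turnExp q α * (Complex.I * turn q))

theorem intervalIntegrable_arc {F : ℂ → ℂ} (q : Bool × Bool) (ρ : ℝ) {a b : ℝ} (hab : a ≤ b)
    (hF : ∀ α ∈ Icc a b, ContinuousAt F (axisDir q * ρ * turnExp q α)) :
    IntervalIntegrable (fun α => F (axisDir q * ρ * turnExp q α) *
      (axisDir q * ρ * turnExp q α * (Complex.I * turn q))) MeasureTheory.volume a b := by
  refine ContinuousOn.intervalIntegrable ?_
  rw [uIcc_of_le hab]
  have hc : Continuous fun α => axisDir q * ρ * turnExp q α :=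
    continuous_const.mul (continuous_turnExp q)
  refine ContinuousOn.mul (fun α hα => ?_) (hc.mul continuous_const).continuousOn
  exact ContinuousAt.continuousWithinAt
    (ContinuousAt.comp (g := F) (hF α hα) hc.continuousAt)

/-- Each quarter circle is run from the imaginary towards the real axis; `turn` restores the
counterclockwise direction. -/
theorem circleIntegral_eq_sum_quadrantArc {F : ℂ → ℂ} {ρ : ℝ} (hρ : 0 < ρ)
    (hF : ∀ z : ℂ, ‖z‖ = ρ → ContinuousAt F z) :
    (∮ z in C(0, ρ), F z) =
      ∑ q : Bool × Bool, (turn q : ℂ) * quadrantArc q ρ F 0 (Real.pi / 2) := by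
  set G : ℝ → ℂ := fun θ => deriv (circleMap 0 ρ) θ • F (circleMap 0 ρ θ) with hG
  have hGc : Continuous G := by
    have h1 : Continuous fun θ => F (circleMap 0 ρ θ) :=
      continuous_iff_continuousAt.2 fun θ =>
        ContinuousAt.comp (g := F) (hF _ (by simp [abs_of_pos hρ]))
          (continuous_circleMap 0 ρ).continuousAt
    have h2 : Continuous fun θ => deriv (circleMap 0 ρ) θ := by
      simp only [deriv_circleMap]
      exact (continuous_circleMap 0 ρ).mul continuous_const
    exact h2.smul h1
  have hi : ∀ a b, IntervalIntegrable G MeasureTheory.volume a b :=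
    fun a b => hGc.intervalIntegrable a b
  have hGe : ∀ θ, G θ = ρ * Complex.exp (θ * Complex.I) * Complex.I *
      F (ρ * Complex.exp (θ * Complex.I)) := by
    intro θ
    simp [hG, deriv_circleMap, circleMap]
  have h1 : (∮ z in C(0, ρ), F z) = (∫ θ in (0 : ℝ)..(Real.pi / 2), G θ) +
      (∫ θ in (Real.pi / 2)..Real.pi, G θ) + (∫ θ in Real.pi..(3 * Real.pi / 2), G θ) +
      ∫ θ in (3 * Real.pi / 2)..(2 * Real.pi), G θ := by
    rw [intervalIntegral.integral_add_adjacent_intervals (hi _ _) (hi _ _),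
      intervalIntegral.integral_add_adjacent_intervals (hi _ _) (hi _ _),
      intervalIntegral.integral_add_adjacent_intervals (hi _ _) (hi _ _)]
    rfl
  have hIe : Complex.exp ((Real.pi / 2 : ℝ) * Complex.I) = Complex.I := by
    push_cast; exact Complex.exp_pi_div_two_mul_I
  have hIe' : Complex.exp ((3 * Real.pi / 2 : ℝ) * Complex.I) = -Complex.I := by
    rw [show ((3 * Real.pi / 2 : ℝ) : ℂ) * Complex.I =
      Real.pi * Complex.I + (Real.pi / 2 : ℝ) * Complex.I by push_cast; ring, Complex.exp_add,
      hIe, Complex.exp_pi_mul_I]; ring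
  have hp : ∀ (q : Bool × Bool) (β : ℝ), turn q = 1 → Complex.exp (β * Complex.I) = axisDir q →
      quadrantArc q ρ F 0 (Real.pi / 2) = ∫ θ in β..(β + Real.pi / 2), G θ := by
    intro q β hq hβ
    have := intervalIntegral.integral_comp_add_left (a := 0) (b := Real.pi / 2) G β
    rw [add_zero] at this
    rw [← this, quadrantArc]
    refine intervalIntegral.integral_congr fun α _ => ?_
    rw [hGe, turnExp, hq, ← hβ]
    rw [show ((β + α : ℝ) : ℂ) * Complex.I = β * Complex.I + Complex.I * (1 : ℝ) * α by
      push_cast; ring, Complex.exp_add]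
    push_cast
    ring_nf
  have hm : ∀ (q : Bool × Bool) (β : ℝ), turn q = -1 → Complex.exp (β * Complex.I) = axisDir q →
      quadrantArc q ρ F 0 (Real.pi / 2) = -∫ θ in (β - Real.pi / 2)..β, G θ := by
    intro q β hq hβ
    have := intervalIntegral.integral_comp_sub_left (a := 0) (b := Real.pi / 2) G β
    rw [sub_zero] at this
    rw [← this, quadrantArc, ← intervalIntegral.integral_neg]
    refine intervalIntegral.integral_congr fun α _ => ?_
    rw [hGe, turnExp, hq, ← hβ]
    rw [show ((β - α : ℝ) : ℂ) * Complex.I = β * Complex.I + Complex.I * (-1 : ℝ) * α by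
      push_cast; ring, Complex.exp_add]
    push_cast
    ring_nf
  simp only [Fintype.sum_prod_type, Fintype.sum_bool]
  rw [hp (true, true) (Real.pi / 2) (by simp [turn]) (by simp [axisDir]),
    hp (false, true) (3 * Real.pi / 2) (by simp [turn]) (by simpa [axisDir] using hIe'),
    hm (true, false) (Real.pi / 2) (by simp [turn]) (by simp [axisDir]),
    hm (false, false) (3 * Real.pi / 2) (by simp [turn]) (by simpa [axisDir] using hIe'), h1]
  simp only [turn, if_true, Bool.false_eq_true, if_false]
  rw [show Real.pi / 2 + Real.pi / 2 = Real.pi by ring,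
    show 3 * Real.pi / 2 + Real.pi / 2 = 2 * Real.pi by ring,
    show Real.pi / 2 - Real.pi / 2 = 0 by ring,
    show 3 * Real.pi / 2 - Real.pi / 2 = Real.pi by ring]
  push_cast
  ring

/-- The integral along the imaginary half-axis, parametrized like the contour in the quadrant. -/
def axisInt (R : ℕ) (θ₁ : ℝ) (d : ℂ) (F : ℂ → ℂ) : ℂ :=
  (∫ p in (0 : ℝ)..1, F (d * p) * d) +
    ∫ θ in (rayAngle R)..θ₁, F (d * curveRadius R θ) *
      (d * (curveRadius R θ * (curveLogDeriv R θ / 2) : ℝ))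

/-- Two polar rectangles fill the region between the half-axis and the contour: a sector up to
modulus `1` and the part inside the curve. Their common arc at modulus `1` cancels, and the last arc
of the contour completes the quarter circle. -/
theorem quadrantInt_eq (hR : 1 ≤ R) (h0 : rayAngle R < θ₁) (h1 : θ₁ < Real.pi)
    (hbig : ∀ w : ℂ, Real.exp (curveLog R θ₁) ≤ ‖w‖ → expTrunc R w ≠ 0) {F : ℂ → ℂ}
    (hF : ∀ κ : ℂ, expQuot R (-κ ^ 2) ≠ 0 → DifferentiableAt ℂ F κ) (q : Bool × Bool) :
    quadrantInt R θ₁ q F = axisInt R θ₁ (axisDir q) F +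
      quadrantArc q (curveRadius R θ₁) F 0 (Real.pi / 2) := by
  have hφ := rayAngle_pos R
  have near := polar_cauchy (F := F) (axisDir q) (turn q) (ρ := fun x => x) (ρ' := fun _ => 1)
    (θ := fun _ => rayAngle R / 2) (θ' := fun _ => 0) zero_le_one
    (fun x _ => hasDerivAt_id x) (fun x _ => differentiableAt_const _)
    (fun x _ => hasDerivAt_const _ _) (fun x _ => differentiableAt_const _)
    (fun x hx y hy => by
      refine hF _ ?_
      have e : axisDir q * x * Complex.exp (Complex.I * turn q * y * (rayAngle R / 2 : ℝ)) =
          axisDir q * x * turnExp q (y * rayAngle R / 2) := by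
        rw [turnExp]; congr 2; push_cast; ring
      rw [e, ← norm_ne_zero_iff, norm_expQuot_turn, norm_ne_zero_iff,
        show 2 * (y * rayAngle R / 2) = y * rayAngle R by ring]
      refine expQuot_sector_ne_zero (by positivity) (mul_nonneg hy.1 hφ.le) ?_ hR
      nlinarith [hy.2])
  have far := polar_cauchy (F := F) (axisDir q) (turn q) (ρ := curveRadius R)
    (ρ' := fun θ => curveRadius R θ * (curveLogDeriv R θ / 2))
    (θ := fun θ => θ / 2) (θ' := fun _ => 1 / 2) h0.le
    (fun x hx => hasDerivAt_curveRadius hR hx.1 (hx.2.trans_lt h1))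
    (fun x hx => (hasDerivAt_curveRadius hR hx.1 (hx.2.trans_lt h1)).differentiableAt.mul
      ((differentiableAt_curveLogDeriv hR hx.1 (hx.2.trans_lt h1)).div_const 2))
    (fun x _ => (hasDerivAt_id x).div_const 2) (fun x _ => differentiableAt_const _)
    (fun x hx y hy => by
      refine hF _ ?_
      have e : axisDir q * curveRadius R x * Complex.exp (Complex.I * turn q * y * (x / 2 : ℝ)) =
          axisDir q * (Real.exp (curveLog R x / 2) : ℝ) * turnExp q (y * x / 2) := by
        rw [turnExp, curveRadius]; congr 2; push_cast; ring
      rw [e, ← norm_ne_zero_iff, norm_expQuot_turn_exp, norm_ne_zero_iff,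
        show 2 * (y * x / 2) = y * x by ring]
      exact expQuot_polar_ne_zero hR hx.1 (hx.2.trans_lt h1) hy.1 hy.2)
  -- the last arc
  have harc : ∀ α ∈ Icc (0 : ℝ) (Real.pi / 2),
      ContinuousAt F (axisDir q * curveRadius R θ₁ * turnExp q α) := by
    intro α _
    refine (hF _ ?_).continuousAt
    rw [curveRadius, ← norm_ne_zero_iff, norm_expQuot_turn_exp, norm_ne_zero_iff, Ne,
      expQuot_eq_zero_iff]
    refine hbig _ ?_
    rw [Complex.norm_exp]
    simp
  have hsplit : quadrantArc q (curveRadius R θ₁) F 0 (Real.pi / 2) =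
      quadrantArc q (curveRadius R θ₁) F 0 (θ₁ / 2) +
        quadrantArc q (curveRadius R θ₁) F (θ₁ / 2) (Real.pi / 2) := by
    refine (intervalIntegral.integral_add_adjacent_intervals ?_ ?_).symm
    · exact intervalIntegrable_arc q _ (by linarith) fun α hα => harc α ⟨hα.1, by linarith [hα.2]⟩
    · exact intervalIntegrable_arc q _ (by linarith) fun α hα => harc α ⟨by linarith [hα.1], hα.2⟩
  have hlast : (∫ θ in θ₁..Real.pi, F (arcPath R θ₁ q θ) * arcVel R θ₁ q θ) =
      quadrantArc q (curveRadius R θ₁) F (θ₁ / 2) (Real.pi / 2) := by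
    have := intervalIntegral.integral_comp_div (a := θ₁) (b := Real.pi) (c := 2)
      (fun α => F (axisDir q * curveRadius R θ₁ * turnExp q α) *
        (axisDir q * curveRadius R θ₁ * turnExp q α * (Complex.I * turn q))) two_ne_zero
    rw [quadrantArc, ← inv_smul_eq_iff₀ (two_ne_zero)] at *
    rw [← this, ← intervalIntegral.integral_smul]
    refine intervalIntegral.integral_congr fun θ _ => ?_
    simp only [arcPath, arcVel, Complex.real_smul]
    push_cast
    ring
  have hfirst : (∫ y in (0 : ℝ)..1, F (axisDir q * curveRadius R θ₁ *
      Complex.exp (Complex.I * turn q * y * (θ₁ / 2 : ℝ))) * (axisDir q * curveRadius R θ₁ *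
      Complex.exp (Complex.I * turn q * y * (θ₁ / 2 : ℝ)) * (Complex.I * turn q * (θ₁ / 2 : ℝ)))) =
      quadrantArc q (curveRadius R θ₁) F 0 (θ₁ / 2) := by
    have hne : θ₁ / 2 ≠ 0 := by linarith
    have := intervalIntegral.integral_comp_mul_left (a := 0) (b := 1) (c := θ₁ / 2)
      (fun α => F (axisDir q * curveRadius R θ₁ * turnExp q α) *
        (axisDir q * curveRadius R θ₁ * turnExp q α * (Complex.I * turn q))) hne
    rw [mul_zero, mul_one] at this
    have h2 := congrArg (fun z => (θ₁ / 2) • z) this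
    simp only [smul_inv_smul₀ hne] at h2
    rw [quadrantArc, ← h2, ← intervalIntegral.integral_smul]
    refine intervalIntegral.integral_congr fun y _ => ?_
    simp only [turnExp, Complex.real_smul]
    push_cast
    ring_nf
  have e1 : (∫ p in (0 : ℝ)..1, F (p * nearDir R q) * nearDir R q) =
      ∫ x in (0 : ℝ)..1, F (axisDir q * x * Complex.exp (Complex.I * turn q * (rayAngle R / 2 : ℝ))) *
        (axisDir q * ((1 : ℝ) + Complex.I * turn q * x * (0 : ℝ)) *
          Complex.exp (Complex.I * turn q * (rayAngle R / 2 : ℝ))) := by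
    refine intervalIntegral.integral_congr fun y _ => ?_
    simp only [nearDir, turnExp]
    push_cast
    ring_nf
  have e2 : (∫ θ in (rayAngle R)..θ₁, F (curvePath R q θ) * curveVel R q θ) =
      ∫ x in (rayAngle R)..θ₁, F (axisDir q * curveRadius R x *
        Complex.exp (Complex.I * turn q * (x / 2 : ℝ))) *
        (axisDir q * ((curveRadius R x * (curveLogDeriv R x / 2) : ℝ) +
          Complex.I * turn q * curveRadius R x * (1 / 2 : ℝ)) *
          Complex.exp (Complex.I * turn q * (x / 2 : ℝ))) := by
    refine intervalIntegral.integral_congr fun y _ => ?_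
    simp only [curvePath, curveVel, turnExp]
    push_cast
    ring_nf
  rw [quadrantInt, axisInt, hsplit, hlast, e1, e2, ← hfirst]
  simp only [curveRadius_rayAngle] at far
  simp only [Complex.ofReal_zero, mul_zero, zero_mul, add_zero, intervalIntegral.integral_zero,
    Complex.ofReal_one, mul_one] at near far ⊢
  linear_combination near + far

/-- Each imaginary half-axis borders two quadrants with opposite `turn`, so its integrals cancel and
only the quarter circles remain. -/
theorem circleIntegral_eq_deformedInt (hR : 1 ≤ R) (h0 : rayAngle R < θ₁) (h1 : θ₁ < Real.pi)
    (hbig : ∀ w : ℂ, Real.exp (curveLog R θ₁) ≤ ‖w‖ → expTrunc R w ≠ 0) {F : ℂ → ℂ}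
    (hF : ∀ κ : ℂ, expQuot R (-κ ^ 2) ≠ 0 → DifferentiableAt ℂ F κ) :
    (∮ z in C(0, curveRadius R θ₁), F z) = deformedInt R θ₁ F := by
  rw [circleIntegral_eq_sum_quadrantArc (curveRadius_pos R θ₁)]
  · simp only [deformedInt, quadrantInt_eq hR h0 h1 hbig hF, Fintype.sum_prod_type,
      Fintype.sum_bool, turn, axisDir, if_true, Bool.false_eq_true, if_false]
    push_cast
    ring
  · intro z hz
    refine (hF z ?_).continuousAt
    rw [Ne, expQuot_eq_zero_iff]
    refine hbig _ ?_
    rw [norm_neg, norm_pow, hz, curveRadius, ← Real.exp_nat_mul]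
    apply le_of_eq
    congr 1
    push_cast; ring

end Contour

/-! ### Integrals along the deformed contour -/

section ContourCalculus

variable {R : ℕ} {θ₁ : ℝ}

/-- The hypotheses on the end of the curve. -/
structure GoodEnd (R : ℕ) (θ₁ : ℝ) : Prop where
  one_le : 1 ≤ R
  lt : rayAngle R < θ₁
  lt_pi : θ₁ < Real.pi
  ne_zero : ∀ w : ℂ, Real.exp (curveLog R θ₁) ≤ ‖w‖ → expTrunc R w ≠ 0

theorem quadrantInt_congr (hθ : GoodEnd R θ₁) (q : Bool × Bool) {F G : ℂ → ℂ} (h : EqOn F G (contourSet R)) :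
    quadrantInt R θ₁ q F = quadrantInt R θ₁ q G := by
  unfold quadrantInt
  congr 1
  · congr 1
    · refine intervalIntegral.integral_congr fun p _ => ?_
      simp only [h (near_mem hθ.one_le q p)]
    · refine intervalIntegral.integral_congr fun θ h' => ?_
      rw [uIcc_of_le hθ.lt.le] at h'
      simp only [h (curve_mem hθ.one_le hθ.lt_pi q h')]
  · refine intervalIntegral.integral_congr fun θ h' => ?_
    rw [uIcc_of_le hθ.lt_pi.le] at h'
    simp only [h (arc_mem hθ.lt hθ.ne_zero q h')]

theorem quadrant_intervalIntegrable (hθ : GoodEnd R θ₁) (q : Bool × Bool) {F : ℂ → ℂ}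
    (hF : ContinuousOn F (contourSet R)) :
    IntervalIntegrable (fun p : ℝ => F (p * nearDir R q) * nearDir R q) MeasureTheory.volume 0 1 ∧
    IntervalIntegrable (fun θ => F (curvePath R q θ) * curveVel R q θ) MeasureTheory.volume
      (rayAngle R) θ₁ ∧
    IntervalIntegrable (fun θ => F (arcPath R θ₁ q θ) * arcVel R θ₁ q θ) MeasureTheory.volume
      θ₁ Real.pi := by
  refine ⟨?_, ?_, ?_⟩
  · refine ContinuousOn.intervalIntegrable (ContinuousOn.mul ?_ continuousOn_const)
    exact hF.comp (by fun_prop) fun p _ => near_mem hθ.one_le q p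
  · refine ContinuousOn.intervalIntegrable ?_
    rw [uIcc_of_le hθ.lt.le]
    exact (hF.comp (continuousOn_curvePath hθ.one_le hθ.lt_pi q)
      fun p hp => curve_mem hθ.one_le hθ.lt_pi q hp).mul
      (continuousOn_curveVel hθ.one_le hθ.lt_pi q)
  · refine ContinuousOn.intervalIntegrable ?_
    rw [uIcc_of_le hθ.lt_pi.le]
    exact (hF.comp (continuous_arcPath q).continuousOn
      fun p hp => arc_mem hθ.lt hθ.ne_zero q hp).mul (continuous_arcVel q).continuousOn

theorem quadrantInt_sub (hθ : GoodEnd R θ₁) (q : Bool × Bool) {F G : ℂ → ℂ} (hF : ContinuousOn F (contourSet R))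
    (hG : ContinuousOn G (contourSet R)) :
    quadrantInt R θ₁ q (fun t => F t - G t) = quadrantInt R θ₁ q F - quadrantInt R θ₁ q G := by
  obtain ⟨f1, f2, f3⟩ := quadrant_intervalIntegrable hθ q hF
  obtain ⟨g1, g2, g3⟩ := quadrant_intervalIntegrable hθ q hG
  unfold quadrantInt
  simp only [sub_mul]
  rw [intervalIntegral.integral_sub f1 g1, intervalIntegral.integral_sub f2 g2,
    intervalIntegral.integral_sub f3 g3]
  ring

theorem quadrantInt_const_mul (q : Bool × Bool) (c : ℂ) (F : ℂ → ℂ) :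
    quadrantInt R θ₁ q (fun t => c * F t) = c * quadrantInt R θ₁ q F := by
  unfold quadrantInt
  simp only [mul_assoc, intervalIntegral.integral_const_mul]
  ring

theorem deformedInt_congr (hθ : GoodEnd R θ₁) {F G : ℂ → ℂ} (h : EqOn F G (contourSet R)) :
    deformedInt R θ₁ F = deformedInt R θ₁ G := by
  simp only [deformedInt, quadrantInt_congr hθ _ h]

theorem deformedInt_sub (hθ : GoodEnd R θ₁) {F G : ℂ → ℂ} (hF : ContinuousOn F (contourSet R))
    (hG : ContinuousOn G (contourSet R)) :
    deformedInt R θ₁ (fun t => F t - G t) = deformedInt R θ₁ F - deformedInt R θ₁ G := by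
  simp only [deformedInt, quadrantInt_sub hθ _ hF hG, mul_sub, Finset.sum_sub_distrib]

theorem deformedInt_const_mul (c : ℂ) (F : ℂ → ℂ) :
    deformedInt R θ₁ (fun t => c * F t) = c * deformedInt R θ₁ F := by
  simp only [deformedInt, quadrantInt_const_mul, Finset.mul_sum]
  exact Finset.sum_congr rfl fun q _ => by ring

theorem hasDerivAt_turnExp (q : Bool × Bool) (θ : ℝ) :
    HasDerivAt (fun θ : ℝ => turnExp q (θ / 2)) (turnExp q (θ / 2) * (Complex.I * turn q / 2)) θ := by
  have h1 : HasDerivAt (fun θ : ℝ => ((θ / 2 : ℝ) : ℂ)) (1 / 2 : ℂ) θ := by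
    have := ((hasDerivAt_id θ).div_const 2).ofReal_comp
    simpa using this
  have := (h1.const_mul (Complex.I * turn q)).cexp
  refine this.congr_deriv ?_
  rw [turnExp]
  ring

theorem hasDerivAt_curvePath (hR : 1 ≤ R) (q : Bool × Bool) {θ : ℝ} (h0 : rayAngle R ≤ θ)
    (h1 : θ < Real.pi) : HasDerivAt (curvePath R q) (curveVel R q θ) θ := by
  have h := ((hasDerivAt_curveRadius hR h0 h1).ofReal_comp.const_mul (axisDir q)).mul
    (hasDerivAt_turnExp q θ)
  refine h.congr_deriv ?_
  simp only [curveVel, curvePath]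
  push_cast
  ring

theorem hasDerivAt_arcPath (q : Bool × Bool) (θ : ℝ) :
    HasDerivAt (arcPath R θ₁ q) (arcVel R θ₁ q θ) θ := by
  have h := (hasDerivAt_turnExp q θ).const_mul (axisDir q * (curveRadius R θ₁ : ℂ))
  refine h.congr_deriv ?_
  simp only [arcVel, arcPath]
  ring

/-- The three pieces join at `nearDir R q` and at the end of the curve, so the values of the
primitive telescope. -/
theorem quadrantInt_of_primitive (hθ : GoodEnd R θ₁) (q : Bool × Bool) {F G : ℂ → ℂ}
    (hF : ContinuousOn F (contourSet R)) (hG : ∀ t ∈ contourSet R, HasDerivAt G (F t) t) :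
    quadrantInt R θ₁ q F = G (arcPath R θ₁ q Real.pi) - G 0 := by
  obtain ⟨f1, f2, f3⟩ := quadrant_intervalIntegrable hθ q hF
  have e1 := intervalIntegral.integral_eq_sub_of_hasDerivAt
    (f := fun p : ℝ => G (p * nearDir R q)) (fun p _ => by
      have h1 : HasDerivAt (fun p : ℝ => (p : ℂ) * nearDir R q) (nearDir R q) p := by
        simpa using (hasDerivAt_id p).ofReal_comp.mul_const (nearDir R q)
      exact (hG _ (near_mem hθ.one_le q p)).comp p h1) f1
  have e2 := intervalIntegral.integral_eq_sub_of_hasDerivAt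
    (f := fun θ : ℝ => G (curvePath R q θ)) (fun θ h' => by
      rw [uIcc_of_le hθ.lt.le] at h'
      exact (hG _ (curve_mem hθ.one_le hθ.lt_pi q h')).comp θ
        (hasDerivAt_curvePath hθ.one_le q h'.1 (h'.2.trans_lt hθ.lt_pi))) f2
  have e3 := intervalIntegral.integral_eq_sub_of_hasDerivAt
    (f := fun θ : ℝ => G (arcPath R θ₁ q θ)) (fun θ h' => by
      rw [uIcc_of_le hθ.lt_pi.le] at h'
      exact (hG _ (arc_mem hθ.lt hθ.ne_zero q h')).comp θ (hasDerivAt_arcPath q θ)) f3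
  have e4 : curvePath R q (rayAngle R) = nearDir R q := by
    rw [curvePath, curveRadius_rayAngle, nearDir]; simp
  have e5 : curvePath R q θ₁ = arcPath R θ₁ q θ₁ := rfl
  rw [quadrantInt, e1, e2, e3, e4, e5]
  simp

/-- Every branch starts at `0` and ends on the real axis, where the two branches with the same end
have opposite `turn`: the contour consists of two closed loops through `0`. -/
theorem deformedInt_of_primitive (hθ : GoodEnd R θ₁) {F G : ℂ → ℂ} (hF : ContinuousOn F (contourSet R))
    (hG : ∀ t ∈ contourSet R, HasDerivAt G (F t) t) : deformedInt R θ₁ F = 0 := by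
  have hI : Complex.exp (Complex.I * (Real.pi / 2)) = Complex.I := by
    rw [mul_comm]; exact Complex.exp_pi_div_two_mul_I
  have hI' : Complex.exp (-(Complex.I * (Real.pi / 2))) = -Complex.I := by
    rw [Complex.exp_neg, hI, Complex.inv_I]
  have hm : ∀ z : ℂ, Complex.I * z * Complex.I = -z := fun z => by
    linear_combination z * Complex.I_sq
  simp only [deformedInt, quadrantInt_of_primitive hθ _ hF hG, Fintype.sum_prod_type,
    Fintype.sum_bool, arcPath, turnExp, turn, axisDir, if_true, Bool.false_eq_true, if_false]
  push_cast
  simp only [mul_one, mul_neg, neg_mul, hI, hI', hm, neg_neg]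
  ring

/-- The deformed contour does not wind around points of the imaginary axis. -/
theorem deformedInt_inv_sub (hθ : GoodEnd R θ₁) {v : ℝ} (hv : v ≠ 0) :
    deformedInt R θ₁ (fun t => 1 / (v * Complex.I - t)) = 0 := by
  have hne : ∀ t ∈ contourSet R, v * Complex.I - t ≠ 0 := by
    intro t ht h0
    have h1 : t = v * Complex.I := (sub_eq_zero.1 h0).symm
    have h2 := ht.2 (by rw [h1]; simp [hv])
    rw [h1] at h2
    simp at h2
  -- The sign makes `σ (v + t i)` positive at `t = 0`. At any other point of the contour its
  -- imaginary part `σ Re t` is nonzero, so a single branch of the logarithm serves as primitive.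
  set σ : ℝ := ((SignType.sign v : SignType) : ℝ) with hσ
  have hσv : 0 < σ * v := by
    rcases lt_or_gt_of_ne hv with h | h
    · simp [hσ, sign_neg h, h]
    · simp [hσ, sign_pos h, h]
  have hσ0 : σ ≠ 0 := by rintro h; rw [h] at hσv; simp at hσv
  refine deformedInt_of_primitive hθ (G := fun t => -Complex.log (σ * (v + t * Complex.I)))
    (fun t ht => (ContinuousAt.div (by fun_prop) (by fun_prop) (hne t ht)).continuousWithinAt) ?_
  intro t ht
  have hs : (σ : ℂ) * (v + t * Complex.I) ∈ Complex.slitPlane := by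
    rcases eq_or_ne t 0 with rfl | h0
    · left
      simpa using hσv
    · right
      have := ht.2 h0
      simp [hσ0, this]
  have h1 : HasDerivAt (fun t : ℂ => (σ : ℂ) * (v + t * Complex.I)) (σ * Complex.I) t := by
    have := (((hasDerivAt_id t).mul_const Complex.I).const_add (v : ℂ)).const_mul (σ : ℂ)
    simpa using this
  refine (h1.clog hs).neg.congr_deriv ?_
  have h2 := hne t ht
  have hσc : (σ : ℂ) ≠ 0 := by exact_mod_cast hσ0
  have e : (v : ℂ) + t * Complex.I = -(Complex.I * (v * Complex.I - t)) := by
    linear_combination (v : ℂ) * Complex.I_sq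
  rw [mul_div_mul_left _ _ hσc, e, div_neg, neg_neg, div_mul_cancel_left₀ Complex.I_ne_zero,
    one_div]

end ContourCalculus

/-! ### Shifting the vertical line -/

theorem integrable_vertical {f : ℂ → ℂ} (hf : Continuous f) {a C c : ℝ} (ha : 0 < a)
    (hb : ∀ v : ℝ, ‖f (c + v * Complex.I)‖ ≤ C * Real.exp (-a * v ^ 2)) :
    MeasureTheory.Integrable (fun v : ℝ => f (c + v * Complex.I)) :=
  ((integrable_exp_neg_mul_sq ha).const_mul C).mono' (by fun_prop) (MeasureTheory.ae_of_all _ hb)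

/-- A vertical line of integration can be shifted in a strip in which the integrand decays. -/
theorem integral_vertical_shift {f : ℂ → ℂ} (hf : Differentiable ℂ f) {a C c : ℝ} (ha : 0 < a)
    (hb : ∀ s : ℂ, |s.re| ≤ |c| → ‖f s‖ ≤ C * Real.exp (-a * s.im ^ 2)) :
    ∫ v : ℝ, f (c + v * Complex.I) = ∫ v : ℝ, f (v * Complex.I) := by
  have hi1 := integrable_vertical hf.continuous (c := c) ha
    (fun v => by simpa using hb (c + v * Complex.I) (by simp))
  have hi0 := integrable_vertical hf.continuous (c := 0) ha
    (fun v => by simpa using hb (0 + v * Complex.I) (by simp))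
  have t1 := MeasureTheory.intervalIntegral_tendsto_integral hi1 tendsto_neg_atTop_atBot tendsto_id
  have t0 := MeasureTheory.intervalIntegral_tendsto_integral hi0 tendsto_neg_atTop_atBot tendsto_id
  have hC : 0 ≤ C := by
    have := (norm_nonneg _).trans (hb 0 (by simp))
    simpa using this
  have hlim : Tendsto (fun T : ℝ => C * Real.exp (-a * T ^ 2) * |c|) atTop (𝓝 0) := by
    have h1 : Tendsto (fun T : ℝ => -a * T ^ 2) atTop atBot :=
      (tendsto_pow_atTop two_ne_zero).const_mul_atTop_of_neg (by linarith)
    have h2 := ((Real.tendsto_exp_atBot.comp h1).const_mul C).mul_const |c|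
    simpa using h2
  -- The horizontal sides of the rectangle at heights `± T` vanish in the limit.
  have hh : ∀ σ : ℝ, σ ^ 2 = 1 → Tendsto (fun T : ℝ => ∫ x : ℝ in (0 : ℝ)..c,
      f (x + (σ * T : ℝ) * Complex.I)) atTop (𝓝 0) := by
    intro σ hσ
    refine squeeze_zero_norm (fun T => ?_) hlim
    have := intervalIntegral.norm_integral_le_of_norm_le_const (a := 0) (b := c)
      (f := fun x : ℝ => f (x + (σ * T : ℝ) * Complex.I)) (C := C * Real.exp (-a * T ^ 2))
      (fun x hx => by
        have h1 := hb (x + (σ * T : ℝ) * Complex.I) (by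
          simp only [Complex.add_re, Complex.ofReal_re, Complex.mul_re, Complex.I_re, mul_zero,
            Complex.ofReal_im, Complex.I_im, mul_one, sub_self, add_zero]
          rcases le_total 0 c with h | h
          · rw [uIoc_of_le h] at hx
            rw [abs_of_pos hx.1, abs_of_nonneg h]; exact hx.2
          · rw [uIoc_of_ge h] at hx
            rw [abs_of_nonpos hx.2, abs_of_nonpos h]; linarith [hx.1])
        refine h1.trans (le_of_eq ?_)
        simp only [Complex.add_im, Complex.ofReal_im, Complex.mul_im, Complex.I_im, mul_one,
          Complex.ofReal_re, Complex.I_re, mul_zero, zero_add, add_zero]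
        rw [mul_pow, hσ, one_mul])
    simpa using this
  have hrect : ∀ T : ℝ, (∫ x : ℝ in (0 : ℝ)..c, f (x + ((-1 : ℝ) * T : ℝ) * Complex.I)) -
      (∫ x : ℝ in (0 : ℝ)..c, f (x + ((1 : ℝ) * T : ℝ) * Complex.I)) +
      Complex.I * (∫ y : ℝ in (-T)..T, f (c + y * Complex.I)) -
      Complex.I * (∫ y : ℝ in (-T)..T, f ((0 : ℝ) + y * Complex.I)) = 0 := by
    intro T
    have := Complex.integral_boundary_rect_eq_zero_of_differentiableOn f
      (⟨0, -T⟩ : ℂ) ⟨c, T⟩ hf.differentiableOn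
    simpa using this
  have hL := (((hh (-1) (by norm_num)).sub (hh 1 (by norm_num))).add
    (t1.const_mul Complex.I)).sub (t0.const_mul Complex.I)
  have h0 := tendsto_nhds_unique hL (tendsto_const_nhds.congr fun T => (hrect T).symm)
  have h1 : Complex.I * ((∫ v : ℝ, f (c + v * Complex.I)) -
      ∫ v : ℝ, f ((0 : ℝ) + v * Complex.I)) = 0 := by
    linear_combination h0
  have h2 := sub_eq_zero.1 ((mul_eq_zero.1 h1).resolve_left Complex.I_ne_zero)
  rw [h2]
  simp

/-! ### From circle and line to the deformed contour and the imaginary axis -/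

section Deform

variable {R : ℕ} {θ₁ : ℝ}

/-- The singularities lie inside the circle of radius `ρ`. -/
def Encloses (R : ℕ) (ρ : ℝ) : Prop := 0 < ρ ∧ ∀ κ : ℂ, expQuot R (-κ ^ 2) = 0 → ‖κ‖ < ρ

/-- A function whose only singularities are the zeros of `expQuot R (-κ ^ 2)`. -/
def RegularOff (R : ℕ) (F : ℂ → ℂ) : Prop :=
  ∀ κ : ℂ, expQuot R (-κ ^ 2) ≠ 0 → DifferentiableAt ℂ F κ

theorem Encloses.mono {ρ ρ' : ℝ} (h : Encloses R ρ) (hle : ρ ≤ ρ') : Encloses R ρ' :=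
  ⟨h.1.trans_le hle, fun κ hκ => (h.2 κ hκ).trans_le hle⟩

theorem Encloses.ne_zero {ρ : ℝ} (h : Encloses R ρ) {κ : ℂ} (hκ : ρ ≤ ‖κ‖) :
    expQuot R (-κ ^ 2) ≠ 0 := fun h0 => absurd (h.2 κ h0) (not_lt.2 hκ)

theorem circleIntegral_eq_of_le {F : ℂ → ℂ} (hF : RegularOff R F) {ρ ρ' : ℝ}
    (h : Encloses R ρ) (hle : ρ ≤ ρ') : (∮ t in C(0, ρ'), F t) = ∮ t in C(0, ρ), F t := by
  refine Complex.circleIntegral_eq_of_differentiable_on_annulus_off_countable h.1 hle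
    countable_empty (fun z hz => (hF z (h.ne_zero ?_)).continuousAt.continuousWithinAt)
    (fun z hz => hF z (h.ne_zero ?_))
  · simpa using hz.2
  · have : z ∉ Metric.closedBall (0 : ℂ) ρ := hz.1.2
    simp only [Metric.mem_closedBall, dist_zero_right, not_le] at this
    exact this.le

theorem circleIntegral_eq_of_encloses {F : ℂ → ℂ} (hF : RegularOff R F) {ρ ρ' : ℝ}
    (h : Encloses R ρ) (h' : Encloses R ρ') : (∮ t in C(0, ρ'), F t) = ∮ t in C(0, ρ), F t := by
  rcases le_total ρ ρ' with hle | hle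
  · exact circleIntegral_eq_of_le hF h hle
  · exact (circleIntegral_eq_of_le hF h' hle).symm

theorem GoodEnd.encloses (hθ : GoodEnd R θ₁) : Encloses R (curveRadius R θ₁) := by
  refine ⟨curveRadius_pos R θ₁, fun κ hκ => ?_⟩
  by_contra! hle
  refine hθ.ne_zero (-κ ^ 2) ?_ ((expQuot_eq_zero_iff R _).1 hκ)
  have e : Real.exp (curveLog R θ₁) = curveRadius R θ₁ ^ 2 := by
    rw [curveRadius, ← Real.exp_nat_mul]; congr 1; push_cast; ring
  rw [e, norm_neg, norm_pow]
  exact pow_le_pow_left₀ (curveRadius_pos R θ₁).le hle 2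

/-- The inner integral after subtraction of the pole. -/
def innerInt (N D : ℂ → ℂ) (ρ : ℝ) (s : ℂ) : ℂ := ∮ t in C(0, ρ), D t * dslope N s t

theorem differentiable_dslope {N : ℂ → ℂ} (hN : Differentiable ℂ N) (s : ℂ) :
    Differentiable ℂ (dslope N s) := by
  have := (Complex.differentiableOn_dslope (f := N) (s := univ) (c := s) univ_mem).2
    hN.differentiableOn
  exact differentiableOn_univ.1 this

/-- The Cauchy power series uses `(t - s)⁻¹` normalized by `2πi`; the factor `-2πi` undoes both
conventions. -/
theorem differentiableOn_cauchy_integral {h : ℂ → ℂ} {ρ : ℝ} (hρ : 0 < ρ)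
    (hh : ContinuousOn h (Metric.sphere 0 ρ)) :
    DifferentiableOn ℂ (fun s => ∮ t in C(0, ρ), h t / (s - t)) (Metric.ball 0 ρ) := by
  lift ρ to NNReal using hρ.le
  have hc := hasFPowerSeriesOn_cauchy_integral (hh.circleIntegrable ρ.coe_nonneg)
    (NNReal.coe_pos.1 hρ)
  have h1 := hc.differentiableOn
  rw [Metric.eball_coe] at h1
  have h2 := h1.const_mul (-(2 * Real.pi * Complex.I : ℂ))
  refine h2.congr fun s _ => ?_
  have hpi : (2 * Real.pi * Complex.I : ℂ) ≠ 0 := by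
    simp [Real.pi_ne_zero]
  rw [smul_eq_mul, neg_mul, ← mul_assoc, mul_inv_cancel₀ hpi, one_mul]
  simp only [circleIntegral]
  rw [← intervalIntegral.integral_neg]
  refine intervalIntegral.integral_congr fun θ _ => ?_
  simp only [smul_eq_mul]
  rw [← neg_sub s, inv_neg]
  ring

variable {N D e : ℂ → ℂ}

theorem innerInt_regular (hN : Differentiable ℂ N) (hD : RegularOff R D) (s : ℂ) :
    RegularOff R (fun t => D t * dslope N s t) :=
  fun κ hκ => (hD κ hκ).mul (differentiable_dslope hN s κ)

theorem continuousOn_sphere_of_regular {F : ℂ → ℂ} (hF : RegularOff R F) {ρ : ℝ}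
    (h : Encloses R ρ) : ContinuousOn F (Metric.sphere 0 ρ) := fun z hz =>
  (hF z (h.ne_zero (by simpa using (mem_sphere_zero_iff_norm.1 hz).ge))).continuousAt.continuousWithinAt

/-- Expanding `D(t) (N(t) - N(s)) / (t - s)` with `N D = e` exhibits the original integrand and a
correction whose numerator is entire. -/
theorem innerInt_split (hD : RegularOff R D) (he : Differentiable ℂ e)
    (hND : ∀ κ : ℂ, expQuot R (-κ ^ 2) ≠ 0 → N κ * D κ = e κ) {ρ : ℝ} (h : Encloses R ρ) {s : ℂ}
    (hs : ‖s‖ ≠ ρ) :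
    innerInt N D ρ s = N s * (∮ t in C(0, ρ), D t / (s - t)) - ∮ t in C(0, ρ), e t / (s - t) := by
  have hne : ∀ t ∈ Metric.sphere (0 : ℂ) ρ, s - t ≠ 0 := by
    intro t ht h0
    rw [sub_eq_zero.1 h0] at hs
    exact hs (mem_sphere_zero_iff_norm.1 ht)
  have hcD : CircleIntegrable (fun t => N s * (D t / (s - t))) 0 ρ :=
    (continuousOn_const.mul ((continuousOn_sphere_of_regular hD h).div
      (continuousOn_const.sub continuousOn_id) hne)).circleIntegrable h.1.le
  have hce : CircleIntegrable (fun t => e t / (s - t)) 0 ρ :=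
    (he.continuous.continuousOn.div
      (continuousOn_const.sub continuousOn_id) hne).circleIntegrable h.1.le
  rw [← circleIntegral.integral_const_mul, ← circleIntegral.integral_sub hcD hce, innerInt]
  refine circleIntegral.integral_congr h.1.le fun t ht => ?_
  have h1 := hne t ht
  have hts : t ≠ s := fun h' => h1 (by rw [h', sub_self])
  have h2 := hND t (h.ne_zero (by simpa using (mem_sphere_zero_iff_norm.1 ht).ge))
  rw [dslope_of_ne N hts, slope_def_field, ← h2]
  have h3 : t - s ≠ 0 := sub_ne_zero.2 hts
  field_simp
  ring

/-- The regularized integrand has no pole at `t = s`, so the radius is immaterial and may be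
enlarged until `s` is inside, where both Cauchy integrals are holomorphic. -/
theorem differentiable_innerInt (hN : Differentiable ℂ N) (hD : RegularOff R D)
    (he : Differentiable ℂ e)
    (hND : ∀ κ : ℂ, expQuot R (-κ ^ 2) ≠ 0 → N κ * D κ = e κ) {ρ : ℝ} (h : Encloses R ρ) :
    Differentiable ℂ (innerInt N D ρ) := by
  intro s
  set ρ' := max ρ (‖s‖ + 1) with hρ'
  have h' : Encloses R ρ' := h.mono (le_max_left _ _)
  have hs : s ∈ Metric.ball (0 : ℂ) ρ' := by
    rw [mem_ball_zero_iff]; exact lt_of_lt_of_le (by linarith) (le_max_right _ _)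
  have heq : innerInt N D ρ = innerInt N D ρ' := funext fun z =>
    circleIntegral_eq_of_encloses (innerInt_regular hN hD z) h' h
  have hd : DifferentiableOn ℂ (innerInt N D ρ') (Metric.ball 0 ρ') := by
    refine ((hN.differentiableOn.mul (differentiableOn_cauchy_integral h'.1
      (continuousOn_sphere_of_regular hD h'))).sub (differentiableOn_cauchy_integral h'.1
      he.continuous.continuousOn)).congr fun z hz => ?_
    exact innerInt_split hD he hND h' (mem_ball_zero_iff.1 hz).ne
  rw [heq]
  exact hd.differentiableAt (Metric.isOpen_ball.mem_nhds hs)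

/-- For `s` outside the circle the correction `e(t) / (s - t)` is holomorphic inside it, so
regularization changes nothing. -/
theorem innerInt_outside (hD : RegularOff R D) (he : Differentiable ℂ e)
    (hND : ∀ κ : ℂ, expQuot R (-κ ^ 2) ≠ 0 → N κ * D κ = e κ) {ρ : ℝ} (h : Encloses R ρ) {s : ℂ}
    (hs : ρ < ‖s‖) : innerInt N D ρ s = N s * ∮ t in C(0, ρ), D t / (s - t) := by
  rw [innerInt_split hD he hND h hs.ne']
  have hd : DiffContOnCl ℂ (fun t => e t / (s - t)) (Metric.ball 0 ρ) := by
    refine DifferentiableOn.diffContOnCl fun t ht => ?_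
    have ht' : ‖t‖ ≤ ρ := by
      rw [closure_ball _ h.1.ne'] at ht
      simpa using ht
    have hne : s - t ≠ 0 := by
      intro h0
      rw [sub_eq_zero.1 h0] at hs
      linarith
    exact ((he t).div (by fun_prop) hne).differentiableWithinAt
  rw [hd.circleIntegral_eq_zero h.1.le, sub_zero]

/-- High up in the strip `|s - t| ≥ 1` and the decay of `N` is inherited; the remaining rectangle is
compact. -/
theorem exists_innerInt_bound (hN : Differentiable ℂ N) (hD : RegularOff R D)
    (he : Differentiable ℂ e)
    (hND : ∀ κ : ℂ, expQuot R (-κ ^ 2) ≠ 0 → N κ * D κ = e κ) {a : ℝ} (ha : 0 < a)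
    (hdec : ∀ A : ℝ, ∃ C : ℝ, ∀ s : ℂ, |s.re| ≤ A → ‖N s‖ ≤ C * Real.exp (-a * s.im ^ 2))
    {ρ : ℝ} (h : Encloses R ρ) (A : ℝ) :
    ∃ C : ℝ, ∀ s : ℂ, |s.re| ≤ A → ‖innerInt N D ρ s‖ ≤ C * Real.exp (-a * s.im ^ 2) := by
  obtain ⟨C₁, hC₁⟩ := hdec A
  obtain ⟨B, hB⟩ := (isCompact_sphere (0 : ℂ) ρ).exists_bound_of_continuousOn
    (continuousOn_sphere_of_regular hD h)
  have hB0 : 0 ≤ B := (norm_nonneg _).trans (hB (ρ : ℂ) (by simp [abs_of_pos h.1]))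
  -- the compact part
  have hK : IsCompact (Icc (-A) A ×ℂ Icc (-(ρ + 1)) (ρ + 1)) := isCompact_Icc.reProdIm isCompact_Icc
  obtain ⟨B₂, hB₂⟩ := hK.exists_bound_of_continuousOn
    (differentiable_innerInt hN hD he hND h).continuous.continuousOn
  refine ⟨max (C₁ * (2 * Real.pi * ρ * B)) (max B₂ 0 * Real.exp (a * (ρ + 1) ^ 2)), fun s hs => ?_⟩
  rcases le_or_gt (|s.im|) (ρ + 1) with him | him
  · have h1 := hB₂ s ⟨abs_le.1 hs, abs_le.1 him⟩
    have h2 : s.im ^ 2 ≤ (ρ + 1) ^ 2 := sq_le_sq' (abs_le.1 him).1 (abs_le.1 him).2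
    calc ‖innerInt N D ρ s‖ ≤ max B₂ 0 := h1.trans (le_max_left _ _)
      _ = max B₂ 0 * (Real.exp (a * (ρ + 1) ^ 2) * Real.exp (-(a * (ρ + 1) ^ 2))) := by
          rw [← Real.exp_add]; simp
      _ ≤ max B₂ 0 * (Real.exp (a * (ρ + 1) ^ 2) * Real.exp (-a * s.im ^ 2)) := by
          refine mul_le_mul_of_nonneg_left (mul_le_mul_of_nonneg_left
            (Real.exp_le_exp.2 ?_) (Real.exp_pos _).le) (le_max_right _ _)
          nlinarith
      _ = max B₂ 0 * Real.exp (a * (ρ + 1) ^ 2) * Real.exp (-a * s.im ^ 2) := by ring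
      _ ≤ _ := by gcongr; exact le_max_right _ _
  · have hsn : ρ + 1 < ‖s‖ := him.trans_le (Complex.abs_im_le_norm s)
    rw [innerInt_outside hD he hND h (by linarith), norm_mul]
    have h1 : ‖∮ t in C(0, ρ), D t / (s - t)‖ ≤ 2 * Real.pi * ρ * B := by
      refine circleIntegral.norm_integral_le_of_norm_le_const h.1.le fun t ht => ?_
      have h2 : 1 ≤ ‖s - t‖ := by
        have := norm_sub_norm_le s t
        rw [mem_sphere_zero_iff_norm.1 ht] at this
        linarith
      rw [norm_div]
      exact (div_le_self (norm_nonneg _) h2).trans (hB t ht)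
    have hp : 0 ≤ 2 * Real.pi * ρ * B := by have := Real.pi_pos; have := h.1; positivity
    calc ‖N s‖ * ‖∮ t in C(0, ρ), D t / (s - t)‖
        ≤ (C₁ * Real.exp (-a * s.im ^ 2)) * (2 * Real.pi * ρ * B) :=
          mul_le_mul (hC₁ s hs) h1 (norm_nonneg _) ((norm_nonneg _).trans (hC₁ s hs))
      _ = C₁ * (2 * Real.pi * ρ * B) * Real.exp (-a * s.im ^ 2) := by ring
      _ ≤ _ := by gcongr; exact le_max_left _ _

/-- The contour is deformed while there is no pole, and only then is the integrand split. The
correction vanishes: `(e(t) - e(s)) / (s - t)` is entire, and the contour does not wind around `s`.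
It meets the imaginary axis only at `0`, hence `v ≠ 0`. -/
theorem innerInt_imaginary (hθ : GoodEnd R θ₁) (hN : Differentiable ℂ N) (hD : RegularOff R D)
    (he : Differentiable ℂ e)
    (hND : ∀ κ : ℂ, expQuot R (-κ ^ 2) ≠ 0 → N κ * D κ = e κ) {ρ : ℝ} (h : Encloses R ρ)
    {v : ℝ} (hv : v ≠ 0) :
    innerInt N D ρ (v * Complex.I) =
      N (v * Complex.I) * deformedInt R θ₁ (fun t => D t / (v * Complex.I - t)) := by
  set s : ℂ := v * Complex.I with hs
  have hne : ∀ t ∈ contourSet R, s - t ≠ 0 := by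
    intro t ht h0
    have h1 : t = v * Complex.I := (sub_eq_zero.1 h0).symm
    have h2 := ht.2 (by rw [h1]; simp [hv])
    rw [h1] at h2
    simp at h2
  have hDc : ContinuousOn D (contourSet R) := fun t ht =>
    (hD t ht.1).continuousAt.continuousWithinAt
  have hsub : ContinuousOn (fun t => s - t) (contourSet R) := by fun_prop
  have c1 : ContinuousOn (fun t => N s * (D t / (s - t))) (contourSet R) :=
    continuousOn_const.mul (hDc.div hsub hne)
  have c2 : ContinuousOn (fun t => e t / (s - t)) (contourSet R) :=
    he.continuous.continuousOn.div hsub hne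
  have c3 : ContinuousOn (fun t => e s * (1 / (s - t))) (contourSet R) :=
    continuousOn_const.mul (continuousOn_const.div hsub hne)
  have hreg := innerInt_regular hN hD s
  have e1 : innerInt N D ρ s = deformedInt R θ₁ (fun t => D t * dslope N s t) := by
    rw [← circleIntegral_eq_deformedInt hθ.one_le hθ.lt hθ.lt_pi hθ.ne_zero hreg]
    exact circleIntegral_eq_of_encloses hreg hθ.encloses h
  have e2 : deformedInt R θ₁ (fun t => D t * dslope N s t) =
      deformedInt R θ₁ (fun t => N s * (D t / (s - t))) -
        deformedInt R θ₁ (fun t => e t / (s - t)) := by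
    rw [← deformedInt_sub hθ c1 c2]
    refine deformedInt_congr hθ fun t ht => ?_
    have h1 := hne t ht
    have hts : t ≠ s := fun h' => h1 (by rw [h', sub_self])
    have h3 : t - s ≠ 0 := sub_ne_zero.2 hts
    have h2 := hND t ht.1
    rw [dslope_of_ne N hts, slope_def_field, ← h2]
    field_simp
    ring
  have e3 : deformedInt R θ₁ (fun t => e t / (s - t)) = 0 := by
    have h1 : deformedInt R θ₁ (fun t => e t / (s - t) - e s * (1 / (s - t))) = 0 := by
      have h2 : deformedInt R θ₁ (fun t => -dslope e s t) = 0 := by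
        rw [← circleIntegral_eq_deformedInt (F := fun t => -dslope e s t) hθ.one_le hθ.lt
          hθ.lt_pi hθ.ne_zero (fun κ _ => (differentiable_dslope he s κ).neg)]
        exact (differentiable_dslope he s).neg.diffContOnCl.circleIntegral_eq_zero
          (curveRadius_pos R θ₁).le
      rw [← h2]
      refine deformedInt_congr hθ fun t ht => ?_
      have h1 := hne t ht
      have hts : t ≠ s := fun h' => h1 (by rw [h', sub_self])
      have h3 : t - s ≠ 0 := sub_ne_zero.2 hts
      rw [dslope_of_ne e hts, slope_def_field]
      field_simp
      ring
    rw [deformedInt_sub hθ c2 c3, deformedInt_const_mul, deformedInt_inv_sub hθ hv] at h1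
    simpa using h1
  rw [e1, e2, e3, sub_zero, deformedInt_const_mul]

/-- The double integral over a circle and a vertical line, moved to the deformed contour and the
imaginary axis. -/
theorem circle_line_eq_deformed (hθ : GoodEnd R θ₁) (hN : Differentiable ℂ N)
    (hD : RegularOff R D) (he : Differentiable ℂ e)
    (hND : ∀ κ : ℂ, expQuot R (-κ ^ 2) ≠ 0 → N κ * D κ = e κ) {a : ℝ} (ha : 0 < a)
    (hdec : ∀ A : ℝ, ∃ C : ℝ, ∀ s : ℂ, |s.re| ≤ A → ‖N s‖ ≤ C * Real.exp (-a * s.im ^ 2))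
    {ρ c : ℝ} (h : Encloses R ρ) (hc : ρ < |c|) :
    (∮ t in C(0, ρ), ∫ v : ℝ, N (c + v * Complex.I) * D t / (c + v * Complex.I - t)) =
      ∫ v : ℝ, N (v * Complex.I) *
        deformedInt R θ₁ (fun t => D t / (v * Complex.I - t)) := by
  have hout : ∀ v : ℝ, ρ < ‖(c : ℂ) + v * Complex.I‖ := fun v => by
    refine hc.trans_le ?_
    simpa using Complex.abs_re_le_norm ((c : ℂ) + v * Complex.I)
  -- change of the order of integration
  have hswap : (∮ t in C(0, ρ), ∫ v : ℝ, N (c + v * Complex.I) * D t / (c + v * Complex.I - t)) =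
      ∫ v : ℝ, innerInt N D ρ (c + v * Complex.I) := by
    obtain ⟨C₁, hC₁⟩ := hdec |c|
    obtain ⟨B, hB⟩ := (isCompact_sphere (0 : ℂ) ρ).exists_bound_of_continuousOn
      (continuousOn_sphere_of_regular hD h)
    have hsph : ∀ θ, circleMap 0 ρ θ ∈ Metric.sphere (0 : ℂ) ρ := fun θ =>
      circleMap_mem_sphere _ h.1.le θ
    have hgap : ∀ θ v : ℝ, |c| - ρ ≤ ‖(c : ℂ) + v * Complex.I - circleMap 0 ρ θ‖ := by
      intro θ v
      have h1 := norm_sub_norm_le ((c : ℂ) + v * Complex.I) (circleMap 0 ρ θ)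
      have h2 : |c| ≤ ‖(c : ℂ) + v * Complex.I‖ := by
        simpa using Complex.abs_re_le_norm ((c : ℂ) + v * Complex.I)
      rw [mem_sphere_zero_iff_norm.1 (hsph θ)] at h1
      linarith
    simp only [circleIntegral, ← MeasureTheory.integral_smul]
    rw [MeasureTheory.intervalIntegral_integral_swap]
    · refine MeasureTheory.integral_congr_ae (MeasureTheory.ae_of_all _ fun v => ?_)
      beta_reduce
      rw [innerInt_outside hD he hND h (hout v), circleIntegral,
        ← intervalIntegral.integral_const_mul]
      refine intervalIntegral.integral_congr fun θ _ => ?_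
      simp only [smul_eq_mul]
      ring
    · have hcont : Continuous (Function.uncurry fun (θ v : ℝ) => deriv (circleMap 0 ρ) θ •
          (N (c + v * Complex.I) * D (circleMap 0 ρ θ) /
            (c + v * Complex.I - circleMap 0 ρ θ))) := by
        have h1 : Continuous fun θ : ℝ => D (circleMap 0 ρ θ) :=
          (continuousOn_sphere_of_regular hD h).comp_continuous (continuous_circleMap 0 ρ) hsph
        have h2 : Continuous fun θ : ℝ => deriv (circleMap 0 ρ) θ := by
          simp only [deriv_circleMap]
          exact (continuous_circleMap 0 ρ).mul continuous_const
        have h3 : Continuous fun p : ℝ × ℝ => N (c + p.2 * Complex.I) :=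
          hN.continuous.comp (by fun_prop)
        have h4 : Continuous fun p : ℝ × ℝ => (c : ℂ) + p.2 * Complex.I - circleMap 0 ρ p.1 := by
          have := (continuous_circleMap 0 ρ).comp (continuous_fst (X := ℝ) (Y := ℝ))
          exact (by fun_prop : Continuous fun p : ℝ × ℝ => (c : ℂ) + p.2 * Complex.I).sub this
        refine (h2.comp continuous_fst).smul ((h3.mul (h1.comp continuous_fst)).div h4 fun p => ?_)
        have := hgap p.1 p.2
        rw [← norm_pos_iff]
        linarith
      have hbd : MeasureTheory.Integrable (fun p : ℝ × ℝ =>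
          (1 : ℝ) * (ρ * (C₁ * B / (|c| - ρ)) * Real.exp (-a * p.2 ^ 2)))
          ((MeasureTheory.volume.restrict (uIoc 0 (2 * Real.pi))).prod MeasureTheory.volume) := by
        have hfin : MeasureTheory.Integrable (fun _ : ℝ => (1 : ℝ))
            (MeasureTheory.volume.restrict (uIoc 0 (2 * Real.pi))) := by
          have : MeasureTheory.IntegrableOn (fun _ : ℝ => (1 : ℝ)) (uIoc 0 (2 * Real.pi)) :=
            MeasureTheory.integrableOn_const (by rw [uIoc]; simp)
          exact this
        exact hfin.mul_prod ((integrable_exp_neg_mul_sq ha).const_mul _)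
      refine hbd.mono' hcont.aestronglyMeasurable (MeasureTheory.ae_of_all _ fun p => ?_)
      rcases p with ⟨θ, v⟩
      simp only [Function.uncurry]
      rw [norm_smul, norm_div, norm_mul, deriv_circleMap, norm_mul, Complex.norm_I, mul_one,
        mem_sphere_zero_iff_norm.1 (hsph θ), one_mul]
      have h1 := hC₁ (c + v * Complex.I) (by simp)
      simp only [Complex.add_im, Complex.ofReal_im, Complex.mul_im, Complex.I_im, mul_one,
        Complex.ofReal_re, Complex.I_re, mul_zero, zero_add, add_zero] at h1
      have h2 := hB _ (hsph θ)
      have h3 := hgap θ v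
      have h4 : 0 < |c| - ρ := by linarith
      have h5 : ‖N (c + v * Complex.I)‖ * ‖D (circleMap 0 ρ θ)‖ ≤
          C₁ * Real.exp (-a * v ^ 2) * B :=
        mul_le_mul h1 h2 (norm_nonneg _) ((norm_nonneg _).trans h1)
      have h6 : ‖N (c + v * Complex.I)‖ * ‖D (circleMap 0 ρ θ)‖ /
          ‖(c : ℂ) + v * Complex.I - circleMap 0 ρ θ‖ ≤
          C₁ * Real.exp (-a * v ^ 2) * B / (|c| - ρ) :=
        div_le_div₀ ((by positivity : (0 : ℝ) ≤ _).trans h5) h5 h4 h3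
      calc _ ≤ ρ * (C₁ * Real.exp (-a * v ^ 2) * B / (|c| - ρ)) :=
            mul_le_mul_of_nonneg_left h6 h.1.le
        _ = _ := by ring
  rw [hswap]
  obtain ⟨C, hC⟩ := exists_innerInt_bound hN hD he hND ha hdec h |c|
  -- The entire inner integral lets the line cross the circle without any residue.
  rw [integral_vertical_shift (differentiable_innerInt hN hD he hND h) ha hC]
  refine MeasureTheory.integral_congr_ae ?_
  have h0 : ∀ᵐ v : ℝ, v ≠ 0 := by
    simp [MeasureTheory.ae_iff]
  filter_upwards [h0] with v hv
  exact innerInt_imaginary hθ hN hD he hND h hv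

end Deform

/-! ### Laplace integrals depending on two complex variables -/

section Laplace

variable {Ω : Type*} [MeasurableSpace Ω] {μ : MeasureTheory.Measure Ω}

/-- Differentiation under the integral replaces `Φ` by the operator-valued `A ⊗ Φ`, and the extra
`‖A‖` is absorbed by raising the exponential rate by one. The class of integrals is thus stable, and
induction works once the target space is arbitrary. -/
theorem contDiff_laplace_aux (n : ℕ) {V : Type} [NormedAddCommGroup V] [NormedSpace ℂ V]
    [FiniteDimensional ℂ V]
    {A : Ω → V →L[ℂ] ℂ} (hA : MeasureTheory.AEStronglyMeasurable A μ) :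
    ∀ {E : Type} [NormedAddCommGroup E] [NormedSpace ℂ E] {Φ : Ω → E},
      MeasureTheory.AEStronglyMeasurable Φ μ →
      (∀ M : ℝ, MeasureTheory.Integrable (fun ξ => Real.exp (M * ‖A ξ‖) * ‖Φ ξ‖) μ) →
      ContDiff ℂ n (fun z => ∫ ξ, Complex.exp (A ξ z) • Φ ξ ∂μ) := by
  have hmeas : ∀ {E : Type} [NormedAddCommGroup E] [NormedSpace ℂ E] {Φ : Ω → E},
      MeasureTheory.AEStronglyMeasurable Φ μ → ∀ z : V,
      MeasureTheory.AEStronglyMeasurable (fun ξ => Complex.exp (A ξ z) • Φ ξ) μ :=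
    fun hΦ z => (Complex.continuous_exp.comp_aestronglyMeasurable
      (hA.apply_continuousLinearMap z)).smul hΦ
  have hexp : ∀ (ξ : Ω) (z : V) (M : ℝ), ‖z‖ ≤ M →
      ‖Complex.exp (A ξ z)‖ ≤ Real.exp (M * ‖A ξ‖) := by
    intro ξ z M hM
    rw [Complex.norm_exp]
    refine Real.exp_le_exp.2 ((Complex.re_le_norm _).trans (((A ξ).le_opNorm z).trans ?_))
    rw [mul_comm]
    exact mul_le_mul_of_nonneg_right hM (norm_nonneg _)
  have hderiv : ∀ {E : Type} [NormedAddCommGroup E] [NormedSpace ℂ E] {Φ : Ω → E},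
      MeasureTheory.AEStronglyMeasurable Φ μ →
      (∀ M : ℝ, MeasureTheory.Integrable (fun ξ => Real.exp (M * ‖A ξ‖) * ‖Φ ξ‖) μ) →
      ∀ z : V, HasFDerivAt (fun z => ∫ ξ, Complex.exp (A ξ z) • Φ ξ ∂μ)
        (∫ ξ, Complex.exp (A ξ z) • (A ξ).smulRight (Φ ξ) ∂μ) z := by
    intro E _ _ Φ hΦ hint z
    have hΦ' : MeasureTheory.AEStronglyMeasurable (fun ξ => (A ξ).smulRight (Φ ξ)) μ :=
      (ContinuousLinearMap.smulRightL ℂ V E).aestronglyMeasurable_comp₂ hA hΦ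
    refine hasFDerivAt_integral_of_dominated_of_fderiv_le
      (bound := fun ξ => Real.exp ((‖z‖ + 2) * ‖A ξ‖) * ‖Φ ξ‖)
      (F' := fun z ξ => Complex.exp (A ξ z) • (A ξ).smulRight (Φ ξ))
      (Metric.ball_mem_nhds z one_pos) (Eventually.of_forall (hmeas hΦ)) ?_ (hmeas hΦ' z) ?_
      (hint _) ?_
    · refine (hint ‖z‖).mono' (hmeas hΦ z) (MeasureTheory.ae_of_all _ fun ξ => ?_)
      rw [norm_smul]
      exact mul_le_mul_of_nonneg_right (hexp ξ z _ le_rfl) (norm_nonneg _)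
    · refine MeasureTheory.ae_of_all _ fun ξ w hw => ?_
      have hw' : ‖w‖ ≤ ‖z‖ + 1 := by
        have := norm_le_norm_add_norm_sub' w z
        rw [Metric.mem_ball, dist_eq_norm] at hw
        linarith
      rw [norm_smul, ContinuousLinearMap.norm_smulRight_apply, ← mul_assoc]
      refine mul_le_mul_of_nonneg_right ?_ (norm_nonneg _)
      have h1 : ‖A ξ‖ ≤ Real.exp ‖A ξ‖ := by linarith [Real.add_one_le_exp ‖A ξ‖]
      calc ‖Complex.exp (A ξ w)‖ * ‖A ξ‖ ≤ Real.exp ((‖z‖ + 1) * ‖A ξ‖) * Real.exp ‖A ξ‖ :=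
            mul_le_mul (hexp ξ w _ hw') h1 (norm_nonneg _) (Real.exp_pos _).le
        _ = Real.exp ((‖z‖ + 2) * ‖A ξ‖) := by rw [← Real.exp_add]; congr 1; ring
    · refine MeasureTheory.ae_of_all _ fun ξ w _ => ?_
      have h1 := ((A ξ).hasFDerivAt (x := w)).cexp.smul_const (Φ ξ)
      refine h1.congr_fderiv ?_
      ext u
      simp [mul_smul]
  induction n with
  | zero =>
    intro E _ _ Φ hΦ hint
    have : Continuous (fun z => ∫ ξ, Complex.exp (A ξ z) • Φ ξ ∂μ) :=
      continuous_iff_continuousAt.2 fun z => (hderiv hΦ hint z).continuousAt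
    exact contDiff_zero.2 this
  | succ n ih =>
    intro E _ _ Φ hΦ hint
    have hΦ' : MeasureTheory.AEStronglyMeasurable (fun ξ => (A ξ).smulRight (Φ ξ)) μ :=
      (ContinuousLinearMap.smulRightL ℂ V E).aestronglyMeasurable_comp₂ hA hΦ
    push_cast
    rw [contDiff_succ_iff_fderiv]
    refine ⟨fun z => (hderiv hΦ hint z).differentiableAt, by simp, ?_⟩
    have : fderiv ℂ (fun z => ∫ ξ, Complex.exp (A ξ z) • Φ ξ ∂μ) =
        fun z => ∫ ξ, Complex.exp (A ξ z) • (A ξ).smulRight (Φ ξ) ∂μ :=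
      funext fun z => (hderiv hΦ hint z).fderiv
    rw [this]
    refine ih hΦ' fun M => ?_
    refine (hint (M + 1)).mono' ?_ (MeasureTheory.ae_of_all _ fun ξ => ?_)
    · exact (Real.continuous_exp.comp_aestronglyMeasurable (hA.norm.const_mul M)).mul hΦ'.norm
    · rw [Real.norm_of_nonneg (by positivity), ContinuousLinearMap.norm_smulRight_apply,
        ← mul_assoc]
      refine mul_le_mul_of_nonneg_right ?_ (norm_nonneg _)
      have h1 : ‖A ξ‖ ≤ Real.exp ‖A ξ‖ := by linarith [Real.add_one_le_exp ‖A ξ‖]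
      calc Real.exp (M * ‖A ξ‖) * ‖A ξ‖ ≤ Real.exp (M * ‖A ξ‖) * Real.exp ‖A ξ‖ := by gcongr
        _ = Real.exp ((M + 1) * ‖A ξ‖) := by rw [← Real.exp_add]; congr 1; ring

/-- The two-variable Laplace integral `∫ e^{a x + b y} Φ`. -/
def laplace (μ : MeasureTheory.Measure Ω) (a b Φ : Ω → ℂ) (z : ℂ × ℂ) : ℂ :=
  ∫ ξ, Complex.exp (a ξ * z.1 + b ξ * z.2) * Φ ξ ∂μ

theorem norm_cexp_le (a b : ℂ) (z : ℂ × ℂ) {M : ℝ} (hM : ‖z‖ ≤ M) :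
    ‖Complex.exp (a * z.1 + b * z.2)‖ ≤ Real.exp (M * (‖a‖ + ‖b‖)) := by
  rw [Complex.norm_exp]
  refine Real.exp_le_exp.2 ((Complex.re_le_norm _).trans ((norm_add_le _ _).trans ?_))
  rw [norm_mul, norm_mul, mul_add, mul_comm M, mul_comm M]
  have h1 : ‖z.1‖ ≤ M := (norm_fst_le z).trans hM
  have h2 : ‖z.2‖ ≤ M := (norm_snd_le z).trans hM
  gcongr

theorem contDiff_laplace {a b Φ : Ω → ℂ} (ha : MeasureTheory.AEStronglyMeasurable a μ)
    (hb : MeasureTheory.AEStronglyMeasurable b μ) (hΦ : MeasureTheory.AEStronglyMeasurable Φ μ)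
    (hint : ∀ M : ℝ, MeasureTheory.Integrable
      (fun ξ => Real.exp (M * (‖a ξ‖ + ‖b ξ‖)) * ‖Φ ξ‖) μ) :
    ContDiff ℂ ∞ (laplace μ a b Φ) := by
  set A : Ω → (ℂ × ℂ) →L[ℂ] ℂ := fun ξ =>
    a ξ • ContinuousLinearMap.fst ℂ ℂ ℂ + b ξ • ContinuousLinearMap.snd ℂ ℂ ℂ with hA
  have hAm : MeasureTheory.AEStronglyMeasurable A μ :=
    (ha.smul_const _).add (hb.smul_const _)
  have hAn : ∀ ξ, ‖A ξ‖ ≤ ‖a ξ‖ + ‖b ξ‖ := by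
    intro ξ
    refine (norm_add_le _ _).trans (add_le_add ?_ ?_)
    · rw [norm_smul]
      exact mul_le_of_le_one_right (norm_nonneg _) (ContinuousLinearMap.norm_fst_le ..)
    · rw [norm_smul]
      exact mul_le_of_le_one_right (norm_nonneg _) (ContinuousLinearMap.norm_snd_le ..)
  rw [contDiff_infty]
  intro n
  have h := contDiff_laplace_aux n hAm hΦ (fun M => by
    refine (hint |M|).mono' ?_ (MeasureTheory.ae_of_all _ fun ξ => ?_)
    · exact (Real.continuous_exp.comp_aestronglyMeasurable (hAm.norm.const_mul M)).mul hΦ.norm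
    · rw [Real.norm_of_nonneg (by positivity)]
      refine mul_le_mul_of_nonneg_right (Real.exp_le_exp.2 ?_) (norm_nonneg _)
      calc M * ‖A ξ‖ ≤ |M| * ‖A ξ‖ := by gcongr; exact le_abs_self M
        _ ≤ _ := by gcongr; exact hAn ξ)
  convert h using 2 with z
  simp [laplace, hA]

/-- Entire functions of two variables that converge locally uniformly. -/
structure EntireConv (F : ℕ → ℂ × ℂ → ℂ) (f : ℂ × ℂ → ℂ) : Prop where
  contDiff : ∀ᶠ n in atTop, ContDiff ℂ ∞ (F n)
  contDiff_lim : ContDiff ℂ ∞ f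
  tendsto : ∀ z₀, Tendsto (fun p : ℕ × (ℂ × ℂ) => F p.1 p.2) (atTop ×ˢ 𝓝 z₀) (𝓝 (f z₀))

theorem EntireConv.add {F G : ℕ → ℂ × ℂ → ℂ} {f g : ℂ × ℂ → ℂ} (hF : EntireConv F f)
    (hG : EntireConv G g) : EntireConv (fun n z => F n z + G n z) (fun z => f z + g z) where
  contDiff := by filter_upwards [hF.contDiff, hG.contDiff] with n h1 h2 using h1.add h2
  contDiff_lim := hF.contDiff_lim.add hG.contDiff_lim
  tendsto z₀ := (hF.tendsto z₀).add (hG.tendsto z₀)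

theorem EntireConv.mul {F G : ℕ → ℂ × ℂ → ℂ} {f g : ℂ × ℂ → ℂ} (hF : EntireConv F f)
    (hG : EntireConv G g) : EntireConv (fun n z => F n z * G n z) (fun z => f z * g z) where
  contDiff := by filter_upwards [hF.contDiff, hG.contDiff] with n h1 h2 using h1.mul h2
  contDiff_lim := hF.contDiff_lim.mul hG.contDiff_lim
  tendsto z₀ := (hF.tendsto z₀).mul (hG.tendsto z₀)

theorem EntireConv.const {c : ℕ → ℂ} {c₀ : ℂ} (h : Tendsto c atTop (𝓝 c₀)) :
    EntireConv (fun n _ => c n) (fun _ => c₀) where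
  contDiff := Eventually.of_forall fun _ => contDiff_const
  contDiff_lim := contDiff_const
  tendsto _ := h.comp tendsto_fst

theorem EntireConv.sum {ι : Type*} (s : Finset ι) {F : ι → ℕ → ℂ × ℂ → ℂ} {f : ι → ℂ × ℂ → ℂ}
    (h : ∀ i ∈ s, EntireConv (F i) (f i)) :
    EntireConv (fun n z => ∑ i ∈ s, F i n z) (fun z => ∑ i ∈ s, f i z) where
  contDiff := by
    have : ∀ᶠ n in atTop, ∀ i ∈ s, ContDiff ℂ ∞ (F i n) :=
      (Filter.eventually_all_finset s).2 fun i hi => (h i hi).contDiff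
    filter_upwards [this] with n hn using ContDiff.sum fun i hi => hn i hi
  contDiff_lim := ContDiff.sum fun i hi => (h i hi).contDiff_lim
  tendsto z₀ := tendsto_finsetSum s fun i hi => (h i hi).tendsto z₀

/-- Dominated convergence for Laplace integrals. -/
theorem entireConv_laplace {a b Φ : ℕ → Ω → ℂ} {a₀ b₀ Φ₀ : Ω → ℂ} {g : ℝ → Ω → ℝ}
    (ha : ∀ n, MeasureTheory.AEStronglyMeasurable (a n) μ)
    (hb : ∀ n, MeasureTheory.AEStronglyMeasurable (b n) μ)
    (hΦ : ∀ᶠ n in atTop, MeasureTheory.AEStronglyMeasurable (Φ n) μ)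
    (hlim : ContDiff ℂ ∞ (laplace μ a₀ b₀ Φ₀))
    (hg : ∀ M, MeasureTheory.Integrable (g M) μ)
    (hbound : ∀ᶠ n in atTop, ∀ M, ∀ᵐ ξ ∂μ,
      Real.exp (M * (‖a n ξ‖ + ‖b n ξ‖)) * ‖Φ n ξ‖ ≤ g M ξ)
    (ht : ∀ z₀ : ℂ × ℂ, ∀ᵐ ξ ∂μ, Tendsto
      (fun p : ℕ × (ℂ × ℂ) => Complex.exp (a p.1 ξ * p.2.1 + b p.1 ξ * p.2.2) * Φ p.1 ξ)
      (atTop ×ˢ 𝓝 z₀) (𝓝 (Complex.exp (a₀ ξ * z₀.1 + b₀ ξ * z₀.2) * Φ₀ ξ))) :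
    EntireConv (fun n => laplace μ (a n) (b n) (Φ n)) (laplace μ a₀ b₀ Φ₀) where
  contDiff := by
    filter_upwards [hΦ, hbound] with n h1 h2
    refine contDiff_laplace (ha n) (hb n) h1 fun M => (hg M).mono' ?_ ?_
    · exact (Real.continuous_exp.comp_aestronglyMeasurable
        (((ha n).norm.add (hb n).norm).const_mul M)).mul h1.norm
    · filter_upwards [h2 M] with ξ hξ
      rwa [Real.norm_of_nonneg (by positivity)]
  contDiff_lim := hlim
  tendsto z₀ := by
    refine MeasureTheory.tendsto_integral_filter_of_dominated_convergence (g (‖z₀‖ + 1)) ?_ ?_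
      (hg _) (ht z₀)
    · filter_upwards [hΦ.prod_inl (𝓝 z₀)] with p hp
      exact (Complex.continuous_exp.comp_aestronglyMeasurable
        (((ha p.1).mul_const _).add ((hb p.1).mul_const _))).mul hp
    · have hz : ∀ᶠ z in 𝓝 z₀, ‖z‖ ≤ ‖z₀‖ + 1 := by
        have := (continuous_norm.tendsto z₀).eventually (eventually_lt_nhds (lt_add_one ‖z₀‖))
        filter_upwards [this] with z hz using hz.le
      filter_upwards [hbound.prod_inl (𝓝 z₀), hz.prod_inr atTop] with p hp hz
      filter_upwards [hp (‖z₀‖ + 1)] with ξ hξ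
      rw [norm_mul]
      exact (mul_le_mul_of_nonneg_right (norm_cexp_le _ _ _ hz) (norm_nonneg _)).trans hξ

end Laplace

/-! ### Convergence of all partial derivatives -/

/-- The derivative in a fixed direction. -/
def dirDeriv (e : ℂ × ℂ) (F : ℂ × ℂ → ℂ) (z : ℂ × ℂ) : ℂ := fderiv ℂ F z e

theorem contDiff_dirDeriv (e : ℂ × ℂ) {F : ℂ × ℂ → ℂ} (hF : ContDiff ℂ ∞ F) :
    ContDiff ℂ ∞ (dirDeriv e F) :=
  (contDiff_infty_iff_fderiv.1 hF).2.clm_apply contDiff_const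

theorem contDiff_iterate_dirDeriv (e : ℂ × ℂ) {F : ℂ × ℂ → ℂ} (hF : ContDiff ℂ ∞ F) (q : ℕ) :
    ContDiff ℂ ∞ ((dirDeriv e)^[q] F) := by
  induction q with
  | zero => exact hF
  | succ q ih => rw [Function.iterate_succ_apply']; exact contDiff_dirDeriv e ih

/-- Convergence jointly in the index and the point, to a continuous limit, is locally uniform. -/
theorem tendstoLocallyUniformly_of_tendsto {F : ℕ → ℂ × ℂ → ℂ} {f : ℂ × ℂ → ℂ} (hf : Continuous f)
    (h : ∀ z₀, Tendsto (fun p : ℕ × (ℂ × ℂ) => F p.1 p.2) (atTop ×ˢ 𝓝 z₀) (𝓝 (f z₀))) :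
    TendstoLocallyUniformly F f atTop := by
  rw [tendstoLocallyUniformly_iff_forall_tendsto]
  intro z₀
  have h1 : Tendsto (fun p : ℕ × (ℂ × ℂ) => f p.2) (atTop ×ˢ 𝓝 z₀) (𝓝 (f z₀)) :=
    (hf.tendsto z₀).comp tendsto_snd
  exact (h1.prodMk_nhds (h z₀)).mono_right (nhds_prod_eq.le.trans (by
    rw [← nhds_prod_eq]; exact nhds_le_uniformity (f z₀)))

theorem EntireConv.tendstoUniformlyOn {F : ℕ → ℂ × ℂ → ℂ} {f : ℂ × ℂ → ℂ} (h : EntireConv F f)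
    {K : Set (ℂ × ℂ)} (hK : IsCompact K) : TendstoUniformlyOn F f atTop K :=
  (tendstoLocallyUniformlyOn_iff_tendstoUniformlyOn_of_compact hK).1
    (tendstoLocallyUniformly_of_tendsto h.contDiff_lim.continuous
      h.tendsto).tendstoLocallyUniformlyOn

/-- Cauchy's estimate on the unit disc of the complex line through `z` in direction `e`. -/
theorem norm_dirDeriv_le {e : ℂ × ℂ} (he : ‖e‖ ≤ 1) {F : ℂ × ℂ → ℂ} (hF : Differentiable ℂ F)
    {z : ℂ × ℂ} {C : ℝ} (hC : ∀ w, dist w z ≤ 1 → ‖F w‖ ≤ C) : ‖dirDeriv e F z‖ ≤ C := by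
  have hl : HasDerivAt (fun ζ : ℂ => z + ζ • e) e 0 := by
    simpa using ((hasDerivAt_id (0 : ℂ)).smul_const e).const_add z
  have hd : HasDerivAt (fun ζ : ℂ => F (z + ζ • e)) (dirDeriv e F z) 0 :=
    (hF z).hasFDerivAt.comp_hasDerivAt_of_eq 0 hl (by simp)
  have hdiff : Differentiable ℂ (fun ζ : ℂ => F (z + ζ • e)) := hF.comp (by fun_prop)
  have := Complex.norm_deriv_le_of_forall_mem_sphere_norm_le (c := 0) one_pos
    hdiff.diffContOnCl (C := C) (fun ζ hζ => hC _ (by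
      rw [dist_eq_norm, add_sub_cancel_left, norm_smul, mem_sphere_zero_iff_norm.1 hζ, one_mul]
      exact he))
  rwa [hd.deriv, div_one] at this

/-- Cauchy's estimate applied to `F n - f`: uniform smallness on the ball of radius `2` controls the
derivative on the ball of radius `1`. -/
theorem EntireConv.dirDeriv {e : ℂ × ℂ} (he : ‖e‖ ≤ 1) {F : ℕ → ℂ × ℂ → ℂ} {f : ℂ × ℂ → ℂ}
    (h : EntireConv F f) : EntireConv (fun n => dirDeriv e (F n)) (dirDeriv e f) where
  contDiff := by filter_upwards [h.contDiff] with n hn using contDiff_dirDeriv e hn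
  contDiff_lim := contDiff_dirDeriv e h.contDiff_lim
  tendsto z₀ := by
    have hu := h.tendstoUniformlyOn (isCompact_closedBall z₀ 2)
    have h1 : Tendsto (fun p : ℕ × (ℂ × ℂ) => HigherPearcey.dirDeriv e (F p.1) p.2 -
        HigherPearcey.dirDeriv e f p.2) (atTop ×ˢ 𝓝 z₀) (𝓝 0) := by
      rw [Metric.tendsto_nhds]
      intro ε hε
      have h2 := Metric.tendstoUniformlyOn_iff.1 hu (ε / 2) (half_pos hε)
      have h3 : ∀ᶠ z in 𝓝 z₀, z ∈ Metric.closedBall z₀ 1 :=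
        Metric.closedBall_mem_nhds z₀ one_pos
      filter_upwards [(h2.and h.contDiff).prod_inl (𝓝 z₀), h3.prod_inr atTop] with p hp hz
      have hFd := hp.2.differentiable (by simp)
      have hfd := h.contDiff_lim.differentiable (by simp)
      have e1 : HigherPearcey.dirDeriv e (F p.1) p.2 - HigherPearcey.dirDeriv e f p.2 =
          HigherPearcey.dirDeriv e (fun w => F p.1 w - f w) p.2 := by
        rw [HigherPearcey.dirDeriv, HigherPearcey.dirDeriv, HigherPearcey.dirDeriv,
          fderiv_fun_sub (hFd _) (hfd _)]
        rfl
      rw [dist_zero_right, e1]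
      refine (norm_dirDeriv_le he (hFd.sub hfd) (C := ε / 2) fun w hw => ?_).trans_lt
        (half_lt_self hε)
      have h4 := hp.1 w (by
        rw [Metric.mem_closedBall] at hz ⊢
        linarith [dist_triangle w p.2 z₀])
      rw [dist_comm, dist_eq_norm] at h4
      exact h4.le
    have h5 : Tendsto (fun p : ℕ × (ℂ × ℂ) => HigherPearcey.dirDeriv e f p.2) (atTop ×ˢ 𝓝 z₀)
        (𝓝 (HigherPearcey.dirDeriv e f z₀)) :=
      ((contDiff_dirDeriv e h.contDiff_lim).continuous.tendsto z₀).comp tendsto_snd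
    simpa using h1.add h5

theorem EntireConv.iterate_dirDeriv {e : ℂ × ℂ} (he : ‖e‖ ≤ 1) {F : ℕ → ℂ × ℂ → ℂ}
    {f : ℂ × ℂ → ℂ} (h : EntireConv F f) (q : ℕ) :
    EntireConv (fun n => (HigherPearcey.dirDeriv e)^[q] (F n))
      ((HigherPearcey.dirDeriv e)^[q] f) := by
  induction q with
  | zero => exact h
  | succ q ih => simp only [Function.iterate_succ_apply']; exact ih.dirDeriv he

theorem iteratedDeriv_snd_eq {F : ℂ × ℂ → ℂ} (hF : ContDiff ℂ ∞ F) (x : ℂ) (q : ℕ) :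
    iteratedDeriv q (fun y : ℝ => F (x, y)) = fun y : ℝ => (dirDeriv (0, 1))^[q] F (x, y) := by
  induction q with
  | zero => simp
  | succ q ih =>
    rw [iteratedDeriv_succ, ih]
    funext y
    rw [Function.iterate_succ_apply']
    have hd := (contDiff_iterate_dirDeriv (0, 1) hF q).differentiable (by simp)
    have h1 : HasDerivAt (fun y : ℂ => (x, y)) ((0 : ℂ), (1 : ℂ)) (y : ℂ) :=
      (hasDerivAt_const _ x).prodMk (hasDerivAt_id _)
    have h2 : HasDerivAt (fun y : ℂ => (dirDeriv (0, 1))^[q] F (x, y))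
      (dirDeriv (0, 1) ((dirDeriv (0, 1))^[q] F) (x, y)) (y : ℂ) :=
      (hd (x, (y : ℂ))).hasFDerivAt.comp_hasDerivAt (y : ℂ) h1
    exact h2.comp_ofReal.deriv

theorem iteratedDeriv_fst_eq {F : ℂ × ℂ → ℂ} (hF : ContDiff ℂ ∞ F) (y : ℂ) (q : ℕ) :
    iteratedDeriv q (fun x : ℝ => F (x, y)) = fun x : ℝ => (dirDeriv (1, 0))^[q] F (x, y) := by
  induction q with
  | zero => simp
  | succ q ih =>
    rw [iteratedDeriv_succ, ih]
    funext x
    rw [Function.iterate_succ_apply']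
    have hd := (contDiff_iterate_dirDeriv (1, 0) hF q).differentiable (by simp)
    have h1 : HasDerivAt (fun x : ℂ => (x, y)) ((1 : ℂ), (0 : ℂ)) (x : ℂ) :=
      (hasDerivAt_id _).prodMk (hasDerivAt_const _ y)
    have h2 : HasDerivAt (fun x : ℂ => (dirDeriv (1, 0))^[q] F (x, y))
      (dirDeriv (1, 0) ((dirDeriv (1, 0))^[q] F) (x, y)) (x : ℂ) :=
      (hd ((x : ℂ), y)).hasFDerivAt.comp_hasDerivAt (x : ℂ) h1
    exact h2.comp_ofReal.deriv

theorem partialDeriv_eq {F : ℂ × ℂ → ℂ} (hF : ContDiff ℂ ∞ F) (p q : ℕ) (z : ℝ × ℝ) :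
    partialDeriv p q (fun x y : ℝ => F (x, y)) z =
      (dirDeriv (1, 0))^[p] ((dirDeriv (0, 1))^[q] F) (z.1, z.2) := by
  rw [partialDeriv]
  simp only [iteratedDeriv_snd_eq hF]
  rw [iteratedDeriv_fst_eq (contDiff_iterate_dirDeriv (0, 1) hF q)]

theorem EntireConv.tendstoUniformlyOn_partialDeriv {F : ℕ → ℂ × ℂ → ℂ} {f : ℂ × ℂ → ℂ}
    (h : EntireConv F f) {H : ℕ → ℝ → ℝ → ℂ} {h₀ : ℝ → ℝ → ℂ}
    (hH : ∀ᶠ n in atTop, H n = fun x y : ℝ => F n (x, y)) (hh : h₀ = fun x y : ℝ => f (x, y)) (p q : ℕ)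
    {S : Set (ℝ × ℝ)} (hS : Bornology.IsBounded S) :
    TendstoUniformlyOn (fun n => partialDeriv p q (H n)) (partialDeriv p q h₀) atTop S := by
  have h1 := (h.iterate_dirDeriv (e := (0, 1)) (by simp [Prod.norm_def]) q).iterate_dirDeriv
    (e := (1, 0)) (by simp [Prod.norm_def]) p
  set φ : ℝ × ℝ → ℂ × ℂ := fun z => (z.1, z.2) with hφ
  have hφc : Continuous φ := by fun_prop
  have hK : IsCompact (φ '' closure S) :=
    (Metric.isCompact_of_isClosed_isBounded isClosed_closure hS.closure).image hφc
  have h2 := (h1.tendstoUniformlyOn hK).comp φ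
  have h3 := h2.mono (s' := S) fun z hz => ⟨z, subset_closure hz, rfl⟩
  have h4 : partialDeriv p q h₀ =
      (HigherPearcey.dirDeriv (1, 0))^[p] ((HigherPearcey.dirDeriv (0, 1))^[q] f) ∘ φ := by
    funext z
    rw [hh, partialDeriv_eq h.contDiff_lim]; rfl
  rw [h4]
  refine h3.congr ?_
  filter_upwards [hH, h.contDiff] with n hn hc
  intro z _
  simp only [Function.comp]
  rw [hn, partialDeriv_eq hc]

theorem contDiff_real_of_complex {F : ℂ × ℂ → ℂ} (hF : ContDiff ℂ ∞ F) :
    ContDiff ℝ ∞ (fun z : ℝ × ℝ => F (z.1, z.2)) := by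
  have h1 : ContDiff ℝ ∞ F := hF.restrict_scalars ℝ
  refine h1.comp (ContDiff.prodMk ?_ ?_)
  · exact Complex.ofRealCLM.contDiff.comp contDiff_fst
  · exact Complex.ofRealCLM.contDiff.comp contDiff_snd

/-! ### Scales -/

/-- The ratio `n^{-1/(2R+2)}` between the local scale at the origin and the scale `n^{1/2}` of the
end-points. -/
def fineScale (R n : ℕ) : ℝ := (n : ℝ) ^ (-(1 / (2 * ((R : ℝ) + 1))))

/-- The factor `n^{-δ} τ / (1/2 - n^{-δ} τ)` of the quadratic exponent, multiplied by `2 n^δ`. -/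
def timeRate (R n : ℕ) (τ : ℝ) : ℝ := 4 * τ / (1 - 2 * ((n : ℝ) ^ (-scalingExponent R) * τ))

/-- The factor of the linear exponent. -/
def timeSlope (R n : ℕ) (τ : ℝ) : ℝ := 4 / (1 - 2 * ((n : ℝ) ^ (-scalingExponent R) * τ))

theorem fineScale_pos (R : ℕ) {n : ℕ} (hn : n ≠ 0) : 0 < fineScale R n :=
  Real.rpow_pos_of_pos (by positivity) _

theorem fineScale_le_one (R : ℕ) {n : ℕ} (hn : n ≠ 0) : fineScale R n ≤ 1 :=
  Real.rpow_le_one_of_one_le_of_nonpos (by exact_mod_cast Nat.one_le_iff_ne_zero.2 hn)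
    (by have : (0 : ℝ) ≤ 1 / (2 * ((R : ℝ) + 1)) := by positivity
        linarith)

theorem tendsto_fineScale (R : ℕ) : Tendsto (fineScale R) atTop (𝓝 0) :=
  (tendsto_rpow_neg_atTop (by positivity : (0 : ℝ) < 1 / (2 * ((R : ℝ) + 1)))).comp
    tendsto_natCast_atTop_atTop

/-- This relation fixes the scale: it makes the term of degree `2R + 2` independent of `n`. -/
theorem mul_fineScale_pow (R : ℕ) {n : ℕ} (hn : n ≠ 0) :
    (n : ℝ) * fineScale R n ^ (2 * (R + 1)) = 1 := by
  have hn' : (0 : ℝ) < n := by positivity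
  rw [fineScale, ← Real.rpow_natCast, ← Real.rpow_mul hn'.le]
  nth_rewrite 1 [← Real.rpow_one (n : ℝ)]
  rw [← Real.rpow_add hn']
  convert Real.rpow_zero (n : ℝ) using 2
  push_cast
  field_simp
  ring

theorem mul_fineScale_sq (R : ℕ) {n : ℕ} (hn : n ≠ 0) :
    (n : ℝ) * fineScale R n ^ 2 = (n : ℝ) ^ scalingExponent R := by
  have hn' : (0 : ℝ) < n := by positivity
  rw [fineScale, ← Real.rpow_natCast, ← Real.rpow_mul hn'.le]
  nth_rewrite 1 [← Real.rpow_one (n : ℝ)]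
  rw [← Real.rpow_add hn', scalingExponent]
  congr 1
  push_cast
  field_simp
  ring

theorem sqrt_mul_fineScale (R n : ℕ) (hn : n ≠ 0) :
    (n : ℝ) ^ (-(scalingExponent R / 2)) * Real.sqrt n * fineScale R n = 1 := by
  have hn' : (0 : ℝ) < n := by positivity
  rw [fineScale, Real.sqrt_eq_rpow, ← Real.rpow_add hn', ← Real.rpow_add hn', scalingExponent]
  convert Real.rpow_zero (n : ℝ) using 2
  field_simp
  ring

theorem scalingExponent_pos {R : ℕ} (hR : 1 ≤ R) : 0 < scalingExponent R := by
  unfold scalingExponent; positivity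

theorem tendsto_rpow_neg_scalingExponent {R : ℕ} (hR : 1 ≤ R) :
    Tendsto (fun n : ℕ => (n : ℝ) ^ (-scalingExponent R)) atTop (𝓝 0) :=
  (tendsto_rpow_neg_atTop (scalingExponent_pos hR)).comp tendsto_natCast_atTop_atTop

theorem tendsto_mul_fineScale_sq {R : ℕ} (hR : 1 ≤ R) :
    Tendsto (fun n : ℕ => (n : ℝ) * fineScale R n ^ 2) atTop atTop := by
  refine Tendsto.congr' ?_ ((tendsto_rpow_atTop (scalingExponent_pos hR)).comp
    tendsto_natCast_atTop_atTop)
  filter_upwards [eventually_ne_atTop 0] with n hn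
  exact (mul_fineScale_sq R hn).symm

theorem tendsto_time_denom {R : ℕ} (hR : 1 ≤ R) (τ : ℝ) :
    Tendsto (fun n : ℕ => 1 - 2 * ((n : ℝ) ^ (-scalingExponent R) * τ)) atTop (𝓝 1) := by
  simpa using (((tendsto_rpow_neg_scalingExponent hR).mul_const τ).const_mul 2).const_sub 1

theorem tendsto_timeRate {R : ℕ} (hR : 1 ≤ R) (τ : ℝ) :
    Tendsto (fun n => timeRate R n τ) atTop (𝓝 (4 * τ)) := by
  have h := (tendsto_const_nhds (x := 4 * τ)).div (tendsto_time_denom hR τ) one_ne_zero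
  rwa [div_one] at h

theorem tendsto_timeSlope {R : ℕ} (hR : 1 ≤ R) (τ : ℝ) :
    Tendsto (fun n => timeSlope R n τ) atTop (𝓝 4) := by
  have h := (tendsto_const_nhds (x := (4 : ℝ))).div (tendsto_time_denom hR τ) one_ne_zero
  rwa [div_one] at h

theorem eventually_abs_timeRate_le {R : ℕ} (hR : 1 ≤ R) (τ : ℝ) :
    ∀ᶠ n in atTop, |timeRate R n τ| ≤ |4 * τ| + 1 := by
  filter_upwards [(tendsto_timeRate hR τ).abs.eventually (eventually_lt_nhds (lt_add_one _))]
    with n hn using hn.le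

theorem eventually_abs_timeSlope_le {R : ℕ} (hR : 1 ≤ R) (τ : ℝ) :
    ∀ᶠ n in atTop, |timeSlope R n τ| ≤ 5 := by
  filter_upwards [(tendsto_timeSlope hR τ).abs.eventually
    (eventually_lt_nhds (by norm_num : |(4 : ℝ)| < 5))] with n hn using hn.le

/-! ### The weight on the local scale -/

/-- The weight function of the rescaled model. -/
def weight (R n : ℕ) (τ : ℝ) (s : ℂ) : ℂ :=
  Complex.exp (timeRate R n τ * s ^ 2) * expQuot R (-(fineScale R n * s) ^ 2) ^ n

/-- The weight function of the limiting kernel. -/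
def limitWeight (R : ℕ) (τ : ℝ) (s : ℂ) : ℂ :=
  Complex.exp (4 * τ * s ^ 2 + (-1) ^ R * s ^ (2 * R + 2) / ((R + 1).factorial : ℂ))

theorem differentiable_weight (R n : ℕ) (τ : ℝ) : Differentiable ℂ (weight R n τ) := by
  have h := differentiable_expQuot R
  have h2 : Differentiable ℂ fun s : ℂ => -((fineScale R n : ℂ) * s) ^ 2 := by fun_prop
  have h3 : Differentiable ℂ fun s : ℂ => (timeRate R n τ : ℂ) * s ^ 2 := by fun_prop
  exact h3.cexp.mul ((h.comp h2).pow n)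

theorem continuous_weight (R n : ℕ) (τ : ℝ) : Continuous (weight R n τ) :=
  (differentiable_weight R n τ).continuous

theorem tendsto_weight {R : ℕ} (hR : 1 ≤ R) (τ : ℝ) (s : ℂ) :
    Tendsto (fun n => weight R n τ s) atTop (𝓝 (limitWeight R τ s)) := by
  have h0 : Tendsto (fun n : ℕ => (fineScale R n : ℂ)) atTop (𝓝 0) := by
    exact_mod_cast (Complex.continuous_ofReal.tendsto 0).comp (tendsto_fineScale R)
  have h1 : Tendsto (fun n : ℕ => -((fineScale R n : ℂ) * s) ^ 2) atTop (𝓝 0) := by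
    simpa using ((h0.mul_const s).pow 2).neg
  have h2 : Tendsto (fun n : ℕ => (n : ℂ) * (-((fineScale R n : ℂ) * s) ^ 2) ^ (R + 1)) atTop
      (𝓝 ((-1) ^ (R + 1) * s ^ (2 * R + 2))) := by
    refine tendsto_const_nhds.congr' ?_
    filter_upwards [eventually_ne_atTop 0] with n hn
    have h := mul_fineScale_pow R hn
    have h' : (n : ℂ) * (fineScale R n : ℂ) ^ (2 * (R + 1)) = 1 := by exact_mod_cast h
    calc _ = (-1) ^ (R + 1) * s ^ (2 * R + 2) * 1 := by ring
      _ = (-1) ^ (R + 1) * s ^ (2 * R + 2) * (n * (fineScale R n : ℂ) ^ (2 * (R + 1))) := by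
          rw [h']
      _ = _ := by rw [neg_pow (((fineScale R n : ℂ) * s) ^ 2)]; ring
  have h3 := Complex.tendsto_one_add_pow_exp_of_tendsto
    (tendsto_mul_expQuot_sub_one R h1 h2)
  have h4 : Tendsto (fun n => Complex.exp ((timeRate R n τ : ℂ) * s ^ 2)) atTop
      (𝓝 (Complex.exp (((4 * τ : ℝ) : ℂ) * s ^ 2))) :=
    ((((Complex.continuous_ofReal.tendsto _).comp (tendsto_timeRate hR τ)).mul_const
      (s ^ 2)).cexp)
  have h5 := h4.mul h3
  rw [← Complex.exp_add] at h5
  convert h5 using 2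
  · simp [weight]
  · rw [limitWeight]
    congr 1
    push_cast
    ring

theorem limitWeight_ne_zero (R : ℕ) (τ : ℝ) (s : ℂ) : limitWeight R τ s ≠ 0 := Complex.exp_ne_zero _

/-- As `R ≥ 1`, the power dominates `u² - 1`, and completing the square gives the constant. Applied
with `u = v²`, it lets the term of degree `2R + 2` beat any quadratic exponent. -/
theorem exists_linear_sub_pow_le {R : ℕ} (hR : 1 ≤ R) {c : ℝ} (hc : 0 < c) (K : ℝ) :
    ∃ C : ℝ, ∀ u : ℝ, 0 ≤ u → K * u - c * u ^ (R + 1) ≤ C := by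
  refine ⟨c + K ^ 2 / (4 * c), fun u hu => ?_⟩
  have h1 : u ^ 2 - 1 ≤ u ^ (R + 1) := by
    rcases le_total u 1 with h | h
    · have : u ^ 2 ≤ 1 := pow_le_one₀ hu h
      have : 0 ≤ u ^ (R + 1) := by positivity
      linarith
    · have : u ^ 2 ≤ u ^ (R + 1) := pow_le_pow_right₀ h (by omega)
      linarith
  have h2 : K * u - c * u ^ 2 ≤ K ^ 2 / (4 * c) := by
    rw [le_div_iff₀ (by positivity)]
    nlinarith [sq_nonneg (K - 2 * c * u)]
  nlinarith [mul_le_mul_of_nonneg_left h1 hc.le]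

theorem norm_exp_rate_le {r K : ℝ} (hr : |r| ≤ K) (s : ℂ) :
    ‖Complex.exp (r * s ^ 2)‖ ≤ Real.exp (K * ‖s‖ ^ 2) := by
  rw [Complex.norm_exp]
  refine Real.exp_le_exp.2 ((Complex.re_le_norm _).trans ?_)
  rw [norm_mul, norm_pow, Complex.norm_real, Real.norm_eq_abs]
  gcongr

/-- After the `n`-th power the decay exponent is the minimum of `v^{2R+2}` and `n h² v²`, times
`gapConst`. The former is superquadratic and the coefficient of the latter tends to infinity, so any
Gaussian rate is reached. -/
theorem exists_norm_weight_axis_le {R : ℕ} (hR : 1 ≤ R) (τ K : ℝ) :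
    ∃ C : ℝ, 0 ≤ C ∧ ∀ᶠ n in atTop, ∀ v : ℝ,
      ‖weight R n τ (v * Complex.I)‖ ≤ C * Real.exp (-K * v ^ 2) := by
  have hg := gapConst_pos R
  set K' := |4 * τ| + 1 + |K| with hK'
  obtain ⟨C, hC⟩ := exists_linear_sub_pow_le hR hg K'
  refine ⟨Real.exp (max C 0), (Real.exp_pos _).le, ?_⟩
  filter_upwards [eventually_abs_timeRate_le hR τ, eventually_ne_atTop 0,
    (tendsto_mul_fineScale_sq hR).eventually_ge_atTop (K' / gapConst R)] with n h1 hn h2 v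
  set h := fineScale R n with hh
  have e1 : -((h : ℂ) * (v * Complex.I)) ^ 2 = ((h ^ 2 * v ^ 2 : ℝ) : ℂ) := by
    push_cast
    rw [mul_pow, mul_pow, Complex.I_sq]; ring
  have h3 := norm_expQuot_ofReal_le R (by positivity : 0 ≤ h ^ 2 * v ^ 2)
  have h4 : ‖expQuot R (-((h : ℂ) * (v * Complex.I)) ^ 2) ^ n‖ ≤
      Real.exp (-(gapConst R * min ((v ^ 2) ^ (R + 1)) (n * h ^ 2 * v ^ 2))) := by
    rw [norm_pow, e1]
    refine (pow_le_pow_left₀ (norm_nonneg _) h3 n).trans (le_of_eq ?_)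
    rw [← Real.exp_nat_mul]
    congr 1
    have e2 : (n : ℝ) * (h ^ 2 * v ^ 2) ^ (R + 1) = (v ^ 2) ^ (R + 1) := by
      have := mul_fineScale_pow R hn
      rw [← hh] at this
      rw [mul_pow, ← pow_mul, ← mul_assoc, this, one_mul]
    rw [← e2, mul_assoc (n : ℝ), ← mul_min_of_nonneg _ _ (Nat.cast_nonneg n)]
    ring
  rw [weight, norm_mul]
  calc _ ≤ Real.exp ((|4 * τ| + 1) * ‖(v : ℂ) * Complex.I‖ ^ 2) *
        Real.exp (-(gapConst R * min ((v ^ 2) ^ (R + 1)) (n * h ^ 2 * v ^ 2))) :=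
        mul_le_mul (norm_exp_rate_le h1 _) h4 (norm_nonneg _) (Real.exp_pos _).le
    _ ≤ _ := by
        rw [← Real.exp_add, ← Real.exp_add]
        refine Real.exp_le_exp.2 ?_
        have e3 : ‖(v : ℂ) * Complex.I‖ ^ 2 = v ^ 2 := by simp
        rw [e3]
        have hv := sq_nonneg v
        have h5 : K' * v ^ 2 - max C 0 ≤
            gapConst R * min ((v ^ 2) ^ (R + 1)) (n * h ^ 2 * v ^ 2) := by
          rw [mul_min_of_nonneg _ _ hg.le]
          refine le_min ?_ ?_
          · linarith [hC (v ^ 2) hv, le_max_left C 0]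
          · have h6 : K' ≤ gapConst R * (n * h ^ 2) := by
              rw [div_le_iff₀ hg] at h2; linarith
            have := mul_le_mul_of_nonneg_right h6 hv
            linarith [le_max_right C 0]
        have h7 : K * v ^ 2 ≤ |K| * v ^ 2 := mul_le_mul_of_nonneg_right (le_abs_self K) hv
        rw [hK'] at h5
        linarith

theorem exp_half_le_one_add {x : ℝ} (h0 : 0 ≤ x) (h1 : x ≤ 1) : Real.exp (x / 2) ≤ 1 + x := by
  have h2 := Real.add_one_le_exp (-(x / 2))
  rw [Real.exp_neg] at h2
  have hp := Real.exp_pos (x / 2)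
  rw [le_inv_comm₀ (by linarith) hp] at h2
  refine h2.trans ?_
  rw [inv_le_iff_one_le_mul₀ (by linarith)]
  nlinarith

/-- The restriction `h p ≤ 1` allows the use of `expQuot_ray_lower`. With `x = gapConst R * p^{2R+2}
/ n ≤ 1`, the inequality `1 + x ≥ exp(x/2)` turns the `n`-th power into an exponential in
`p^{2R+2}`, uniformly in `n`. -/
theorem exists_norm_weight_ray_inv_le {R : ℕ} (hR : 1 ≤ R) (τ K : ℝ) :
    ∃ C : ℝ, 0 ≤ C ∧ ∀ᶠ n in atTop, ∀ (q : Bool × Bool) (p : ℝ), 0 ≤ p → fineScale R n * p ≤ 1 →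
      ‖(weight R n τ (p * nearDir R q))⁻¹‖ ≤ C * Real.exp (-K * p ^ 2) := by
  have hg := gapConst_pos R
  set K' := |4 * τ| + 1 + |K| with hK'
  obtain ⟨C, hC⟩ := exists_linear_sub_pow_le hR (half_pos hg) K'
  refine ⟨Real.exp C, (Real.exp_pos _).le, ?_⟩
  filter_upwards [eventually_abs_timeRate_le hR τ, eventually_ne_atTop 0] with n h1 hn q p hp0 hp1
  set h := fineScale R n with hh
  have hh0 : 0 < h := fineScale_pos R hn
  have hhp : 0 ≤ h * p := by positivity
  have e1 : (h : ℂ) * (p * nearDir R q) = axisDir q * (h * p : ℝ) * turnExp q (rayAngle R / 2) := by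
    rw [nearDir]; push_cast; ring
  have e2 : 1 + gapConst R * ((p ^ 2) ^ (R + 1) / n) ≤
      ‖expQuot R (-((h : ℂ) * (p * nearDir R q)) ^ 2)‖ := by
    rw [e1, norm_expQuot_turn]
    have h2 := expQuot_ray_lower R (sq_nonneg (h * p)) (pow_le_one₀ hhp hp1)
    have e3 : ((h * p) ^ 2) ^ (R + 1) = (p ^ 2) ^ (R + 1) / n := by
      have := mul_fineScale_pow R hn
      rw [← hh] at this
      have hn' : (n : ℝ) ≠ 0 := by positivity
      field_simp
      calc _ = (n : ℝ) * h ^ (2 * (R + 1)) * (p ^ 2) ^ (R + 1) := by ring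
        _ = _ := by rw [this, one_mul]
    rw [e3] at h2
    refine h2.trans ((Complex.re_le_norm _).trans (le_of_eq ?_))
    congr 3
    push_cast
    ring_nf
  set x := gapConst R * ((p ^ 2) ^ (R + 1) / n) with hx
  have hx0 : 0 ≤ x := by positivity
  have hx1 : x ≤ 1 := by
    have e3 : (p ^ 2) ^ (R + 1) / n = ((h * p) ^ 2) ^ (R + 1) := by
      have := mul_fineScale_pow R hn
      rw [← hh] at this
      have hn' : (n : ℝ) ≠ 0 := by positivity
      field_simp
      symm
      calc _ = (n : ℝ) * h ^ (2 * (R + 1)) * (p ^ 2) ^ (R + 1) := by ring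
        _ = _ := by rw [this, one_mul]
    rw [hx, e3]
    exact mul_le_one₀ (gapConst_le_one R) (by positivity)
      (pow_le_one₀ (by positivity) (pow_le_one₀ hhp hp1))
  have h5 : Real.exp (gapConst R / 2 * (p ^ 2) ^ (R + 1)) ≤
      ‖expQuot R (-((h : ℂ) * (p * nearDir R q)) ^ 2)‖ ^ n := by
    refine le_trans (le_of_eq ?_) (pow_le_pow_left₀ (Real.exp_pos _).le
      ((exp_half_le_one_add hx0 hx1).trans e2) n)
    rw [← Real.exp_nat_mul, hx]
    congr 1
    have hn' : (n : ℝ) ≠ 0 := by positivity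
    field_simp
  rw [weight, mul_inv, norm_mul, ← Complex.exp_neg, norm_inv, norm_pow]
  have e4 : -((timeRate R n τ : ℂ) * (p * nearDir R q) ^ 2) =
      ((-timeRate R n τ : ℝ) : ℂ) * (p * nearDir R q) ^ 2 := by push_cast; ring
  have e5 : ‖(p : ℂ) * nearDir R q‖ ^ 2 = p ^ 2 := by
    rw [norm_mul, norm_nearDir, mul_one, Complex.norm_real, Real.norm_eq_abs, sq_abs]
  calc _ ≤ Real.exp ((|4 * τ| + 1) * ‖(p : ℂ) * nearDir R q‖ ^ 2) *
        (Real.exp (gapConst R / 2 * (p ^ 2) ^ (R + 1)))⁻¹ := by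
        refine mul_le_mul ?_ ?_ (by positivity) (Real.exp_pos _).le
        · rw [e4]; exact norm_exp_rate_le (by rwa [abs_neg]) _
        · gcongr
    _ ≤ _ := by
        rw [← Real.exp_neg, ← Real.exp_add, ← Real.exp_add, e5]
        refine Real.exp_le_exp.2 ?_
        have h6 := hC (p ^ 2) (sq_nonneg p)
        have h7 : K * p ^ 2 ≤ |K| * p ^ 2 :=
          mul_le_mul_of_nonneg_right (le_abs_self K) (sq_nonneg p)
        rw [hK'] at h6
        linarith

theorem norm_weight_inv_far_le {R n : ℕ} {τ K B g : ℝ} (hK : |timeRate R n τ| ≤ K) (hn : n ≠ 0)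
    (hg : 0 < g) {κ : ℂ} (hB : ‖κ‖ ≤ B) (hκ : 1 + g ≤ ‖expQuot R (-κ ^ 2)‖) :
    ‖(weight R n τ (κ / fineScale R n))⁻¹‖ ≤
      Real.exp (K * B ^ 2 / fineScale R n ^ 2) * ((1 + g) ^ n)⁻¹ := by
  have hh := fineScale_pos R hn
  have hh' : (fineScale R n : ℂ) ≠ 0 := by exact_mod_cast hh.ne'
  rw [weight, mul_inv, norm_mul, ← Complex.exp_neg, norm_inv, norm_pow, mul_div_cancel₀ _ hh']
  have e4 : -((timeRate R n τ : ℂ) * (κ / fineScale R n) ^ 2) =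
      ((-timeRate R n τ : ℝ) : ℂ) * (κ / fineScale R n) ^ 2 := by push_cast; ring
  refine mul_le_mul ?_ ?_ (by positivity) (Real.exp_pos _).le
  · rw [e4]
    refine (norm_exp_rate_le (K := K) (by rwa [abs_neg]) _).trans (Real.exp_le_exp.2 ?_)
    have hK0 : 0 ≤ K := (abs_nonneg _).trans hK
    rw [norm_div, Complex.norm_real, Real.norm_of_nonneg hh.le, div_pow, mul_div_assoc]
    gcongr
  · gcongr

/-- Here `h^{-2} = n^{1/(R+1)} ≤ n^{1/2}` because `R ≥ 1`, so the geometric decay wins. -/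
theorem tendsto_exp_mul_inv_pow {R : ℕ} (hR : 1 ≤ R) (K : ℝ) {g : ℝ} (hg : 0 < g) :
    Tendsto (fun n => Real.exp (K / fineScale R n ^ 2) * ((1 + g) ^ n)⁻¹) atTop (𝓝 0) := by
  have hl : 0 < Real.log (1 + g) := Real.log_pos (by linarith)
  have h1 : Tendsto (fun n : ℕ => Real.sqrt n) atTop atTop :=
    Real.tendsto_sqrt_atTop.comp tendsto_natCast_atTop_atTop
  have h2 : Tendsto (fun n : ℕ => Real.sqrt n * (Real.log (1 + g) * Real.sqrt n - |K|)) atTop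
      atTop :=
    h1.atTop_mul_atTop₀ (tendsto_atTop_add_const_right _ _ (h1.const_mul_atTop hl))
  have h3 := Real.tendsto_exp_neg_atTop_nhds_zero.comp h2
  refine squeeze_zero' (Eventually.of_forall fun n => by positivity) ?_ h3
  filter_upwards [eventually_ne_atTop 0] with n hn
  have hn1 : (1 : ℝ) ≤ n := by exact_mod_cast Nat.one_le_iff_ne_zero.2 hn
  have e1 : (fineScale R n ^ 2)⁻¹ ≤ Real.sqrt n := by
    rw [fineScale, ← Real.rpow_natCast, ← Real.rpow_mul (by positivity), ← Real.rpow_neg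
      (by positivity), Real.sqrt_eq_rpow]
    refine Real.rpow_le_rpow_of_exponent_le hn1 ?_
    have hR' : (1 : ℝ) ≤ R := by exact_mod_cast hR
    push_cast
    rw [neg_mul, neg_neg, div_mul_eq_mul_div, div_le_div_iff₀ (by positivity) (by positivity)]
    linarith
  have e2 : ((1 + g) ^ n)⁻¹ = Real.exp (-(n * Real.log (1 + g))) := by
    rw [Real.exp_neg, Real.exp_nat_mul, Real.exp_log (by linarith)]
  rw [e2, ← Real.exp_add]
  refine Real.exp_le_exp.2 ?_
  have e3 : K / fineScale R n ^ 2 ≤ |K| * Real.sqrt n := by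
    rw [div_eq_mul_inv]
    exact mul_le_mul (le_abs_self K) e1 (by positivity) (abs_nonneg K)
  have e4 : Real.sqrt n * Real.sqrt n = n := Real.mul_self_sqrt (by positivity)
  linear_combination e3 + Real.log (1 + g) * e4

/-! ### Dominated families of Laplace integrals -/

section Dominated

variable {Ω : Type*} [MeasurableSpace Ω] {μ : MeasureTheory.Measure Ω}

/-- A sequence of Laplace integrals whose integrands have common integrable bounds. -/
structure LaplaceDom (μ : MeasureTheory.Measure Ω) (a b Φ : ℕ → Ω → ℂ) : Prop where
  meas_fst : ∀ n, MeasureTheory.AEStronglyMeasurable (a n) μ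
  meas_snd : ∀ n, MeasureTheory.AEStronglyMeasurable (b n) μ
  meas : ∀ n, MeasureTheory.AEStronglyMeasurable (Φ n) μ
  dom : ∃ g : ℝ → Ω → ℝ, (∀ M, MeasureTheory.Integrable (g M) μ) ∧ ∀ᶠ n in atTop, ∀ M,
    ∀ᵐ ξ ∂μ, Real.exp (M * (‖a n ξ‖ + ‖b n ξ‖)) * ‖Φ n ξ‖ ≤ g M ξ

variable {a b Φ : ℕ → Ω → ℂ} {a₀ b₀ Φ₀ : Ω → ℂ}

theorem integrable_laplace_of_le {a b Φ : Ω → ℂ} {g : Ω → ℝ}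
    (ha : MeasureTheory.AEStronglyMeasurable a μ) (hb : MeasureTheory.AEStronglyMeasurable b μ)
    (hΦ : MeasureTheory.AEStronglyMeasurable Φ μ) (hg : MeasureTheory.Integrable g μ)
    (z : ℂ × ℂ) (h : ∀ᵐ ξ ∂μ, Real.exp (‖z‖ * (‖a ξ‖ + ‖b ξ‖)) * ‖Φ ξ‖ ≤ g ξ) :
    MeasureTheory.Integrable (fun ξ => Complex.exp (a ξ * z.1 + b ξ * z.2) * Φ ξ) μ := by
  refine hg.mono' ((Complex.continuous_exp.comp_aestronglyMeasurable
    ((ha.mul_const _).add (hb.mul_const _))).mul hΦ) ?_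
  filter_upwards [h] with ξ hξ
  rw [norm_mul]
  exact (mul_le_mul_of_nonneg_right (norm_cexp_le _ _ _ le_rfl) (norm_nonneg _)).trans hξ

theorem LaplaceDom.eventually_integrable (h : LaplaceDom μ a b Φ) :
    ∀ᶠ n in atTop, ∀ z : ℂ × ℂ,
      MeasureTheory.Integrable (fun ξ => Complex.exp (a n ξ * z.1 + b n ξ * z.2) * Φ n ξ) μ := by
  obtain ⟨g, hg, hd⟩ := h.dom
  filter_upwards [hd] with n hn z
  exact integrable_laplace_of_le (h.meas_fst n) (h.meas_snd n) (h.meas n) (hg _) z (hn _)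

theorem LaplaceDom.limit_le (h : LaplaceDom μ a b Φ)
    (ha : ∀ᵐ ξ ∂μ, Tendsto (fun n => a n ξ) atTop (𝓝 (a₀ ξ)))
    (hb : ∀ᵐ ξ ∂μ, Tendsto (fun n => b n ξ) atTop (𝓝 (b₀ ξ)))
    (hΦ : ∀ᵐ ξ ∂μ, Tendsto (fun n => Φ n ξ) atTop (𝓝 (Φ₀ ξ))) :
    ∃ g : ℝ → Ω → ℝ, (∀ M, MeasureTheory.Integrable (g M) μ) ∧ ∀ M,
      ∀ᵐ ξ ∂μ, Real.exp (M * (‖a₀ ξ‖ + ‖b₀ ξ‖)) * ‖Φ₀ ξ‖ ≤ g M ξ := by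
  obtain ⟨g, hg, hd⟩ := h.dom
  obtain ⟨n₀, hn₀⟩ := eventually_atTop.1 hd
  refine ⟨g, hg, fun M => ?_⟩
  have h1 : ∀ᵐ ξ ∂μ, ∀ n, n₀ ≤ n → Real.exp (M * (‖a n ξ‖ + ‖b n ξ‖)) * ‖Φ n ξ‖ ≤ g M ξ := by
    rw [MeasureTheory.ae_all_iff]
    intro n
    by_cases hn : n₀ ≤ n
    · filter_upwards [hn₀ n hn M] with ξ hξ _ using hξ
    · exact MeasureTheory.ae_of_all _ fun ξ hn' => absurd hn' hn
  filter_upwards [h1, ha, hb, hΦ] with ξ h1 h2 h3 h4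
  have h5 : Tendsto (fun n => Real.exp (M * (‖a n ξ‖ + ‖b n ξ‖)) * ‖Φ n ξ‖) atTop
      (𝓝 (Real.exp (M * (‖a₀ ξ‖ + ‖b₀ ξ‖)) * ‖Φ₀ ξ‖)) :=
    (((h2.norm.add h3.norm).const_mul M).rexp).mul h4.norm
  exact le_of_tendsto h5 (eventually_atTop.2 ⟨n₀, h1⟩)

theorem LaplaceDom.integrable_limit (h : LaplaceDom μ a b Φ)
    (ha : ∀ᵐ ξ ∂μ, Tendsto (fun n => a n ξ) atTop (𝓝 (a₀ ξ)))
    (hb : ∀ᵐ ξ ∂μ, Tendsto (fun n => b n ξ) atTop (𝓝 (b₀ ξ)))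
    (hΦ : ∀ᵐ ξ ∂μ, Tendsto (fun n => Φ n ξ) atTop (𝓝 (Φ₀ ξ))) (z : ℂ × ℂ) :
    MeasureTheory.Integrable (fun ξ => Complex.exp (a₀ ξ * z.1 + b₀ ξ * z.2) * Φ₀ ξ) μ := by
  obtain ⟨g, hg, hd⟩ := h.limit_le ha hb hΦ
  exact integrable_laplace_of_le (aestronglyMeasurable_of_tendsto_ae _ h.meas_fst ha)
    (aestronglyMeasurable_of_tendsto_ae _ h.meas_snd hb)
    (aestronglyMeasurable_of_tendsto_ae _ h.meas hΦ) (hg _) z (hd _)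

theorem LaplaceDom.entireConv (h : LaplaceDom μ a b Φ)
    (ha : ∀ᵐ ξ ∂μ, Tendsto (fun n => a n ξ) atTop (𝓝 (a₀ ξ)))
    (hb : ∀ᵐ ξ ∂μ, Tendsto (fun n => b n ξ) atTop (𝓝 (b₀ ξ)))
    (hΦ : ∀ᵐ ξ ∂μ, Tendsto (fun n => Φ n ξ) atTop (𝓝 (Φ₀ ξ))) :
    EntireConv (fun n => laplace μ (a n) (b n) (Φ n)) (laplace μ a₀ b₀ Φ₀) := by
  obtain ⟨g, hg, hd⟩ := h.dom
  have ma := aestronglyMeasurable_of_tendsto_ae _ h.meas_fst ha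
  have mb := aestronglyMeasurable_of_tendsto_ae _ h.meas_snd hb
  have mΦ := aestronglyMeasurable_of_tendsto_ae _ h.meas hΦ
  refine entireConv_laplace h.meas_fst h.meas_snd (Eventually.of_forall h.meas) ?_ hg hd ?_
  · obtain ⟨g', hg', hd'⟩ := h.limit_le ha hb hΦ
    refine contDiff_laplace ma mb mΦ fun M => (hg' M).mono' ?_ ?_
    · exact (Real.continuous_exp.comp_aestronglyMeasurable
        ((ma.norm.add mb.norm).const_mul M)).mul mΦ.norm
    · filter_upwards [hd' M] with ξ hξ
      rwa [Real.norm_of_nonneg (by positivity)]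
  · intro z₀
    filter_upwards [ha, hb, hΦ] with ξ h1 h2 h3
    have e1 : Tendsto (fun p : ℕ × (ℂ × ℂ) => p.2.1) (atTop ×ˢ 𝓝 z₀) (𝓝 z₀.1) :=
      (continuous_fst.tendsto z₀).comp tendsto_snd
    have e2 : Tendsto (fun p : ℕ × (ℂ × ℂ) => p.2.2) (atTop ×ˢ 𝓝 z₀) (𝓝 z₀.2) :=
      (continuous_snd.tendsto z₀).comp tendsto_snd
    exact ((((h1.comp tendsto_fst).mul e1).add ((h2.comp tendsto_fst).mul e2)).cexp).mul
      (h3.comp tendsto_fst)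

/-- Unlike in the preceding result, the exponents need not converge: away from the origin they grow
like `1 / h`, and only the product with the density tends to `0`. -/
theorem LaplaceDom.entireConv_zero (h : LaplaceDom μ a b Φ)
    (h0 : ∀ M, ∀ᵐ ξ ∂μ, Tendsto (fun n => Real.exp (M * (‖a n ξ‖ + ‖b n ξ‖)) * ‖Φ n ξ‖) atTop
      (𝓝 0)) :
    EntireConv (fun n => laplace μ (a n) (b n) (Φ n)) (fun _ => 0) := by
  obtain ⟨g, hg, hd⟩ := h.dom
  have e : (fun _ : ℂ × ℂ => (0 : ℂ)) = laplace μ 0 0 0 := by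
    funext z; simp [laplace]
  rw [e]
  refine entireConv_laplace h.meas_fst h.meas_snd (Eventually.of_forall h.meas) ?_ hg hd ?_
  · rw [← e]; exact contDiff_const
  · intro z₀
    filter_upwards [h0 (‖z₀‖ + 1)] with ξ h1
    have hz : ∀ᶠ z in 𝓝 z₀, ‖z‖ ≤ ‖z₀‖ + 1 := by
      have := (continuous_norm.tendsto z₀).eventually (eventually_lt_nhds (lt_add_one ‖z₀‖))
      filter_upwards [this] with z hz using hz.le
    simp only [Pi.zero_apply, mul_zero]
    refine squeeze_zero_norm' ?_ (h1.comp tendsto_fst)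
    filter_upwards [hz.prod_inr atTop] with p hp
    rw [norm_mul]
    exact mul_le_mul_of_nonneg_right (norm_cexp_le _ _ _ hp) (norm_nonneg _)

end Dominated

/-! ### The part of the kernel near the origin -/

/-- A bound with an integrable singularity at the origin. -/
def envelope (v : ℝ) : ℝ := |v| ^ (-(1 / 2) : ℝ) * Real.exp (-v ^ 2)

theorem integrable_envelope : MeasureTheory.Integrable envelope := by
  have h1 : MeasureTheory.IntegrableOn envelope (Ioi 0) := by
    refine (integrableOn_rpow_mul_exp_neg_mul_sq one_pos
      (by norm_num : (-1 : ℝ) < -(1 / 2))).congr_fun (fun v hv => ?_) measurableSet_Ioi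
    simp only [envelope, abs_of_pos (mem_Ioi.1 hv), neg_mul, one_mul]
  have h2 : MeasureTheory.IntegrableOn envelope (Iic 0) := by
    rw [← MeasureTheory.Measure.map_neg_eq_self (MeasureTheory.volume : MeasureTheory.Measure ℝ)]
    let m : MeasurableEmbedding fun x : ℝ => -x := (Homeomorph.neg ℝ).measurableEmbedding
    rw [m.integrableOn_map_iff]
    have e : envelope ∘ Neg.neg = envelope := by
      funext v; simp [envelope]
    rw [neg_preimage, neg_Iic, neg_zero, integrableOn_Ici_iff_integrableOn_Ioi]
    exact e.symm ▸ h1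
  rw [← MeasureTheory.integrableOn_univ, ← Iic_union_Ioi (a := (0 : ℝ))]
  exact h2.union h1

/-- The distance of `p w` from the imaginary axis is at least `η p`, and that of `i v` from the line
through `w` at least `η |v|`. Their geometric mean splits the singularity into two integrable ones.
-/
theorem inv_norm_sub_le {η p v : ℝ} {w : ℂ} (hw : ‖w‖ = 1) (hη : 0 < η) (hre : η ≤ |w.re|)
    (hp : 0 < p) (hv : v ≠ 0) :
    ‖(v * Complex.I - p * w)⁻¹‖ ≤ η⁻¹ * (|p| ^ (-(1 / 2) : ℝ) * |v| ^ (-(1 / 2) : ℝ)) := by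
  have hv' : 0 < |v| := abs_pos.2 hv
  have hw2 : w.re ^ 2 + w.im ^ 2 = 1 := by
    have := Complex.sq_norm w
    rw [hw, Complex.normSq_apply] at this
    linarith
  have hre2 : η ^ 2 ≤ w.re ^ 2 := by
    rw [← sq_abs w.re]
    exact pow_le_pow_left₀ hη.le hre 2
  have e1 : ‖(v : ℂ) * Complex.I - p * w‖ ^ 2 = (p * w.re) ^ 2 + (v - p * w.im) ^ 2 := by
    rw [Complex.sq_norm, Complex.normSq_apply]
    simp
    ring
  have h1 : (η * p) ^ 2 ≤ ‖(v : ℂ) * Complex.I - p * w‖ ^ 2 := by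
    rw [e1, mul_pow, mul_pow]
    nlinarith [sq_nonneg (v - p * w.im), sq_nonneg p]
  have h2 : (η * |v|) ^ 2 ≤ ‖(v : ℂ) * Complex.I - p * w‖ ^ 2 := by
    have : (p * w.re) ^ 2 + (v - p * w.im) ^ 2 = (p - v * w.im) ^ 2 + v ^ 2 * w.re ^ 2 := by
      linear_combination (p ^ 2 - v ^ 2) * hw2
    rw [e1, mul_pow, sq_abs, this]
    nlinarith [sq_nonneg (p - v * w.im), sq_nonneg v]
  have h3 := abs_le_of_sq_le_sq' h1 (norm_nonneg _)
  have h4 := abs_le_of_sq_le_sq' h2 (norm_nonneg _)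
  have h5 : η * Real.sqrt (|p| * |v|) ≤ ‖(v : ℂ) * Complex.I - p * w‖ := by
    refine (abs_le_of_sq_le_sq' ?_ (norm_nonneg _)).2
    rw [mul_pow, Real.sq_sqrt (by positivity), abs_of_pos hp]
    calc η ^ 2 * (p * |v|) = (η * p) * (η * |v|) := by ring
      _ ≤ ‖(v : ℂ) * Complex.I - p * w‖ * ‖(v : ℂ) * Complex.I - p * w‖ :=
        mul_le_mul h3.2 h4.2 (by positivity) (norm_nonneg _)
      _ = _ := by ring
  rw [norm_inv, ← Real.mul_rpow (abs_nonneg _) (abs_nonneg _), Real.rpow_neg (by positivity),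
    ← Real.sqrt_eq_rpow, ← mul_inv]
  have hpp : 0 < |p| := abs_pos.2 hp.ne'
  exact inv_anti₀ (by positivity) h5

/-- The measure on the parameters of a ray and of the imaginary axis. -/
def rayMeasure : MeasureTheory.Measure (ℝ × ℝ) :=
  (MeasureTheory.volume.restrict (Ioi 0)).prod MeasureTheory.volume

theorem ae_rayMeasure : ∀ᵐ ξ ∂rayMeasure, 0 < ξ.1 ∧ ξ.2 ≠ 0 := by
  have h1 : ∀ᵐ p : ℝ ∂(MeasureTheory.volume.restrict (Ioi 0)), 0 < p :=
    MeasureTheory.ae_restrict_mem measurableSet_Ioi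
  have h2 : ∀ᵐ v : ℝ, v ≠ 0 := MeasureTheory.Measure.ae_ne MeasureTheory.volume 0
  have h3 := (MeasureTheory.Measure.quasiMeasurePreserving_fst
    (ν := (MeasureTheory.volume : MeasureTheory.Measure ℝ))).ae h1
  have h4 := (MeasureTheory.Measure.quasiMeasurePreserving_snd
    (μ := (MeasureTheory.volume : MeasureTheory.Measure ℝ).restrict (Ioi 0))).ae h2
  exact h3.and h4

/-- The density of the Laplace integral over a ray. -/
def nearDensity (R n : ℕ) (q : Bool × Bool) (τi τj : ℝ) (ξ : ℝ × ℝ) : ℂ :=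
  (if fineScale R n * ξ.1 ≤ 1 then 1 else 0) *
    (weight R n τj (ξ.2 * Complex.I) * (weight R n τi (ξ.1 * nearDir R q))⁻¹ * nearDir R q *
      (ξ.2 * Complex.I - ξ.1 * nearDir R q)⁻¹)

/-- The density of the limiting Laplace integral over a ray. -/
def limitDensity (R : ℕ) (q : Bool × Bool) (τi τj : ℝ) (ξ : ℝ × ℝ) : ℂ :=
  limitWeight R τj (ξ.2 * Complex.I) * (limitWeight R τi (ξ.1 * nearDir R q))⁻¹ * nearDir R q *
      (ξ.2 * Complex.I - ξ.1 * nearDir R q)⁻¹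

theorem sin_half_rayAngle_pos {R : ℕ} (hR : 1 ≤ R) : 0 < Real.sin (rayAngle R / 2) :=
  Real.sin_pos_of_pos_of_lt_pi (by linarith [rayAngle_pos R])
    (by linarith [rayAngle_le hR, Real.pi_pos])

theorem abs_re_nearDir {R : ℕ} (hR : 1 ≤ R) (q : Bool × Bool) :
    |(nearDir R q).re| = Real.sin (rayAngle R / 2) := by
  have h := abs_re_axis_turn q 1 (rayAngle R / 2)
  rw [abs_one, one_mul, abs_of_pos (sin_half_rayAngle_pos hR), Complex.ofReal_one, mul_one] at h
  exact h

theorem linear_sub_sq_le (A p : ℝ) : A * p - 2 * p ^ 2 ≤ A ^ 2 / 4 - p ^ 2 := by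
  nlinarith [sq_nonneg (A - 2 * p)]

/-- Rate `2` is taken in both Gaussian bounds: one unit absorbs the linear exponents by completing
the square, the other stays in the envelopes. The `5` bounds the slopes, which tend to `4`. -/
theorem laplaceDom_near {R : ℕ} (hR : 1 ≤ R) (q : Bool × Bool) (τi τj : ℝ) :
    LaplaceDom rayMeasure (fun n ξ => timeSlope R n τi * (ξ.1 * nearDir R q))
      (fun n ξ => -(timeSlope R n τj * (ξ.2 * Complex.I))) (nearDensity R · q τi τj) where
  meas_fst n := by
    have : Continuous fun ξ : ℝ × ℝ => (timeSlope R n τi : ℂ) * (ξ.1 * nearDir R q) := by fun_prop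
    exact this.aestronglyMeasurable
  meas_snd n := by
    have : Continuous fun ξ : ℝ × ℝ => -((timeSlope R n τj : ℂ) * (ξ.2 * Complex.I)) := by
      fun_prop
    exact this.aestronglyMeasurable
  meas n := by
    have h1 : Measurable (weight R n τj) := (continuous_weight R n τj).measurable
    have h2 : Measurable (weight R n τi) := (continuous_weight R n τi).measurable
    have h3 : Measurable fun ξ : ℝ × ℝ =>
        (if fineScale R n * ξ.1 ≤ 1 then 1 else 0 : ℂ) :=
      Measurable.ite (measurableSet_le (by fun_prop) (by fun_prop)) measurable_const
        measurable_const
    refine Measurable.aestronglyMeasurable (h3.mul ?_)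
    fun_prop
  dom := by
    set η := Real.sin (rayAngle R / 2) with hη
    have hη0 : 0 < η := sin_half_rayAngle_pos hR
    obtain ⟨C₁, hC₁, h1⟩ := exists_norm_weight_axis_le hR τj 2
    obtain ⟨C₂, hC₂, h2⟩ := exists_norm_weight_ray_inv_le hR τi 2
    refine ⟨fun M ξ => (C₁ * C₂ * η⁻¹ * Real.exp ((5 * |M|) ^ 2 / 4) ^ 2) *
      (envelope ξ.1 * envelope ξ.2), fun M => ?_, ?_⟩
    · exact (integrable_envelope.restrict.mul_prod integrable_envelope).const_mul _
    · filter_upwards [h1, h2, eventually_abs_timeSlope_le hR τi,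
        eventually_abs_timeSlope_le hR τj] with n h1 h2 h3 h4 M
      filter_upwards [ae_rayMeasure] with ξ hξ
      obtain ⟨p, v⟩ := ξ
      obtain ⟨hp, hv⟩ : 0 < p ∧ v ≠ 0 := hξ
      have hnn : 0 ≤ C₁ * C₂ * η⁻¹ * Real.exp ((5 * |M|) ^ 2 / 4) ^ 2 *
          (envelope p * envelope v) := by
        unfold envelope; positivity
      by_cases hc : fineScale R n * p ≤ 1
      swap
      · simpa [nearDensity, hc] using hnn
      have e1 : ‖(timeSlope R n τi : ℂ) * (p * nearDir R q)‖ ≤ 5 * p := by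
        rw [norm_mul, norm_mul, norm_nearDir, mul_one, Complex.norm_real, Complex.norm_real,
          Real.norm_eq_abs, Real.norm_of_nonneg hp.le]
        gcongr
      have e2 : ‖-((timeSlope R n τj : ℂ) * (v * Complex.I))‖ ≤ 5 * |v| := by
        rw [norm_neg, norm_mul, norm_mul, Complex.norm_I, mul_one, Complex.norm_real,
          Complex.norm_real, Real.norm_eq_abs, Real.norm_eq_abs]
        gcongr
      have e3 : Real.exp (M * (‖(timeSlope R n τi : ℂ) * (p * nearDir R q)‖ +
          ‖-((timeSlope R n τj : ℂ) * (v * Complex.I))‖)) ≤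
          Real.exp (|M| * (5 * p + 5 * |v|)) := by
        refine Real.exp_le_exp.2 ?_
        refine (mul_le_mul_of_nonneg_right (le_abs_self M) (by positivity)).trans ?_
        gcongr
      have e4 := inv_norm_sub_le (norm_nearDir R q) hη0 (abs_re_nearDir hR q).ge hp hv
      have e5 : ‖nearDensity R n q τi τj (p, v)‖ ≤
          (C₁ * Real.exp (-2 * v ^ 2)) * (C₂ * Real.exp (-2 * p ^ 2)) * 1 *
            (η⁻¹ * (|p| ^ (-(1 / 2) : ℝ) * |v| ^ (-(1 / 2) : ℝ))) := by
        simp only [nearDensity, hc, if_true, one_mul]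
        rw [norm_mul, norm_mul, norm_mul, norm_nearDir]
        have h5 := h1 v
        have h6 := h2 q p hp.le hc
        gcongr
      have e6 : Real.exp (|M| * (5 * p + 5 * |v|)) * Real.exp (-2 * v ^ 2) *
          Real.exp (-2 * p ^ 2) ≤
          Real.exp ((5 * |M|) ^ 2 / 4) ^ 2 * (Real.exp (-p ^ 2) * Real.exp (-v ^ 2)) := by
        rw [← Real.exp_nat_mul, ← Real.exp_add, ← Real.exp_add, ← Real.exp_add, ← Real.exp_add]
        refine Real.exp_le_exp.2 ?_
        have h5 := linear_sub_sq_le (5 * |M|) p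
        have h6 := linear_sub_sq_le (5 * |M|) |v|
        rw [sq_abs] at h6
        push_cast
        linarith
      calc _ ≤ Real.exp (|M| * (5 * p + 5 * |v|)) *
            ((C₁ * Real.exp (-2 * v ^ 2)) * (C₂ * Real.exp (-2 * p ^ 2)) * 1 *
            (η⁻¹ * (|p| ^ (-(1 / 2) : ℝ) * |v| ^ (-(1 / 2) : ℝ)))) :=
            mul_le_mul e3 e5 (norm_nonneg _) (Real.exp_pos _).le
        _ = (Real.exp (|M| * (5 * p + 5 * |v|)) * Real.exp (-2 * v ^ 2) *
              Real.exp (-2 * p ^ 2)) *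
            (C₁ * C₂ * η⁻¹ * (|p| ^ (-(1 / 2) : ℝ) * |v| ^ (-(1 / 2) : ℝ))) := by ring
        _ ≤ (Real.exp ((5 * |M|) ^ 2 / 4) ^ 2 * (Real.exp (-p ^ 2) * Real.exp (-v ^ 2))) *
            (C₁ * C₂ * η⁻¹ * (|p| ^ (-(1 / 2) : ℝ) * |v| ^ (-(1 / 2) : ℝ))) := by gcongr
        _ = _ := by simp only [envelope]; ring

theorem tendsto_nearDensity {R : ℕ} (hR : 1 ≤ R) (q : Bool × Bool) (τi τj : ℝ) (ξ : ℝ × ℝ) :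
    Tendsto (fun n => nearDensity R n q τi τj ξ) atTop (𝓝 (limitDensity R q τi τj ξ)) := by
  have h1 : ∀ᶠ n in atTop, fineScale R n * ξ.1 ≤ 1 := by
    have := (tendsto_fineScale R).mul_const ξ.1
    rw [zero_mul] at this
    filter_upwards [this.eventually (eventually_lt_nhds one_pos)] with n hn using hn.le
  have h2 := ((((tendsto_weight hR τj (ξ.2 * Complex.I)).mul
    ((tendsto_weight hR τi (ξ.1 * nearDir R q)).inv₀ (limitWeight_ne_zero _ _ _))).mul_const
      (nearDir R q)).mul_const (ξ.2 * Complex.I - ξ.1 * nearDir R q)⁻¹)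
  refine h2.congr' ?_
  filter_upwards [h1] with n hn
  simp [nearDensity, hn]

theorem tendsto_slope_mul {R : ℕ} (hR : 1 ≤ R) (τ : ℝ) (s : ℂ) :
    Tendsto (fun n => (timeSlope R n τ : ℂ) * s) atTop (𝓝 (4 * s)) := by
  have := ((Complex.continuous_ofReal.tendsto _).comp (tendsto_timeSlope hR τ)).mul_const s
  simpa using this

theorem entireConv_near {R : ℕ} (hR : 1 ≤ R) (q : Bool × Bool) (τi τj : ℝ) :
    EntireConv (fun n => laplace rayMeasure (fun ξ => timeSlope R n τi * (ξ.1 * nearDir R q))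
      (fun ξ => -(timeSlope R n τj * (ξ.2 * Complex.I))) (nearDensity R n q τi τj))
      (laplace rayMeasure (fun ξ => 4 * (ξ.1 * nearDir R q)) (fun ξ => -(4 * (ξ.2 * Complex.I)))
        (limitDensity R q τi τj)) :=
  (laplaceDom_near hR q τi τj).entireConv
    (MeasureTheory.ae_of_all _ fun _ => tendsto_slope_mul hR τi _)
    (MeasureTheory.ae_of_all _ fun _ => (tendsto_slope_mul hR τj _).neg)
    (MeasureTheory.ae_of_all _ fun _ => tendsto_nearDensity hR q τi τj _)

theorem integrable_limitDensity {R : ℕ} (hR : 1 ≤ R) (q : Bool × Bool) (τi τj : ℝ) (z : ℂ × ℂ) :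
    MeasureTheory.Integrable (fun ξ => Complex.exp (4 * (ξ.1 * nearDir R q) * z.1 +
      -(4 * (ξ.2 * Complex.I)) * z.2) * limitDensity R q τi τj ξ) rayMeasure :=
  (laplaceDom_near hR q τi τj).integrable_limit
    (MeasureTheory.ae_of_all _ fun _ => tendsto_slope_mul hR τi _)
    (MeasureTheory.ae_of_all _ fun _ => (tendsto_slope_mul hR τj _).neg)
    (MeasureTheory.ae_of_all _ fun _ => tendsto_nearDensity hR q τi τj _) z

/-! ### The part of the kernel away from the origin -/

/-- A path in the region where the weight is large. -/
structure FarPath (R : ℕ) (γ γ' : ℝ → ℂ) (a b : ℝ) : Prop where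
  le : a ≤ b
  cont : ContinuousOn γ (Icc a b)
  cont' : ContinuousOn γ' (Icc a b)
  re_pos : ∃ η : ℝ, 0 < η ∧ ∀ θ ∈ Icc a b, η ≤ |(γ θ).re|
  large : ∀ θ ∈ Icc a b, 1 + gapConst R ≤ ‖expQuot R (-γ θ ^ 2)‖

/-- The measure on the parameters of a path and of the imaginary axis. -/
def pathMeasure (a b : ℝ) : MeasureTheory.Measure (ℝ × ℝ) :=
  (MeasureTheory.volume.restrict (Ioc a b)).prod MeasureTheory.volume

theorem ae_pathMeasure (a b : ℝ) : ∀ᵐ ξ ∂pathMeasure a b, ξ.1 ∈ Icc a b := by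
  have h1 : ∀ᵐ p : ℝ ∂(MeasureTheory.volume.restrict (Ioc a b)), p ∈ Icc a b := by
    filter_upwards [MeasureTheory.ae_restrict_mem measurableSet_Ioc] with p hp
    exact Ioc_subset_Icc_self hp
  exact (MeasureTheory.Measure.quasiMeasurePreserving_fst
    (ν := (MeasureTheory.volume : MeasureTheory.Measure ℝ))).ae h1

/-- The density of the Laplace integral over a path away from the origin. -/
def farDensity (R n : ℕ) (γ γ' : ℝ → ℂ) (τi τj : ℝ) (ξ : ℝ × ℝ) : ℂ :=
  weight R n τj (ξ.2 * Complex.I) * (weight R n τi (γ ξ.1 / fineScale R n))⁻¹ * γ' ξ.1 *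
      (fineScale R n * (ξ.2 * Complex.I) - γ ξ.1)⁻¹

variable {R : ℕ} {γ γ' : ℝ → ℂ} {a b : ℝ}

/-- The quadratic and linear exponents at `γ / h` cost at most the exponential of a multiple of
`h^{-2}`, while the inverse weight gains `(1 + gapConst R)^{-n}`. The pole is harmless since `γ`
keeps its distance from the imaginary axis. -/
theorem FarPath.exists_bound (hR : 1 ≤ R) (h : FarPath R γ γ' a b) (τi τj : ℝ) :
    ∃ C B : ℝ, 0 ≤ C ∧ ∀ᶠ n in atTop, ∀ M : ℝ, ∀ ξ : ℝ × ℝ, ξ.1 ∈ Icc a b →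
      Real.exp (M * (‖(timeSlope R n τi : ℂ) * (γ ξ.1 / fineScale R n)‖ +
        ‖-((timeSlope R n τj : ℂ) * (ξ.2 * Complex.I))‖)) * ‖farDensity R n γ γ' τi τj ξ‖ ≤
      (Real.exp ((5 * |M| * B + (|4 * τi| + 1) * B ^ 2) / fineScale R n ^ 2) *
        ((1 + gapConst R) ^ n)⁻¹) * (C * Real.exp ((5 * |M|) ^ 2 / 4) * Real.exp (-1 * ξ.2 ^ 2)) := by
  obtain ⟨η, hη0, hη⟩ := h.re_pos
  obtain ⟨B, hB⟩ := isCompact_Icc.exists_bound_of_continuousOn h.cont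
  obtain ⟨B', hB'⟩ := isCompact_Icc.exists_bound_of_continuousOn h.cont'
  obtain ⟨C₁, hC₁, h1⟩ := exists_norm_weight_axis_le hR τj 2
  have hB0 : 0 ≤ B := (norm_nonneg _).trans (hB a (left_mem_Icc.2 h.le))
  have hB0' : 0 ≤ B' := (norm_nonneg _).trans (hB' a (left_mem_Icc.2 h.le))
  refine ⟨C₁ * B' * η⁻¹, B, by positivity, ?_⟩
  filter_upwards [h1, eventually_abs_timeSlope_le hR τi, eventually_abs_timeSlope_le hR τj,
    eventually_abs_timeRate_le hR τi, eventually_ne_atTop 0] with n h1 h3 h4 h5 hn M ξ hξ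
  obtain ⟨θ, v⟩ := ξ
  simp only at hξ
  have hh := fineScale_pos R hn
  have hh1 := fineScale_le_one R hn
  set f := fineScale R n with hf
  have e1 : ‖(timeSlope R n τi : ℂ) * (γ θ / f)‖ ≤ 5 * B / f ^ 2 := by
    rw [norm_mul, norm_div, Complex.norm_real, Complex.norm_real, Real.norm_eq_abs,
      Real.norm_of_nonneg hh.le, mul_div_assoc]
    -- As `h ≤ 1`, the linear growth `1 / h` is absorbed into `1 / h²`.
    have e : f ^ 2 ≤ f := by nlinarith
    have := hB θ hξ
    gcongr
  have e2 : ‖-((timeSlope R n τj : ℂ) * (v * Complex.I))‖ ≤ 5 * |v| := by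
    rw [norm_neg, norm_mul, norm_mul, Complex.norm_I, mul_one, Complex.norm_real,
      Complex.norm_real, Real.norm_eq_abs, Real.norm_eq_abs]
    gcongr
  have e3 : Real.exp (M * (‖(timeSlope R n τi : ℂ) * (γ θ / f)‖ +
      ‖-((timeSlope R n τj : ℂ) * (v * Complex.I))‖)) ≤
      Real.exp (|M| * (5 * B / f ^ 2 + 5 * |v|)) := by
    refine Real.exp_le_exp.2 ?_
    refine (mul_le_mul_of_nonneg_right (le_abs_self M) (by positivity)).trans ?_
    gcongr
  have e4 : ‖((f : ℂ) * (v * Complex.I) - γ θ)⁻¹‖ ≤ η⁻¹ := by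
    rw [norm_inv]
    refine inv_anti₀ hη0 ((hη θ hξ).trans ?_)
    have := Complex.abs_re_le_norm ((f : ℂ) * (v * Complex.I) - γ θ)
    simpa using this
  have e5 := norm_weight_inv_far_le h5 hn (gapConst_pos R) (hB θ hξ) (h.large θ hξ)
  have e6 : ‖farDensity R n γ γ' τi τj (θ, v)‖ ≤ (C₁ * Real.exp (-2 * v ^ 2)) *
      (Real.exp ((|4 * τi| + 1) * B ^ 2 / f ^ 2) * ((1 + gapConst R) ^ n)⁻¹) * B' * η⁻¹ := by
    simp only [farDensity]
    rw [norm_mul, norm_mul, norm_mul]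
    have h6 := h1 v
    have h7 := hB' θ hξ
    have h8 := (gapConst_pos R).le
    gcongr
  have e7 : Real.exp (|M| * (5 * B / f ^ 2 + 5 * |v|)) * Real.exp (-2 * v ^ 2) *
      Real.exp ((|4 * τi| + 1) * B ^ 2 / f ^ 2) ≤
      Real.exp ((5 * |M| * B + (|4 * τi| + 1) * B ^ 2) / f ^ 2) *
        (Real.exp ((5 * |M|) ^ 2 / 4) * Real.exp (-1 * v ^ 2)) := by
    rw [← Real.exp_add, ← Real.exp_add, ← Real.exp_add, ← Real.exp_add]
    refine Real.exp_le_exp.2 ?_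
    have h6 := linear_sub_sq_le (5 * |M|) |v|
    rw [sq_abs] at h6
    have h7 : (5 * |M| * B + (|4 * τi| + 1) * B ^ 2) / f ^ 2 =
        |M| * (5 * B / f ^ 2) + (|4 * τi| + 1) * B ^ 2 / f ^ 2 := by ring
    rw [h7]
    linarith
  calc _ ≤ Real.exp (|M| * (5 * B / f ^ 2 + 5 * |v|)) * ((C₁ * Real.exp (-2 * v ^ 2)) *
      (Real.exp ((|4 * τi| + 1) * B ^ 2 / f ^ 2) * ((1 + gapConst R) ^ n)⁻¹) * B' * η⁻¹) :=
        mul_le_mul e3 e6 (norm_nonneg _) (Real.exp_pos _).le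
    _ = (Real.exp (|M| * (5 * B / f ^ 2 + 5 * |v|)) * Real.exp (-2 * v ^ 2) *
      Real.exp ((|4 * τi| + 1) * B ^ 2 / f ^ 2)) *
        (((1 + gapConst R) ^ n)⁻¹ * (C₁ * B' * η⁻¹)) := by ring
    _ ≤ _ := mul_le_mul_of_nonneg_right e7
        (by have := (gapConst_pos R).le; positivity)
    _ = _ := by ring

theorem laplaceDom_far (hR : 1 ≤ R) (h : FarPath R γ γ' a b) (τi τj : ℝ) :
    LaplaceDom (pathMeasure a b) (fun n ξ => timeSlope R n τi * (γ ξ.1 / fineScale R n))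
      (fun n ξ => -(timeSlope R n τj * (ξ.2 * Complex.I))) (farDensity R · γ γ' τi τj) := by
  have mem : ∀ {F : ℝ → ℂ}, ContinuousOn F (Icc a b) →
      MeasureTheory.AEStronglyMeasurable (fun ξ : ℝ × ℝ => F ξ.1) (pathMeasure a b) := by
    intro F hF
    exact ((hF.aestronglyMeasurable measurableSet_Icc).mono_measure
      (MeasureTheory.Measure.restrict_mono_set _ Ioc_subset_Icc_self)).comp_fst
  refine ⟨fun n => ?_, fun n => ?_, fun n => ?_, ?_⟩
  · exact mem (F := fun θ => timeSlope R n τi * (γ θ / fineScale R n))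
      (continuousOn_const.mul (h.cont.div_const _))
  · have : Continuous fun ξ : ℝ × ℝ => -((timeSlope R n τj : ℂ) * (ξ.2 * Complex.I)) := by
      fun_prop
    exact this.aestronglyMeasurable
  · have h1 : MeasureTheory.AEStronglyMeasurable
        (fun ξ : ℝ × ℝ => weight R n τj (ξ.2 * Complex.I)) (pathMeasure a b) :=
      ((continuous_weight R n τj).comp (by fun_prop)).aestronglyMeasurable
    have h2 := mem (F := fun θ => weight R n τi (γ θ / fineScale R n))
      ((continuous_weight R n τi).comp_continuousOn (h.cont.div_const _))
    have h3 : MeasureTheory.AEStronglyMeasurable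
        (fun ξ : ℝ × ℝ => (fineScale R n : ℂ) * (ξ.2 * Complex.I)) (pathMeasure a b) := by
      have : Continuous fun ξ : ℝ × ℝ => (fineScale R n : ℂ) * (ξ.2 * Complex.I) := by fun_prop
      exact this.aestronglyMeasurable
    exact ((h1.mul h2.inv₀).mul (mem h.cont')).mul (h3.sub (mem h.cont)).inv₀
  · obtain ⟨C, B, hC, hb⟩ := h.exists_bound hR τi τj
    have hS : ∀ M : ℝ, ∃ S : ℝ, ∀ n, Real.exp ((5 * |M| * B + (|4 * τi| + 1) * B ^ 2) /
        fineScale R n ^ 2) * ((1 + gapConst R) ^ n)⁻¹ ≤ S := by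
      intro M
      obtain ⟨S, hS⟩ := (tendsto_exp_mul_inv_pow hR (5 * |M| * B + (|4 * τi| + 1) * B ^ 2)
        (gapConst_pos R)).bddAbove_range
      exact ⟨S, fun n => hS ⟨n, rfl⟩⟩
    choose S hS using hS
    refine ⟨fun M ξ => (1 : ℝ) *
      (S M * (C * Real.exp ((5 * |M|) ^ 2 / 4)) * Real.exp (-1 * ξ.2 ^ 2)), fun M => ?_, ?_⟩
    · have hfin : MeasureTheory.Integrable (fun _ : ℝ => (1 : ℝ))
          (MeasureTheory.volume.restrict (Ioc a b)) := MeasureTheory.integrable_const _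
      exact hfin.mul_prod ((integrable_exp_neg_mul_sq one_pos).const_mul _)
    · filter_upwards [hb] with n hn M
      filter_upwards [ae_pathMeasure a b] with ξ hξ
      refine (hn M ξ hξ).trans ?_
      rw [one_mul, mul_assoc (S M)]
      exact mul_le_mul_of_nonneg_right (hS M n) (by positivity)

theorem entireConv_far (hR : 1 ≤ R) (h : FarPath R γ γ' a b) (τi τj : ℝ) :
    EntireConv (fun n => laplace (pathMeasure a b)
      (fun ξ => timeSlope R n τi * (γ ξ.1 / fineScale R n))
      (fun ξ => -(timeSlope R n τj * (ξ.2 * Complex.I))) (farDensity R n γ γ' τi τj))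
      (fun _ => 0) := by
  refine (laplaceDom_far hR h τi τj).entireConv_zero fun M => ?_
  obtain ⟨C, B, hC, hb⟩ := h.exists_bound hR τi τj
  filter_upwards [ae_pathMeasure a b] with ξ hξ
  have h1 := (tendsto_exp_mul_inv_pow hR (5 * |M| * B + (|4 * τi| + 1) * B ^ 2)
    (gapConst_pos R)).mul_const (C * Real.exp ((5 * |M|) ^ 2 / 4) * Real.exp (-1 * ξ.2 ^ 2))
  rw [zero_mul] at h1
  refine squeeze_zero' (Eventually.of_forall fun n => by positivity) ?_ h1
  filter_upwards [hb] with n hn using hn M ξ hξ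

theorem farPath_curve (hR : 1 ≤ R) {θ₁ : ℝ} (h0 : rayAngle R ≤ θ₁) (h1 : θ₁ < Real.pi)
    (q : Bool × Bool) : FarPath R (curvePath R q) (curveVel R q) (rayAngle R) θ₁ where
  le := h0
  cont := continuousOn_curvePath hR h1 q
  cont' := continuousOn_curveVel hR h1 q
  re_pos := by
    have hc : ContinuousOn (fun θ => |(curvePath R q θ).re|) (Icc (rayAngle R) θ₁) :=
      (Complex.continuous_re.comp_continuousOn (continuousOn_curvePath hR h1 q)).abs
    obtain ⟨θ₀, hθ₀, hmin⟩ := isCompact_Icc.exists_isMinOn ⟨_, left_mem_Icc.2 h0⟩ hc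
    refine ⟨_, ?_, fun θ hθ => hmin hθ⟩
    have hs : 0 < Real.sin (θ₀ / 2) := Real.sin_pos_of_pos_of_lt_pi
      (by linarith [rayAngle_pos R, hθ₀.1]) (by linarith [Real.pi_pos, hθ₀.2])
    simp only [curvePath]
    rw [abs_re_axis_turn]
    have := curveRadius_pos R θ₀
    positivity
  large θ hθ := by
    rw [curvePath, curveRadius, norm_expQuot_turn_exp]
    have := one_add_gapConst_le_curve hR hθ.1 (hθ.2.trans_lt h1)
    rwa [mul_div_cancel₀ θ (two_ne_zero' ℝ)]

theorem farPath_arc {θ₁ : ℝ} (h0 : rayAngle R < θ₁) (h1 : θ₁ < Real.pi)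
    (hl : ∀ θ : ℝ, θ₁ ≤ θ → θ ≤ Real.pi →
        1 + gapConst R ≤ ‖expQuot R (Complex.exp (curveLog R θ₁ + θ * Complex.I))‖)
    (q : Bool × Bool) : FarPath R (arcPath R θ₁ q) (arcVel R θ₁ q) θ₁ Real.pi where
  le := h1.le
  cont := (continuous_arcPath q).continuousOn
  cont' := (continuous_arcVel q).continuousOn
  re_pos := by
    have hc : ContinuousOn (fun θ => |(arcPath R θ₁ q θ).re|) (Icc θ₁ Real.pi) :=
      (Complex.continuous_re.comp (continuous_arcPath q)).abs.continuousOn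
    obtain ⟨θ₀, hθ₀, hmin⟩ := isCompact_Icc.exists_isMinOn ⟨_, left_mem_Icc.2 h1.le⟩ hc
    refine ⟨_, ?_, fun θ hθ => hmin hθ⟩
    have hs : 0 < Real.sin (θ₀ / 2) := Real.sin_pos_of_pos_of_lt_pi
      (by linarith [rayAngle_pos R, hθ₀.1]) (by linarith [Real.pi_pos, hθ₀.2])
    simp only [arcPath]
    rw [abs_re_axis_turn]
    have := curveRadius_pos R θ₁
    positivity
  large θ hθ := by
    rw [arcPath, curveRadius, norm_expQuot_turn_exp]
    have := hl θ hθ.1 hθ.2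
    rwa [mul_div_cancel₀ θ (two_ne_zero' ℝ)]

/-! ### The kernel as a sum of Laplace integrals -/

/-- The factor of the integrand that depends on the variable on the line. -/
def lineFactor (R n : ℕ) (τ : ℝ) (y σ : ℂ) : ℂ :=
  Complex.exp (-(timeSlope R n τ * (σ / fineScale R n)) * y) * weight R n τ (σ / fineScale R n)

/-- The factor of the integrand that depends on the variable on the circle. -/
def circleFactor (R n : ℕ) (τ : ℝ) (x κ : ℂ) : ℂ :=
  Complex.exp (timeSlope R n τ * (κ / fineScale R n) * x) *
    (weight R n τ (κ / fineScale R n))⁻¹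

theorem expTrunc_pow_eq (R n : ℕ) (σ : ℂ) :
    expTrunc R (-σ ^ 2) ^ n = expQuot R (-σ ^ 2) ^ n * Complex.exp (-(n * σ ^ 2)) := by
  rw [expQuot, mul_pow, ← Complex.exp_nat_mul, mul_assoc, ← Complex.exp_add]
  have : (n : ℂ) * -(-σ ^ 2) + -(n * σ ^ 2) = 0 := by ring
  rw [this, Complex.exp_zero, mul_one]

/-- The summand `n` is the leading part, cancelled by the Gaussian factor that separates `expTrunc`
from `expQuot`; what remains has order `h^{-2}` and survives on the local scale. -/
theorem scaledTime_ratio {R n : ℕ} {τ : ℝ} (hn : n ≠ 0)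
    (h : 1 - 2 * ((n : ℝ) ^ (-scalingExponent R) * τ) ≠ 0) :
    scaledTime R n τ / (1 - scaledTime R n τ) * n = timeRate R n τ / fineScale R n ^ 2 + n := by
  have hn' : (0 : ℝ) < n := by positivity
  have h1 := mul_fineScale_sq R hn
  have hf := fineScale_pos R hn
  have h2 : (n : ℝ) ^ (-scalingExponent R) * (n * fineScale R n ^ 2) = 1 := by
    rw [h1, ← Real.rpow_add hn', neg_add_cancel, Real.rpow_zero]
  rw [scaledTime, timeRate]
  set u := (n : ℝ) ^ (-scalingExponent R) with hu
  have e : (1 : ℝ) - (1 / 2 + u * τ) = (1 - 2 * (u * τ)) / 2 := by ring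
  rw [e]
  obtain ⟨d, hd⟩ : ∃ d, d = 1 - 2 * (u * τ) := ⟨_, rfl⟩
  rw [← hd] at h ⊢
  field_simp
  linear_combination 4 * τ * h2 - n * fineScale R n ^ 2 * hd

theorem scaledPos_ratio {R n : ℕ} {τ : ℝ} (x : ℝ) (hn : n ≠ 0)
    (h : 1 - 2 * ((n : ℝ) ^ (-scalingExponent R) * τ) ≠ 0) :
    2 * scaledPos R n x * Real.sqrt n / (1 - scaledTime R n τ) =
      timeSlope R n τ / fineScale R n * x := by
  have h1 := sqrt_mul_fineScale R n hn
  have hf := fineScale_pos R hn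
  rw [scaledPos, scaledTime, timeSlope]
  set u := (n : ℝ) ^ (-scalingExponent R) with hu
  have e : (1 : ℝ) - (1 / 2 + u * τ) = (1 - 2 * (u * τ)) / 2 := by ring
  rw [e]
  obtain ⟨d, hd⟩ : ∃ d, d = 1 - 2 * (u * τ) := ⟨_, rfl⟩
  rw [← hd] at h ⊢
  field_simp
  linear_combination 4 * x * h1

section Identity

variable {R : ℕ} {b : Fin R → ℂ} {n : ℕ} {τi τj : ℝ}

theorem pathIntegrand_eq (hb : ∀ r, b r ≠ 0)
    (h : ∏ r, (Polynomial.X - Polynomial.C (1 / b r ^ 2)) =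
      ∑ k ∈ Finset.range (R + 1),
        Polynomial.C ((-1 : ℂ) ^ k / (k.factorial : ℂ)) * Polynomial.X ^ (R - k))
    (hn : n ≠ 0) (hi : 1 - 2 * ((n : ℝ) ^ (-scalingExponent R) * τi) ≠ 0)
    (hj : 1 - 2 * ((n : ℝ) ^ (-scalingExponent R) * τj) ≠ 0) (x y : ℝ) (σ κ : ℂ) :
    pathIntegrand (endPoints b n) (scaledTime R n τi) (scaledTime R n τj) (scaledPos R n x)
      (scaledPos R n y) (Real.sqrt n * σ) (Real.sqrt n * κ) =
      (Real.sqrt n : ℂ)⁻¹ *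
        (lineFactor R n τj y σ * circleFactor R n τi x κ / (σ - κ)) := by
  have hn' : (n : ℂ) ≠ 0 := by exact_mod_cast hn
  have hm : ((Real.sqrt n : ℝ) : ℂ) ^ 2 = n := by
    rw [← Complex.ofReal_pow, Real.sq_sqrt (Nat.cast_nonneg n), Complex.ofReal_natCast]
  have hf : (fineScale R n : ℂ) ≠ 0 := by exact_mod_cast (fineScale_pos R hn).ne'
  have a1 : ((scaledTime R n τi / (1 - scaledTime R n τi) : ℝ) : ℂ) * n =
      timeRate R n τi / (fineScale R n : ℂ) ^ 2 + n := by exact_mod_cast scaledTime_ratio hn hi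
  have a2 : ((scaledTime R n τj / (1 - scaledTime R n τj) : ℝ) : ℂ) * n =
      timeRate R n τj / (fineScale R n : ℂ) ^ 2 + n := by exact_mod_cast scaledTime_ratio hn hj
  have a3 : 2 * (scaledPos R n x : ℂ) * (Real.sqrt n : ℂ) / (1 - (scaledTime R n τi : ℂ)) =
      timeSlope R n τi / (fineScale R n : ℂ) * x := by exact_mod_cast scaledPos_ratio x hn hi
  have a4 : 2 * (scaledPos R n y : ℂ) * (Real.sqrt n : ℂ) / (1 - (scaledTime R n τj : ℂ)) =
      timeSlope R n τj / (fineScale R n : ℂ) * y := by exact_mod_cast scaledPos_ratio y hn hj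
  have a6 : ∀ s : ℂ, (fineScale R n : ℂ) * (s / fineScale R n) = s := fun s =>
    mul_div_cancel₀ s hf
  have a5 : ∀ s : ℂ, -((((Real.sqrt n : ℝ) : ℂ) * s) ^ 2 / (n : ℂ)) = -s ^ 2 := by
    intro s
    rw [mul_pow, hm, mul_div_cancel_left₀ _ hn']
  rw [pathIntegrand, prod_endPoints b hb h hn, a5, a5, expTrunc_pow_eq, expTrunc_pow_eq,
    lineFactor, circleFactor, weight, weight, a6, a6, ← mul_sub]
  set A := ((scaledTime R n τi / (1 - scaledTime R n τi) : ℝ) : ℂ)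
  set A' := ((scaledTime R n τj / (1 - scaledTime R n τj) : ℝ) : ℂ)
  set m := ((Real.sqrt n : ℝ) : ℂ)
  have key : Complex.exp (-A * (m * κ) ^ 2 + 2 * (scaledPos R n x) * (m * κ) /
      (1 - scaledTime R n τi) + A' * (m * σ) ^ 2 - 2 * (m * σ) * (scaledPos R n y) /
      (1 - scaledTime R n τj)) * Complex.exp (-(n * σ ^ 2)) * (Complex.exp (-(n * κ ^ 2)))⁻¹ =
      Complex.exp (-(timeSlope R n τj * (σ / fineScale R n)) * y) *
        Complex.exp (timeRate R n τj * (σ / fineScale R n) ^ 2) *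
        Complex.exp (timeSlope R n τi * (κ / fineScale R n) * x) *
        (Complex.exp (timeRate R n τi * (κ / fineScale R n) ^ 2))⁻¹ := by
    simp only [← Complex.exp_neg, ← Complex.exp_add]
    congr 1
    linear_combination σ ^ 2 * a2 - κ ^ 2 * a1 + κ * a3 - σ * a4 + (A' * σ ^ 2 - A * κ ^ 2) * hm
  calc _ = (Complex.exp (-A * (m * κ) ^ 2 + 2 * (scaledPos R n x) * (m * κ) /
        (1 - scaledTime R n τi) + A' * (m * σ) ^ 2 - 2 * (m * σ) * (scaledPos R n y) /
        (1 - scaledTime R n τj)) * Complex.exp (-(n * σ ^ 2)) * (Complex.exp (-(n * κ ^ 2)))⁻¹) *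
        (expQuot R (-σ ^ 2) ^ n * (expQuot R (-κ ^ 2) ^ n)⁻¹ * m⁻¹ * (σ - κ)⁻¹) := by
        simp only [div_eq_mul_inv, mul_inv]; ring
    _ = _ := by rw [key]; simp only [div_eq_mul_inv, mul_inv]; ring

/-- A polynomial grows more slowly than `exp(ε |w|)` for every `ε > 0`; each monomial is compared
with one term of that series. -/
theorem exists_norm_expTrunc_le (R : ℕ) {ε : ℝ} (hε : 0 < ε) :
    ∃ C : ℝ, 0 ≤ C ∧ ∀ w : ℂ, ‖expTrunc R w‖ ≤ C * Real.exp (ε * ‖w‖) := by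
  refine ⟨∑ k ∈ Finset.range (R + 1), (ε ^ k)⁻¹, by positivity, fun w => ?_⟩
  rw [expTrunc, Finset.sum_mul]
  refine norm_sum_le_of_le _ fun k _ => ?_
  have h1 := Real.pow_div_factorial_le_exp (ε * ‖w‖) (by positivity) k
  rw [norm_div, norm_pow, Complex.norm_natCast]
  rw [mul_pow, mul_div_assoc] at h1
  rw [inv_mul_eq_div, le_div_iff₀ (by positivity)]
  linarith

/-- With `α = r + n`, the quadratic exponent gives `-α` times the square of the imaginary part. The
truncated exponential costs `α/4` of this and the linear term `α/2`, which leaves `α/4`. -/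
theorem exists_strip_bound (R : ℕ) {n : ℕ} (hn : n ≠ 0) (p : ℂ) {r : ℝ} (hr : 0 < r + n) (A : ℝ) :
    ∃ C : ℝ, ∀ s : ℂ, |s.re| ≤ A →
      ‖Complex.exp (p * s + r * s ^ 2) * expQuot R (-s ^ 2) ^ n‖ ≤
        C * Real.exp (-((r + n) / 4) * s.im ^ 2) := by
  set α := r + n with hα
  have hn' : (0 : ℝ) < n := by positivity
  obtain ⟨C, hC0, hC⟩ := exists_norm_expTrunc_le R (ε := α / 4 / n) (by positivity)
  refine ⟨C ^ n * Real.exp (‖p‖ * A + 2 * α * A ^ 2 + ‖p‖ ^ 2 / (2 * α)), fun s hs => ?_⟩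
  have e1 : ‖s‖ ^ 2 = s.re ^ 2 + s.im ^ 2 := by rw [Complex.sq_norm, Complex.normSq_apply]; ring
  have e2 : Complex.exp (p * s + r * s ^ 2) * expQuot R (-s ^ 2) ^ n =
      Complex.exp (p * s + α * s ^ 2) * expTrunc R (-s ^ 2) ^ n := by
    have h1 : Complex.exp (p * s + α * s ^ 2) =
        Complex.exp (p * s + r * s ^ 2) * Complex.exp (n * s ^ 2) := by
      rw [← Complex.exp_add, hα]; congr 1; push_cast; ring
    rw [expTrunc_pow_eq, h1, Complex.exp_neg]
    have := Complex.exp_ne_zero (n * s ^ 2)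
    field_simp
  have e3 : ‖Complex.exp (p * s + α * s ^ 2)‖ ≤
      Real.exp (‖p‖ * (|s.re| + |s.im|) + α * (s.re ^ 2 - s.im ^ 2)) := by
    rw [Complex.norm_exp, Complex.add_re, Complex.re_ofReal_mul]
    refine Real.exp_le_exp.2 (add_le_add ((Complex.re_le_norm _).trans ?_) (le_of_eq ?_))
    · rw [norm_mul]
      exact mul_le_mul_of_nonneg_left (Complex.norm_le_abs_re_add_abs_im s) (norm_nonneg _)
    · rw [sq, Complex.mul_re]; ring
  have e4 : ‖expTrunc R (-s ^ 2) ^ n‖ ≤ C ^ n * Real.exp (α / 4 * (s.re ^ 2 + s.im ^ 2)) := by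
    rw [norm_pow]
    refine (pow_le_pow_left₀ (norm_nonneg _) (hC _) n).trans (le_of_eq ?_)
    rw [mul_pow, ← Real.exp_nat_mul, norm_neg, norm_pow, e1]
    congr 2
    field_simp
  rw [e2, norm_mul]
  calc _ ≤ Real.exp (‖p‖ * (|s.re| + |s.im|) + α * (s.re ^ 2 - s.im ^ 2)) *
        (C ^ n * Real.exp (α / 4 * (s.re ^ 2 + s.im ^ 2))) :=
        mul_le_mul e3 e4 (norm_nonneg _) (Real.exp_pos _).le
    _ = C ^ n * Real.exp (‖p‖ * (|s.re| + |s.im|) + α * (s.re ^ 2 - s.im ^ 2) +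
          α / 4 * (s.re ^ 2 + s.im ^ 2)) := by rw [Real.exp_add _ (α / 4 * _)]; ring
    _ ≤ C ^ n * Real.exp (‖p‖ * A + 2 * α * A ^ 2 + ‖p‖ ^ 2 / (2 * α) +
          -(α / 4) * s.im ^ 2) := by
        refine mul_le_mul_of_nonneg_left (Real.exp_le_exp.2 ?_) (by positivity)
        have h1 : s.re ^ 2 ≤ A ^ 2 := by
          rw [← sq_abs]; exact pow_le_pow_left₀ (abs_nonneg _) hs 2
        have h2 : ‖p‖ * |s.im| ≤ ‖p‖ ^ 2 / (2 * α) + α / 2 * s.im ^ 2 := by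
          have : ‖p‖ ^ 2 / (2 * α) + α / 2 * s.im ^ 2 - ‖p‖ * |s.im| =
              (‖p‖ - α * |s.im|) ^ 2 / (2 * α) := by
            rw [← sq_abs s.im]; field_simp; ring
          have h3 : 0 ≤ (‖p‖ - α * |s.im|) ^ 2 / (2 * α) := by positivity
          linarith
        have h3 := mul_le_mul_of_nonneg_left hs (norm_nonneg p)
        have h4 := mul_le_mul_of_nonneg_left h1 hr.le
        have h5 : 0 ≤ α * A ^ 2 := by positivity
        linarith
    _ = _ := by rw [Real.exp_add]; ring

theorem circleIntegral_scale {m : ℝ} (hm : m ≠ 0) (ρ : ℝ) (f : ℂ → ℂ) :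
    (∮ t in C(0, ρ), f t) = ∮ t in C(0, ρ / m), m * f (m * t) := by
  have hm' : (m : ℂ) ≠ 0 := by exact_mod_cast hm
  simp only [circleIntegral, deriv_circleMap, smul_eq_mul]
  congr 1
  funext θ
  have : circleMap 0 ρ θ = m * circleMap 0 (ρ / m) θ := by
    simp only [circleMap, zero_add]; push_cast; field_simp
  rw [this]
  ring

theorem integral_line_scale {m : ℝ} (hm : 0 < m) (c : ℝ) (g : ℂ → ℂ) :
    ∫ v : ℝ, g (c + v * Complex.I) = m * ∫ v : ℝ, g (m * ((c / m : ℝ) + v * Complex.I)) := by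
  have hm' : (m : ℂ) ≠ 0 := by exact_mod_cast hm.ne'
  have h := MeasureTheory.Measure.integral_comp_mul_left (fun v : ℝ => g (c + v * Complex.I)) m
  have e : ∀ v : ℝ, g (m * ((c / m : ℝ) + v * Complex.I)) = g (c + (m * v : ℝ) * Complex.I) := by
    intro v; congr 1; push_cast; field_simp
  simp only [e]
  rw [h, abs_of_pos (inv_pos.2 hm), Complex.real_smul, Complex.ofReal_inv,
    mul_inv_cancel_left₀ hm']

variable {θ₁ : ℝ}

/-- The deformation applies with `N = lineFactor` and `D = circleFactor`: at equal arguments the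
powers of `expQuot` cancel, so the product `e` is entire. -/
theorem pathIntegral_eq_deformed (hθ : GoodEnd R θ₁) (hb : ∀ r, b r ≠ 0)
    (h : ∏ r, (Polynomial.X - Polynomial.C (1 / b r ^ 2)) =
      ∑ k ∈ Finset.range (R + 1),
        Polynomial.C ((-1 : ℂ) ^ k / (k.factorial : ℂ)) * Polynomial.X ^ (R - k))
    (hn : n ≠ 0) (hi : 1 - 2 * ((n : ℝ) ^ (-scalingExponent R) * τi) ≠ 0)
    (hj : 0 < 1 - 2 * ((n : ℝ) ^ (-scalingExponent R) * τj))
    (hj' : 0 < 1 + 2 * ((n : ℝ) ^ (-scalingExponent R) * τj)) {ρ c : ℝ}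
    (hρ : ∀ r, Real.sqrt n * ‖b r‖ < ρ) (hc : ρ < |c|) (x y : ℝ) :
    (∮ t in C(0, ρ), ∫ v : ℝ, pathIntegrand (endPoints b n) (scaledTime R n τi)
      (scaledTime R n τj) (scaledPos R n x) (scaledPos R n y) (c + v * Complex.I) t * Complex.I) =
      Real.sqrt n * Complex.I * ∫ v : ℝ, lineFactor R n τj y (v * Complex.I) *
        deformedInt R θ₁ (fun t => circleFactor R n τi x t / (v * Complex.I - t)) := by
  have hm : 0 < Real.sqrt n := Real.sqrt_pos.2 (by positivity)
  have hm' : (Real.sqrt n : ℂ) ≠ 0 := by exact_mod_cast hm.ne'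
  have hf := fineScale_pos R hn
  have hf' : (fineScale R n : ℂ) ≠ 0 := by exact_mod_cast hf.ne'
  have hfs : ∀ s : ℂ, (fineScale R n : ℂ) * (s / fineScale R n) = s := fun s =>
    mul_div_cancel₀ s hf'
  have e1 : (∮ t in C(0, ρ), ∫ v : ℝ, pathIntegrand (endPoints b n) (scaledTime R n τi)
      (scaledTime R n τj) (scaledPos R n x) (scaledPos R n y) (c + v * Complex.I) t * Complex.I) =
      ∮ t in C(0, ρ / Real.sqrt n), Real.sqrt n * Complex.I * ∫ v : ℝ,
        lineFactor R n τj y ((c / Real.sqrt n : ℝ) + v * Complex.I) * circleFactor R n τi x t /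
          ((c / Real.sqrt n : ℝ) + v * Complex.I - t) := by
    rw [circleIntegral_scale hm.ne']
    refine congrArg (fun F : ℂ → ℂ => ∮ t in C(0, ρ / Real.sqrt n), F t) (funext fun t => ?_)
    rw [integral_line_scale hm c fun s => pathIntegrand (endPoints b n) (scaledTime R n τi)
      (scaledTime R n τj) (scaledPos R n x) (scaledPos R n y) s (Real.sqrt n * t) * Complex.I]
    simp only [pathIntegrand_eq hb h hn hi hj.ne' x y]
    rw [MeasureTheory.integral_mul_const, MeasureTheory.integral_const_mul,
      mul_assoc (Real.sqrt n : ℂ)⁻¹, mul_inv_cancel_left₀ hm']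
    ring
  rw [e1, circleIntegral.integral_const_mul]
  congr 1
  -- This is `n τ / (1 - τ)` at the scaled time `τ`, which lies in `(0, 1)`; it provides the decay
  -- along vertical lines.
  have hr : 0 < timeRate R n τj / fineScale R n ^ 2 + n := by
    rw [← scaledTime_ratio hn hj.ne']
    have h1 : 0 < scaledTime R n τj := by rw [scaledTime]; linarith
    have h2 : 0 < 1 - scaledTime R n τj := by rw [scaledTime]; linarith
    positivity
  have hw := differentiable_weight R n τj
  have hwi := differentiable_weight R n τi
  refine circle_line_eq_deformed hθ
    (e := fun κ => Complex.exp (-(timeSlope R n τj * (κ / fineScale R n)) * y) *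
      Complex.exp (timeRate R n τj * (κ / fineScale R n) ^ 2) *
      (Complex.exp (timeSlope R n τi * (κ / fineScale R n) * x) *
      (Complex.exp (timeRate R n τi * (κ / fineScale R n) ^ 2))⁻¹))
    (a := (timeRate R n τj / fineScale R n ^ 2 + n) / 4) ?_ ?_ ?_ ?_ (by positivity) ?_ ?_ ?_
  · unfold lineFactor
    fun_prop
  · intro κ hκ
    have h1 : weight R n τi (κ / fineScale R n) ≠ 0 := by
      rw [weight, hfs]
      exact mul_ne_zero (Complex.exp_ne_zero _) (pow_ne_zero _ hκ)
    unfold circleFactor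
    have h2 : DifferentiableAt ℂ (fun κ => weight R n τi (κ / fineScale R n)) κ := by fun_prop
    exact DifferentiableAt.mul (by fun_prop) (h2.inv h1)
  · have h1 : ∀ κ : ℂ, Complex.exp (timeRate R n τi * (κ / fineScale R n) ^ 2) ≠ 0 := fun κ =>
      Complex.exp_ne_zero _
    have h2 : Differentiable ℂ fun κ : ℂ =>
      (Complex.exp (timeRate R n τi * (κ / fineScale R n) ^ 2))⁻¹ :=
      Differentiable.inv (by fun_prop) h1
    fun_prop
  · intro κ hκ
    rw [lineFactor, circleFactor, weight, weight, hfs]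
    have := pow_ne_zero n hκ
    have := Complex.exp_ne_zero (timeRate R n τi * (κ / fineScale R n) ^ 2)
    field_simp
  · intro A
    obtain ⟨C, hC⟩ := exists_strip_bound R hn (-(timeSlope R n τj / fineScale R n * y)) hr A
    refine ⟨C, fun s hs => ?_⟩
    have e2 : lineFactor R n τj y s =
        Complex.exp (-(timeSlope R n τj / fineScale R n * y) * s +
          ((timeRate R n τj / fineScale R n ^ 2 : ℝ) : ℂ) * s ^ 2) * expQuot R (-s ^ 2) ^ n := by
      rw [lineFactor, weight, hfs, ← mul_assoc, ← Complex.exp_add]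
      congr 2
      push_cast
      field_simp
    rw [e2]
    exact hC s hs
  · have hR : 1 ≤ R := hθ.one_le
    have hρ0 : 0 < ρ := lt_of_le_of_lt (by positivity) (hρ ⟨0, hR⟩)
    refine ⟨by positivity, fun κ hκ => ?_⟩
    have h1 : expTrunc R (-((Real.sqrt n * κ) ^ 2 / n)) = 0 := by
      have hmm : ((Real.sqrt n : ℝ) : ℂ) ^ 2 = n := by
        rw [← Complex.ofReal_pow, Real.sq_sqrt (Nat.cast_nonneg n), Complex.ofReal_natCast]
      have hn' : (n : ℂ) ≠ 0 := by exact_mod_cast hn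
      rw [mul_pow, hmm, mul_div_cancel_left₀ _ hn']
      exact (expQuot_eq_zero_iff R _).1 hκ
    obtain ⟨r, hr⟩ := expTrunc_endPoints_eq_zero b hb h hn h1
    rw [norm_mul, Complex.norm_real, Real.norm_of_nonneg hm.le] at hr
    rw [lt_div_iff₀ hm, mul_comm, hr]
    exact hρ r
  · rw [abs_div, abs_of_pos hm]
    exact div_lt_div_of_pos_right hc hm

end Identity

/-! ### The kernel as a sum over rays, curves and arcs -/

/-- The contribution of a ray to the rescaled kernel. -/
def nearPart (R n : ℕ) (q : Bool × Bool) (τi τj : ℝ) : ℂ × ℂ → ℂ :=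
  laplace rayMeasure (fun ξ => timeSlope R n τi * (ξ.1 * nearDir R q))
      (fun ξ => -(timeSlope R n τj * (ξ.2 * Complex.I))) (nearDensity R n q τi τj)

/-- The contribution of a path away from the origin to the rescaled kernel. -/
def farPart (R n : ℕ) (γ γ' : ℝ → ℂ) (a b τi τj : ℝ) : ℂ × ℂ → ℂ :=
  laplace (pathMeasure a b) (fun ξ => timeSlope R n τi * (γ ξ.1 / fineScale R n))
      (fun ξ => -(timeSlope R n τj * (ξ.2 * Complex.I))) (farDensity R n γ γ' τi τj)

/-- All contributions to the rescaled kernel. -/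
def totalPart (R n : ℕ) (θ₁ τi τj : ℝ) (z : ℂ × ℂ) : ℂ :=
  ∑ q : Bool × Bool, (turn q : ℂ) * (nearPart R n q τi τj z +
    farPart R n (curvePath R q) (curveVel R q) (rayAngle R) θ₁ τi τj z +
    farPart R n (arcPath R θ₁ q) (arcVel R θ₁ q) θ₁ Real.pi τi τj z)

/-- The substitution `p ↦ h p` stretches `[0, 1]` to `[0, 1/h]`. The cutoff in `nearDensity` records
this end while the domain of integration stays fixed. -/
theorem near_integral_eq {R n : ℕ} (hn : n ≠ 0) (q : Bool × Bool) (τi τj v : ℝ) (x y : ℂ) :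
    lineFactor R n τj y (fineScale R n * (v * Complex.I)) *
      (∫ p in (0 : ℝ)..1, circleFactor R n τi x (p * nearDir R q) /
        (fineScale R n * (v * Complex.I) - p * nearDir R q) * nearDir R q) =
    ∫ p in Ioi (0 : ℝ), Complex.exp (timeSlope R n τi * (p * nearDir R q) * x +
      -(timeSlope R n τj * (v * Complex.I)) * y) * nearDensity R n q τi τj (p, v) := by
  have hf := fineScale_pos R hn
  have hf' : (fineScale R n : ℂ) ≠ 0 := by exact_mod_cast hf.ne'
  have hdiv : ∀ s : ℂ, fineScale R n * s / (fineScale R n : ℂ) = s := fun s =>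
    mul_div_cancel_left₀ s hf'
  set F : ℝ → ℂ := fun p => circleFactor R n τi x (p * nearDir R q) /
        (fineScale R n * (v * Complex.I) - p * nearDir R q) * nearDir R q with hF
  have h1 : ∫ p in (0 : ℝ)..1, F p =
      ∫ p in Ioi (0 : ℝ), (if fineScale R n * p ≤ 1 then fineScale R n * F (fineScale R n * p)
        else 0) := by
    have h2 := intervalIntegral.smul_integral_comp_mul_left (a := 0) (b := 1 / fineScale R n) F
      (fineScale R n)
    rw [mul_zero, mul_one_div_cancel hf.ne'] at h2
    rw [← h2, ← intervalIntegral.integral_smul,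
      intervalIntegral.integral_of_le (by positivity), ← MeasureTheory.integral_indicator
      measurableSet_Ioc, ← MeasureTheory.integral_indicator measurableSet_Ioi]
    congr 1
    funext p
    have hiff : fineScale R n * p ≤ 1 ↔ p ≤ 1 / fineScale R n := by
      rw [le_div_iff₀ hf, mul_comm]
    by_cases h3 : 0 < p
    · by_cases h4 : p ≤ 1 / fineScale R n <;> simp_all [indicator]
    · simp [indicator, h3]
  rw [h1, ← MeasureTheory.integral_const_mul]
  refine MeasureTheory.setIntegral_congr_fun measurableSet_Ioi fun p _ => ?_
  by_cases h3 : fineScale R n * p ≤ 1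
  · simp only [h3, if_true, nearDensity, hF, lineFactor, circleFactor, one_mul]
    have e1 : (fineScale R n : ℂ) * (v * Complex.I) - ((fineScale R n * p : ℝ) : ℂ) * nearDir R q =
        fineScale R n * (v * Complex.I - p * nearDir R q) := by push_cast; ring
    have e2 : ((fineScale R n * p : ℝ) : ℂ) * nearDir R q / fineScale R n = p * nearDir R q := by
      rw [Complex.ofReal_mul, mul_assoc, hdiv]
    rw [hdiv, e1, e2, Complex.exp_add, div_eq_mul_inv, mul_inv]
    field_simp
  · simp [h3, nearDensity]

theorem far_integral_eq {R n : ℕ} (hn : n ≠ 0) (γ γ' : ℝ → ℂ) {a b : ℝ} (hab : a ≤ b)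
    (τi τj v : ℝ) (x y : ℂ) :
    lineFactor R n τj y (fineScale R n * (v * Complex.I)) *
      (∫ θ in a..b, circleFactor R n τi x (γ θ) /
        (fineScale R n * (v * Complex.I) - γ θ) * γ' θ) =
    ∫ θ in Ioc a b, Complex.exp (timeSlope R n τi * (γ θ / fineScale R n) * x +
      -(timeSlope R n τj * (v * Complex.I)) * y) * farDensity R n γ γ' τi τj (θ, v) := by
  have hf := fineScale_pos R hn
  have hf' : (fineScale R n : ℂ) ≠ 0 := by exact_mod_cast hf.ne'
  have hdiv : ∀ s : ℂ, fineScale R n * s / (fineScale R n : ℂ) = s := fun s =>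
    mul_div_cancel_left₀ s hf'
  rw [intervalIntegral.integral_of_le hab, ← MeasureTheory.integral_const_mul]
  congr 1
  funext θ
  simp only [farDensity, lineFactor, circleFactor]
  rw [hdiv, Complex.exp_add, div_eq_mul_inv]
  ring

/-- The line is rescaled by `h` as well, and Fubini turns each iterated integral into a Laplace
integral on a product measure. -/
theorem line_deformed_eq_totalPart {R n : ℕ} {θ₁ : ℝ} (hθ : GoodEnd R θ₁) (hn : n ≠ 0) {τi τj : ℝ}
    {z : ℂ × ℂ}
    (hnear : ∀ q, MeasureTheory.Integrable (fun ξ : ℝ × ℝ =>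
      Complex.exp (timeSlope R n τi * (ξ.1 * nearDir R q) * z.1 +
        -(timeSlope R n τj * (ξ.2 * Complex.I)) * z.2) * nearDensity R n q τi τj ξ) rayMeasure)
    (hcurve : ∀ q, MeasureTheory.Integrable (fun ξ : ℝ × ℝ =>
      Complex.exp (timeSlope R n τi * (curvePath R q ξ.1 / fineScale R n) * z.1 +
        -(timeSlope R n τj * (ξ.2 * Complex.I)) * z.2) *
        farDensity R n (curvePath R q) (curveVel R q) τi τj ξ) (pathMeasure (rayAngle R) θ₁))
    (harc : ∀ q, MeasureTheory.Integrable (fun ξ : ℝ × ℝ =>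
      Complex.exp (timeSlope R n τi * (arcPath R θ₁ q ξ.1 / fineScale R n) * z.1 +
        -(timeSlope R n τj * (ξ.2 * Complex.I)) * z.2) *
        farDensity R n (arcPath R θ₁ q) (arcVel R θ₁ q) τi τj ξ) (pathMeasure θ₁ Real.pi)) :
    ∫ v : ℝ, lineFactor R n τj z.2 (v * Complex.I) *
        deformedInt R θ₁ (fun t => circleFactor R n τi z.1 t / (v * Complex.I - t)) =
      fineScale R n * totalPart R n θ₁ τi τj z := by
  have hf := fineScale_pos R hn
  have h1 := integral_line_scale hf 0 fun s => lineFactor R n τj z.2 s *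
        deformedInt R θ₁ (fun t => circleFactor R n τi z.1 t / (s - t))
  simp only [zero_div, Complex.ofReal_zero, zero_add] at h1
  rw [h1]
  congr 1
  have h2 : ∀ v : ℝ, lineFactor R n τj z.2 (fineScale R n * (v * Complex.I)) *
        deformedInt R θ₁ (fun t => circleFactor R n τi z.1 t /
          (fineScale R n * (v * Complex.I) - t)) =
      ∑ q : Bool × Bool, (turn q : ℂ) * ((∫ p in Ioi (0 : ℝ),
        Complex.exp (timeSlope R n τi * (p * nearDir R q) * z.1 +
      -(timeSlope R n τj * (v * Complex.I)) * z.2) * nearDensity R n q τi τj (p, v)) +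
        (∫ θ in Ioc (rayAngle R) θ₁,
          Complex.exp (timeSlope R n τi * (curvePath R q θ / fineScale R n) * z.1 +
          -(timeSlope R n τj * (v * Complex.I)) * z.2) *
          farDensity R n (curvePath R q) (curveVel R q) τi τj (θ, v)) +
        ∫ θ in Ioc θ₁ Real.pi,
          Complex.exp (timeSlope R n τi * (arcPath R θ₁ q θ / fineScale R n) * z.1 +
          -(timeSlope R n τj * (v * Complex.I)) * z.2) *
          farDensity R n (arcPath R θ₁ q) (arcVel R θ₁ q) τi τj (θ, v)) := by
    intro v
    rw [deformedInt, Finset.mul_sum]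
    refine Finset.sum_congr rfl fun q _ => ?_
    rw [← near_integral_eq hn, ← far_integral_eq hn _ _ hθ.lt.le,
      ← far_integral_eq hn _ _ hθ.lt_pi.le, quadrantInt]
    ring
  simp only [h2]
  have i1 := fun q => (hnear q).integral_prod_right
  have i2 := fun q => (hcurve q).integral_prod_right
  have i3 := fun q => (harc q).integral_prod_right
  refine Eq.trans (MeasureTheory.integral_finsetSum _ fun q _ =>
    (((i1 q).add (i2 q)).add (i3 q)).const_mul (turn q : ℂ)) ?_
  refine Finset.sum_congr rfl fun q _ => ?_
  rw [MeasureTheory.integral_const_mul]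
  have e1 := MeasureTheory.integral_prod_symm _ (hnear q)
  have e2 := MeasureTheory.integral_prod_symm _ (hcurve q)
  have e3 := MeasureTheory.integral_prod_symm _ (harc q)
  rw [nearPart, farPart, farPart, laplace, laplace, laplace]
  congr 1
  refine Eq.trans (MeasureTheory.integral_add ((i1 q).add (i2 q)) (i3 q)) ?_
  refine congrArg₂ (· + ·) (Eq.trans (MeasureTheory.integral_add (i1 q) (i2 q)) ?_) e3.symm
  exact congrArg₂ (· + ·) e1.symm e2.symm

/-! ### The limit of the rescaled kernel -/

theorem entireConv_exp_quadratic {c d : ℕ → ℂ} (hc : Tendsto c atTop (𝓝 0))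
    (hd : Tendsto d atTop (𝓝 0)) :
    EntireConv (fun n z => Complex.exp (c n * z.1 ^ 2 + d n * z.2 ^ 2)) (fun _ => 1) where
  contDiff := Eventually.of_forall fun n => by fun_prop
  contDiff_lim := contDiff_const
  tendsto z₀ := by
    have e1 : Tendsto (fun p : ℕ × (ℂ × ℂ) => p.2.1) (atTop ×ˢ 𝓝 z₀) (𝓝 z₀.1) :=
      (continuous_fst.tendsto z₀).comp tendsto_snd
    have e2 : Tendsto (fun p : ℕ × (ℂ × ℂ) => p.2.2) (atTop ×ˢ 𝓝 z₀) (𝓝 z₀.2) :=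
      (continuous_snd.tendsto z₀).comp tendsto_snd
    simpa using (((hc.comp tendsto_fst).mul (e1.pow 2)).add
      ((hd.comp tendsto_fst).mul (e2.pow 2))).cexp

/-- The factor in front of the integrals in the rescaled kernel. -/
def prefactor (R n : ℕ) (τi τj : ℝ) : ℂ :=
  -(1 / (2 * (Real.pi : ℂ) ^ 2)) *
    ((1 / Real.sqrt ((1 - scaledTime R n τi) * (1 - scaledTime R n τj)) : ℝ) : ℂ) * Complex.I

/-- The coefficient of the Gaussian factor in the rescaled kernel. -/
def gaussCoeff (R n : ℕ) (τ : ℝ) : ℝ :=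
  (n : ℝ) ^ (-scalingExponent R) / (1 - scaledTime R n τ)

/-- The rescaled kernel as an entire function. -/
def entireKernel (R n : ℕ) (θ₁ τi τj : ℝ) (z : ℂ × ℂ) : ℂ :=
  prefactor R n τi τj *
    Complex.exp (((-gaussCoeff R n τi : ℝ) : ℂ) * z.1 ^ 2 + (gaussCoeff R n τj : ℂ) * z.2 ^ 2) *
    totalPart R n θ₁ τi τj z

/-- The contribution of a ray to the limiting kernel. -/
def limitPart (R : ℕ) (q : Bool × Bool) (τi τj : ℝ) : ℂ × ℂ → ℂ :=
  laplace rayMeasure (fun ξ => 4 * (ξ.1 * nearDir R q)) (fun ξ => -(4 * (ξ.2 * Complex.I)))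
    (limitDensity R q τi τj)

/-- The limiting kernel as an entire function. -/
def entireLimit (R : ℕ) (τi τj : ℝ) (z : ℂ × ℂ) : ℂ :=
  -(1 / (Real.pi : ℂ) ^ 2) * Complex.I * 1 *
    ∑ q : Bool × Bool, (turn q : ℂ) * (limitPart R q τi τj z + 0 + 0)

theorem tendsto_scaledTime {R : ℕ} (hR : 1 ≤ R) (τ : ℝ) :
    Tendsto (fun n => scaledTime R n τ) atTop (𝓝 (1 / 2)) := by
  have h := ((tendsto_rpow_neg_scalingExponent hR).mul_const τ).const_add (1 / 2)
  rwa [zero_mul, add_zero] at h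

theorem tendsto_gaussCoeff {R : ℕ} (hR : 1 ≤ R) (τ : ℝ) :
    Tendsto (fun n => gaussCoeff R n τ) atTop (𝓝 0) := by
  have h := (tendsto_rpow_neg_scalingExponent hR).div ((tendsto_scaledTime hR τ).const_sub 1)
    (by norm_num)
  rwa [zero_div] at h

theorem tendsto_prefactor {R : ℕ} (hR : 1 ≤ R) (τi τj : ℝ) :
    Tendsto (fun n => prefactor R n τi τj) atTop (𝓝 (-(1 / (Real.pi : ℂ) ^ 2) * Complex.I)) := by
  have h1 : Tendsto (fun n => Real.sqrt ((1 - scaledTime R n τi) * (1 - scaledTime R n τj))) atTop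
      (𝓝 (1 / 2)) := by
    have := (((tendsto_scaledTime hR τi).const_sub 1).mul
      ((tendsto_scaledTime hR τj).const_sub 1)).sqrt
    have e : Real.sqrt ((1 - 1 / 2) * (1 - 1 / 2)) = 1 / 2 := by
      rw [Real.sqrt_mul_self (by norm_num)]; norm_num
    rwa [e] at this
  have h2 := (tendsto_const_nhds (x := (1 : ℝ))).div h1 (by norm_num)
  have h3 := (((Complex.continuous_ofReal.tendsto _).comp h2).const_mul
    (-(1 / (2 * (Real.pi : ℂ) ^ 2)))).mul_const Complex.I
  have e : -(1 / (2 * (Real.pi : ℂ) ^ 2)) * ((1 / (1 / 2) : ℝ) : ℂ) * Complex.I =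
      -(1 / (Real.pi : ℂ) ^ 2) * Complex.I := by push_cast; ring
  rw [e] at h3
  exact h3

theorem entireConv_kernel {R : ℕ} {θ₁ : ℝ} (hθ : GoodEnd R θ₁)
    (hl : ∀ θ : ℝ, θ₁ ≤ θ → θ ≤ Real.pi →
        1 + gapConst R ≤ ‖expQuot R (Complex.exp (curveLog R θ₁ + θ * Complex.I))‖) (τi τj : ℝ) :
    EntireConv (fun n => entireKernel R n θ₁ τi τj) (entireLimit R τi τj) := by
  have hR := hθ.one_le
  have h1 := EntireConv.const (tendsto_prefactor hR τi τj)
  have hg : ∀ τ, Tendsto (fun n => ((gaussCoeff R n τ : ℝ) : ℂ)) atTop (𝓝 0) := fun τ => by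
    have h := (Complex.continuous_ofReal.tendsto 0).comp (tendsto_gaussCoeff hR τ)
    rw [Complex.ofReal_zero] at h
    exact h
  have h2 := entireConv_exp_quadratic (c := fun n => ((-gaussCoeff R n τi : ℝ) : ℂ))
    (by simpa using (hg τi).neg) (hg τj)
  have h3 := EntireConv.sum Finset.univ fun (q : Bool × Bool) _ =>
    (EntireConv.const (tendsto_const_nhds (x := (turn q : ℂ)))).mul
      (((entireConv_near hR q τi τj).add
        (entireConv_far hR (farPath_curve hR hθ.lt.le hθ.lt_pi q) τi τj)).add
        (entireConv_far hR (farPath_arc hθ.lt hθ.lt_pi hl q) τi τj))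
  exact (h1.mul h2).mul h3

/-- The right-hand side contains neither circle nor line, whence the freedom in choosing admissible
contours. The powers of `n` cancel through `sqrt_mul_fineScale`. -/
theorem rescaledKernel_eq_entireKernel {R : ℕ} {θ₁ : ℝ} (hθ : GoodEnd R θ₁)
    (hl : ∀ θ : ℝ, θ₁ ≤ θ → θ ≤ Real.pi →
        1 + gapConst R ≤ ‖expQuot R (Complex.exp (curveLog R θ₁ + θ * Complex.I))‖)
    {b : Fin R → ℂ} (hb : ∀ r, b r ≠ 0)
    (h : ∏ r, (Polynomial.X - Polynomial.C (1 / b r ^ 2)) =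
      ∑ k ∈ Finset.range (R + 1),
        Polynomial.C ((-1 : ℂ) ^ k / (k.factorial : ℂ)) * Polynomial.X ^ (R - k)) (τi τj : ℝ)
    {ρ c : ℕ → ℝ} (hρ : ∀ (n : ℕ) (r : Fin R), Real.sqrt (n : ℝ) * ‖b r‖ < ρ n)
    (hc : ∀ n : ℕ, ρ n < |c n|) :
    ∀ᶠ n : ℕ in atTop, rescaledKernel b n (ρ n) (c n) τi τj =
      fun x y : ℝ => entireKernel R n θ₁ τi τj (x, y) := by
  have hR := hθ.one_le
  have ht : ∀ τ, Tendsto (fun n : ℕ => 2 * ((n : ℝ) ^ (-scalingExponent R) * τ)) atTop (𝓝 0) :=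
    fun τ => by simpa using ((tendsto_rpow_neg_scalingExponent hR).mul_const τ).const_mul 2
  have h1 := Filter.eventually_all.2 fun q => (laplaceDom_near hR q τi τj).eventually_integrable
  have h2 := Filter.eventually_all.2 fun q =>
    (laplaceDom_far hR (farPath_curve hR hθ.lt.le hθ.lt_pi q) τi τj).eventually_integrable
  have h3 := Filter.eventually_all.2 fun q =>
    (laplaceDom_far hR (farPath_arc hθ.lt hθ.lt_pi hl q) τi τj).eventually_integrable
  filter_upwards [h1, h2, h3, eventually_ne_atTop 0,
    (ht τi).eventually (eventually_lt_nhds one_pos), (ht τj).eventually (eventually_lt_nhds one_pos),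
    (ht τj).eventually (eventually_gt_nhds (by norm_num : (-1 : ℝ) < 0))]
    with n h1 h2 h3 hn h4 h5 h6
  funext x y
  have e1 := pathIntegral_eq_deformed hθ hb h hn (by linarith : (0 : ℝ) < 1 - _).ne'
    (by linarith) (by linarith) (hρ n) (hc n) x y (τi := τi) (τj := τj)
  have e2 := line_deformed_eq_totalPart hθ hn (z := ((x : ℂ), (y : ℂ))) (fun q => h1 q _)
    (fun q => h2 q _) (fun q => h3 q _)
  have e3 : (((n : ℝ) ^ (-(scalingExponent R / 2)) : ℝ) : ℂ) * (Real.sqrt n : ℂ) *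
      (fineScale R n : ℂ) = 1 := by exact_mod_cast sqrt_mul_fineScale R n hn
  have e4 : scaledPos R n y ^ 2 / (1 - scaledTime R n τj) -
      scaledPos R n x ^ 2 / (1 - scaledTime R n τi) =
      -gaussCoeff R n τi * x ^ 2 + gaussCoeff R n τj * y ^ 2 := by
    have hn' : (0 : ℝ) < n := by positivity
    have : ((n : ℝ) ^ (-(scalingExponent R / 2))) ^ 2 = (n : ℝ) ^ (-scalingExponent R) := by
      rw [← Real.rpow_natCast, ← Real.rpow_mul hn'.le]
      congr 1
      push_cast
      ring
    rw [scaledPos, scaledPos, gaussCoeff, gaussCoeff, mul_pow, mul_pow, this]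
    ring
  rw [rescaledKernel, pathKernel, e1, e2, e4, entireKernel, prefactor]
  push_cast
  linear_combination (-(1 / (2 * (Real.pi : ℂ) ^ 2)) *
    (1 / (Real.sqrt ((1 - scaledTime R n τi) * (1 - scaledTime R n τj)) : ℂ)) * Complex.I *
    Complex.exp (-(gaussCoeff R n τi : ℂ) * x ^ 2 + gaussCoeff R n τj * y ^ 2) *
    totalPart R n θ₁ τi τj (x, y)) * e3

/-! ### The limiting kernel -/

theorem limitIntegrand_mul_nearDir (R : ℕ) (q : Bool × Bool) (τi τj x y : ℝ) (ξ : ℝ × ℝ) :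
    limitIntegrand R τi τj x y (ξ.2 * Complex.I) (ξ.1 * nearDir R q) * nearDir R q =
      Complex.exp (4 * (ξ.1 * nearDir R q) * x + -(4 * (ξ.2 * Complex.I)) * y) *
        limitDensity R q τi τj ξ := by
  rw [limitIntegrand, limitDensity, limitWeight, limitWeight, ← Complex.exp_neg, div_eq_mul_inv]
  have : ∀ A B C D E w : ℂ, A = B + (C + D) → Complex.exp A * E * w =
      Complex.exp B * (Complex.exp C * Complex.exp D * w * E) := by
    intro A B C D E w h
    rw [h, Complex.exp_add, Complex.exp_add]; ring
  refine this _ _ _ _ _ _ ?_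
  ring

theorem nearDir_ne_zero (R : ℕ) (q : Bool × Bool) : nearDir R q ≠ 0 := by
  rw [← norm_pos_iff, norm_nearDir]; exact one_pos

theorem rayMeasure_eq : rayMeasure =
    (MeasureTheory.volume : MeasureTheory.Measure (ℝ × ℝ)).restrict (Ioi 0 ×ˢ univ) := by
  rw [rayMeasure, MeasureTheory.Measure.volume_eq_prod, ← MeasureTheory.Measure.prod_restrict,
    MeasureTheory.Measure.restrict_univ]

theorem integrableOn_limitIntegrand {R : ℕ} (hR : 1 ≤ R) (q : Bool × Bool) (τi τj x y : ℝ) :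
    MeasureTheory.IntegrableOn (fun p : ℝ × ℝ =>
      limitIntegrand R τi τj x y ((p.2 : ℂ) * Complex.I) ((p.1 : ℂ) * nearDir R q))
      (Ioi (0 : ℝ) ×ˢ (univ : Set ℝ)) := by
  have h := (integrable_limitDensity hR q τi τj (x, y)).mul_const (nearDir R q)⁻¹
  rw [rayMeasure_eq] at h
  refine h.congr (MeasureTheory.ae_of_all _ fun ξ => ?_)
  simp only
  rw [← limitIntegrand_mul_nearDir, mul_inv_cancel_right₀ (nearDir_ne_zero R q)]

theorem rayIntegral_nearDir {R : ℕ} (hR : 1 ≤ R) (q : Bool × Bool) (τi τj x y : ℝ) :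
    rayIntegral (nearDir R q) (fun t =>
        ∫ v : ℝ, limitIntegrand R τi τj x y ((v : ℂ) * Complex.I) t * Complex.I) =
      Complex.I * limitPart R q τi τj (x, y) := by
  have h := MeasureTheory.integral_prod _ (integrable_limitDensity hR q τi τj (x, y))
  rw [limitPart, laplace, rayIntegral]
  refine Eq.trans ?_ (congrArg (Complex.I * ·) h).symm
  simp only [← MeasureTheory.integral_const_mul, ← MeasureTheory.integral_mul_const]
  refine MeasureTheory.integral_congr_ae (MeasureTheory.ae_of_all _ fun p => ?_)
  refine MeasureTheory.integral_congr_ae (MeasureTheory.ae_of_all _ fun v => ?_)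
  simp only
  rw [← limitIntegrand_mul_nearDir R q τi τj x y (p, v)]
  ring

/-- The angle `Rπ/(2R+2)` is `π/2` less half of `rayAngle R`, so the rays of `C` are those along
which the deformed contour leaves the origin. -/
theorem rayDir_eq (R : ℕ) : rayDir R = nearDir R (true, false) := by
  have hR : (R : ℂ) + 1 ≠ 0 := by exact_mod_cast (Nat.succ_ne_zero R)
  simp only [rayDir, nearDir, axisDir, turnExp, turn, rayAngle, if_true]
  nth_rewrite 2 [← Complex.exp_pi_div_two_mul_I]
  rw [← Complex.exp_add]
  congr 1
  push_cast
  have : 2 * (R : ℂ) + 2 = 2 * (R + 1) := by ring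
  rw [this]
  field_simp
  simp

theorem neg_rayDir_eq (R : ℕ) : -rayDir R = nearDir R (false, false) := by
  rw [rayDir_eq]
  simp [nearDir, axisDir, turnExp, turn]

theorem rayDir_inv_eq (R : ℕ) : (rayDir R)⁻¹ = nearDir R (false, true) := by
  rw [rayDir_eq]
  simp only [nearDir, axisDir, turnExp, turn, if_true]
  rw [mul_inv, Complex.inv_I, ← Complex.exp_neg]
  simp

theorem neg_rayDir_inv_eq (R : ℕ) : -(rayDir R)⁻¹ = nearDir R (true, true) := by
  rw [rayDir_inv_eq]
  simp [nearDir, axisDir, turnExp, turn]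

/-- The signs of the four rays in `contourIntegral` are the values of `turn` in the corresponding
quadrants. -/
theorem limitKernel_eq {R : ℕ} (hR : 1 ≤ R) (τi τj : ℝ) :
    limitKernel R τi τj = fun x y : ℝ => entireLimit R τi τj (x, y) := by
  funext x y
  rw [limitKernel, contourIntegral, rayDir_inv_eq, ← rayDir_inv_eq, neg_rayDir_inv_eq,
    neg_rayDir_eq, rayDir_inv_eq, rayDir_eq]
  simp only [rayIntegral_nearDir hR]
  rw [entireLimit, Fintype.sum_prod_type, Fintype.sum_bool, Fintype.sum_bool, Fintype.sum_bool]
  simp only [turn]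
  push_cast
  simp
  ring

/-- The scaling limit of the extended kernel. -/
theorem scaling_limit {R : ℕ} (hR : 1 ≤ R) {b : Fin R → ℂ} (hb : ∀ r, b r ≠ 0)
    (h : ∏ r, (Polynomial.X - Polynomial.C (1 / b r ^ 2)) =
      ∑ k ∈ Finset.range (R + 1),
        Polynomial.C ((-1 : ℂ) ^ k / (k.factorial : ℂ)) * Polynomial.X ^ (R - k)) (τi τj : ℝ) :
    (∀ x y : ℝ, ∀ w ∈ ({rayDir R, -rayDir R,
        (rayDir R)⁻¹, -(rayDir R)⁻¹} : Set ℂ),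
      MeasureTheory.IntegrableOn (fun p : ℝ × ℝ =>
        limitIntegrand R τi τj x y ((p.2 : ℂ) * Complex.I) ((p.1 : ℂ) * w))
        (Ioi (0 : ℝ) ×ˢ (univ : Set ℝ))) ∧
    ContDiff ℝ ∞ (fun z : ℝ × ℝ => limitKernel R τi τj z.1 z.2) ∧
    (∀ ρ c : ℕ → ℝ, (∀ (n : ℕ) (r : Fin R), Real.sqrt (n : ℝ) * ‖b r‖ < ρ n) →
        (∀ n : ℕ, ρ n < |c n|) →
      (∀ᶠ n : ℕ in atTop, ContDiff ℝ ∞ (fun z : ℝ × ℝ =>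
        rescaledKernel b n (ρ n) (c n) τi τj z.1 z.2)) ∧
      ∀ (p q : ℕ) (S : Set (ℝ × ℝ)), Bornology.IsBounded S →
        TendstoUniformlyOn
          (fun n => partialDeriv p q
            (rescaledKernel b n (ρ n) (c n) τi τj))
          (partialDeriv p q (limitKernel R τi τj)) atTop S) ∧
    (τi < τj → ∀ n : ℕ, 1 ≤ n → ∀ x y : ℝ,
      rescaledGaussian R n τi τj x y =
        transitionDensity x y (τj - τi)) := by
  obtain ⟨θ₁, hθ1, hθ2, hθ3, hl⟩ := exists_closing_arc hR
  have hθ : GoodEnd R θ₁ := ⟨hR, hθ1, hθ2, hθ3⟩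
  have hconv := entireConv_kernel hθ hl τi τj
  refine ⟨fun x y w hw => ?_, ?_, fun ρ c hρ hc => ⟨?_, fun p q S hS => ?_⟩,
    fun hτ n hn x y => rescaledGaussian_eq R hτ hn x y⟩
  · obtain ⟨q, rfl⟩ : ∃ q, w = nearDir R q := by
      rcases hw with rfl | rfl | rfl | rfl
      exacts [⟨_, rayDir_eq R⟩, ⟨_, neg_rayDir_eq R⟩, ⟨_, rayDir_inv_eq R⟩,
        ⟨_, neg_rayDir_inv_eq R⟩]
    exact integrableOn_limitIntegrand hR q τi τj x y
  · rw [limitKernel_eq hR]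
    exact contDiff_real_of_complex hconv.contDiff_lim
  · filter_upwards [rescaledKernel_eq_entireKernel hθ hl hb h τi τj hρ hc, hconv.contDiff]
      with n h1 h2
    rw [h1]
    exact contDiff_real_of_complex h2
  · exact hconv.tendstoUniformlyOn_partialDeriv
      (rescaledKernel_eq_entireKernel hθ hl hb h τi τj hρ hc) (limitKernel_eq hR τi τj) p q hS

end HigherPearcey

end

theorem mainTheorem4 (R : ℕ) (hR : 1 ≤ R) (b : Fin R → ℂ) (hb : ∀ r, b r ≠ 0) :
    -- the `a_r = 1 / b_r²` are the roots (with multiplicity) of the equation if and only if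
    -- their first `R` power sums are `1, 0, …, 0`
    ((∏ r, (Polynomial.X - Polynomial.C (1 / b r ^ 2)) =
        ∑ k ∈ Finset.range (R + 1),
          Polynomial.C ((-1 : ℂ) ^ k / (k.factorial : ℂ)) * Polynomial.X ^ (R - k)) ↔
      (∑ r, 1 / b r ^ 2 = 1 ∧ ∀ k : ℕ, 2 ≤ k → k ≤ R → ∑ r, (1 / b r ^ 2) ^ k = 0)) ∧
    ((∏ r, (Polynomial.X - Polynomial.C (1 / b r ^ 2)) =
        ∑ k ∈ Finset.range (R + 1),
          Polynomial.C ((-1 : ℂ) ^ k / (k.factorial : ℂ)) * Polynomial.X ^ (R - k)) →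
      ∑ r, (1 / b r ^ 2) ^ (R + 1) = (-1 : ℂ) ^ (R + 1) / (R.factorial : ℂ) ∧
      ∀ τi τj : ℝ,
        -- the limiting double integral converges absolutely
        (∀ x y : ℝ, ∀ w ∈ ({HigherPearcey.rayDir R, -HigherPearcey.rayDir R,
            (HigherPearcey.rayDir R)⁻¹, -(HigherPearcey.rayDir R)⁻¹} : Set ℂ),
          MeasureTheory.IntegrableOn (fun p : ℝ × ℝ =>
            HigherPearcey.limitIntegrand R τi τj x y ((p.2 : ℂ) * Complex.I) ((p.1 : ℂ) * w))
            (Ioi (0 : ℝ) ×ˢ (univ : Set ℝ))) ∧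
        ContDiff ℝ ∞ (fun z : ℝ × ℝ => HigherPearcey.limitKernel R τi τj z.1 z.2) ∧
        -- convergence, for any choice of admissible contours before the limit
        (∀ ρ c : ℕ → ℝ, (∀ (n : ℕ) (r : Fin R), Real.sqrt (n : ℝ) * ‖b r‖ < ρ n) →
            (∀ n : ℕ, ρ n < |c n|) →
          (∀ᶠ n : ℕ in atTop, ContDiff ℝ ∞ (fun z : ℝ × ℝ =>
            HigherPearcey.rescaledKernel b n (ρ n) (c n) τi τj z.1 z.2)) ∧
          ∀ (p q : ℕ) (S : Set (ℝ × ℝ)), Bornology.IsBounded S →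
            TendstoUniformlyOn
              (fun n => HigherPearcey.partialDeriv p q
                (HigherPearcey.rescaledKernel b n (ρ n) (c n) τi τj))
              (HigherPearcey.partialDeriv p q (HigherPearcey.limitKernel R τi τj)) atTop S) ∧
        -- the Gaussian part of the kernel is unchanged by the scaling
        (τi < τj → ∀ n : ℕ, 1 ≤ n → ∀ x y : ℝ,
          HigherPearcey.rescaledGaussian R n τi τj x y =
            HigherPearcey.transitionDensity x y (τj - τi))) := by
  refine ⟨?_, fun h => ⟨?_, fun τi τj => HigherPearcey.scaling_limit hR hb h τi τj⟩⟩
  · rw [HigherPearcey.prod_eq_iff_esymm (fun r => 1 / b r ^ 2)]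
    refine ⟨fun h => ?_, fun h => HigherPearcey.esymm_of_powerSums _ h.1 h.2⟩
    have h' := HigherPearcey.powerSums_of_esymm _ h
    exact ⟨h'.1 hR, h'.2⟩
  · exact HigherPearcey.powerSum_succ_of_esymm hR _
      ((HigherPearcey.prod_eq_iff_esymm (fun r => 1 / b r ^ 2)).1 h)
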